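/- An \emph{origami} of degree $d$ is the connected flat surface (a closed surface with a flat structure whose transition maps are $z\mapsto \pm z+c$, defined away from the vertices) obtained from $d$ unit squares by gluing all their edges in pairs, vertical edges to vertical ones and horizontal edges to horizontal ones, by maps $z\mapsto\pm z+c$. It is \emph{abelian} if the flat structure contains an atlas whose transition maps are translations. Its \emph{Veech group} is the set of all classes $\bar A\in PSL(2,\mathbb R)$ of derivatives of those self-homeomorphisms which preserve the set of vertices and are, away from it, locally of the form $z\mapsto Az+c$, with $A\in SL(2,\mathbb R)$, in the natural coordinates; two origamis are \emph{isomorphic} if there is such a homeomorphism between them with derivative $\pm I$. An origami is \emph{nontrivial} if it has a vertex of cone angle greater than $2\pi$ (that is, it is not a flat torus or a flat pillowcase). For permutations $x,y$ of $\{1,\dots,d\}$ and signs $\varepsilon_1,\dots,\varepsilon_d\in\{\pm1\}$, the origami $(x,y,\varepsilon)$ is obtained as follows: glue the right edge of square $i$ to the left edge of square $x(i)$ and the top edge of square $i$ to the bottom edge of square $y(i)$; then cut along all edges, reflect the squares with $\varepsilon_i=-1$ in a horizontal axis, and glue the same pairs of edges again by maps $z\mapsto\pm z+c$. The \emph{canonical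 double cover} of an origami consists of an upright copy and a copy rotated by $\pi$ of each square, glued by translations over the given pairs of edges. The \emph{Ornithorynque} is the abelian origami with $12$ squares that is the square-tiled cyclic cover $M_6(1,1,1,3)$, i.e. the normalization of the curve $w^6=(z-z_1)(z-z_2)(z-z_3)(z-z_4)^3$ with the flat structure pulled back from the pillowcase made of two unit squares with corners $z_1,z_2,z_3,z_4$. \textbf{Theorem.} The origami $$\mathcal O=(x,y,\varepsilon)=\bigl((1,2,3,4,5,6),\,(1,2,5,6,3,4),\,(-,+,-,+,-,+)\bigr)$$ of degree $6$ (with $x,y$ in cycle notation) is a (connected) nontrivial non-abelian origami whose Veech group is $PSL(2,\mathbb Z)$. Every nontrivial origami, abelian or not, with Veech group $PSL(2,\mathbb Z)$ has degree at least $6$, and every such origami of degree $6$ is isomorphic to $\mathcal O$. The canonical double cover of $\mathcal O$ is isomorphic to the Ornithorynque origami. -/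

import Mathlib

open Topology

/-- The four edges of the unit square. -/
inductive Side where
  | right | left | top | bottom
  deriving DecidableEq

namespace Side

/-- `true` for the two vertical edges, `false` for the two horizontal ones. -/
def isVertical : Side → Bool
  | right => true
  | left => true
  | top => false
  | bottom => false

/-- The edge obtained after rotating the square by the angle `π`. -/
def opp : Side → Side
  | right => left
  | left => right
  | top => bottom
  | bottom => top

/-- The edge obtained after the reflection that exchanges left and right. -/
def flipLR : Side → Side
  | right => left
  | left => right
  | top => top
  | bottom => bottom

/-- The edge obtained after the reflection that exchanges top and bottom. -/
def flipTB : Side → Side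
  | right => right
  | left => left
  | top => bottom
  | bottom => top

/-- The point with parameter `u` on an edge, vertical edges being parametrised upwards and
horizontal ones to the right. -/
def point : Side → unitInterval → unitInterval × unitInterval
  | right, u => (1, u)
  | left, u => (0, u)
  | top, u => (u, 1)
  | bottom, u => (u, 0)

end Side

/-- An origami with set of squares `ι` (possibly disconnected): the `4 * |ι|` edges of the squares
`[0,1] × [0,1]` are glued in pairs, vertical edges to vertical edges and horizontal edges to
horizontal edges. The degree is the number of squares. -/
structure Origami (ι : Type) where
  glue : ι × Side → ι × Side
  glue_glue : ∀ e, glue (glue e) = e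
  glue_ne : ∀ e, glue e ≠ e
  isVertical_glue : ∀ e, (glue e).2.isVertical = e.2.isVertical

namespace Origami

variable {ι κ : Type}

/-- The disjoint union of the closed unit squares. -/
abbrev Squares (ι : Type) : Type := (_ : ι) × (unitInterval × unitInterval)

/-- Elementary identifications. Opposite edges (right and left, or top and bottom) are glued by a
translation `z ↦ z + c`; equal edges are glued by a half rotation `z ↦ -z + c`. -/
def Rel (O : Origami ι) (p q : Squares ι) : Prop :=
  ∃ (s t : Side) (u : unitInterval), O.glue (p.1, s) = (q.1, t) ∧ p.2 = s.point u ∧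
    q.2 = t.point (if s = t then unitInterval.symm u else u)

/-- The closed surface obtained by gluing the squares, with the quotient topology. -/
abbrev Surface (O : Origami ι) : Type := Quot O.Rel

/-- The point of the surface represented by a point of the square `i`. -/
def pt (O : Origami ι) (i : ι) (z : unitInterval × unitInterval) : O.Surface :=
  Quot.mk _ ⟨i, z⟩

/-- Being one of the four corners of the unit square. -/
def IsCorner (z : unitInterval × unitInterval) : Prop :=
  (z.1 = 0 ∨ z.1 = 1) ∧ (z.2 = 0 ∨ z.2 = 1)

/-- The vertices of the surface: the images of the corners of the squares. -/
def vertices (O : Origami ι) : Set O.Surface :=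
  {p | ∃ i z, IsCorner z ∧ O.pt i z = p}

/-- The natural coordinate of a point of the unit square. -/
def coord (z : unitInterval × unitInterval) : ℝ × ℝ := (z.1, z.2)

/-- The natural coordinates of the flat structure on the complement of the vertices: the charts
that on each square are locally of the form `z ↦ ± z + c`. -/
def IsNatural (O : Origami ι) (e : OpenPartialHomeomorph O.Surface (ℝ × ℝ)) : Prop :=
  Disjoint e.source O.vertices ∧
  ∀ i z, O.pt i z ∈ e.source →
    ∃ (s : ℤˣ) (c : ℝ × ℝ), ∀ᶠ w in 𝓝 z, e (O.pt i w) = s • coord w + c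

/-- The linear map of the plane given by a matrix. -/
def planeMap (A : Matrix.SpecialLinearGroup (Fin 2) ℝ) (v : ℝ × ℝ) : ℝ × ℝ :=
  (A.1 0 0 * v.1 + A.1 0 1 * v.2, A.1 1 0 * v.1 + A.1 1 1 * v.2)

/-- `f` is a homeomorphism that respects the vertices and is, away from them, locally of the form
`v ↦ A v + c` in natural coordinates (which are defined up to `v ↦ ± v + c`). -/
def IsAffine (O : Origami ι) (O' : Origami κ) (A : Matrix.SpecialLinearGroup (Fin 2) ℝ)
    (f : O.Surface ≃ₜ O'.Surface) : Prop :=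
  f '' O.vertices = O'.vertices ∧
  ∀ p ∉ O.vertices, ∃ e e', O.IsNatural e ∧ O'.IsNatural e' ∧ p ∈ e.source ∧ f p ∈ e'.source ∧
    ∃ c : ℝ × ℝ, ∀ᶠ q in 𝓝 p, e' (f q) = planeMap A (e q) + c

/-- Isomorphism of flat surfaces: an affine homeomorphism with derivative `± 1`. -/
def Iso (O : Origami ι) (O' : Origami κ) : Prop :=
  ∃ f : O.Surface ≃ₜ O'.Surface, IsAffine O O' 1 f

/-- The Veech group: all classes in `PSL(2,ℝ)` of derivatives of affine self-homeomorphisms. -/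
def veechGroup (O : Origami ι) : Set (Matrix.ProjectiveSpecialLinearGroup (Fin 2) ℝ) :=
  {a | ∃ (A : Matrix.SpecialLinearGroup (Fin 2) ℝ) (f : O.Surface ≃ₜ O.Surface),
    IsAffine O O A f ∧ QuotientGroup.mk A = a}

/-- The flat structure is abelian if natural coordinates can be chosen around all points
that are not vertices so that all transition maps are locally translations. -/
def IsAbelian (O : Origami ι) : Prop :=
  ∃ T : Set (OpenPartialHomeomorph O.Surface (ℝ × ℝ)),
    (∀ e ∈ T, O.IsNatural e) ∧ (∀ p ∉ O.vertices, ∃ e ∈ T, p ∈ e.source) ∧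
    ∀ e ∈ T, ∀ e' ∈ T, ∀ p ∈ e.source ∩ e'.source,
      ∃ c : ℝ × ℝ, ∀ᶠ q in 𝓝 p, e' q = e q + c

/-- The number of corners of squares that meet at a point; the cone angle at a vertex is `π / 2`
times this number. -/
noncomputable def cornerCount (O : Origami ι) (v : O.Surface) : ℕ :=
  {c : Squares ι | IsCorner c.2 ∧ O.pt c.1 c.2 = v}.ncard

/-- Nontrivial: the quadratic differential has a zero, that is, some vertex has a cone angle larger
than `2 π`. The connected origamis excluded by this are the flat tori and the flat pillowcases. -/
def IsNontrivial (O : Origami ι) : Prop := ∃ v, 4 < O.cornerCount v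

/-- Change of the labels of the edges of a square when the square is reflected (`ε = -1`) in a
horizontal axis. -/
def reflect (ε : ℤˣ) (s : Side) : Side := if ε = 1 then s else s.flipTB

theorem reflect_reflect (ε : ℤˣ) (s : Side) : reflect ε (reflect ε s) = s := by
  unfold reflect; split_ifs <;> cases s <;> rfl

theorem isVertical_reflect (ε : ℤˣ) (s : Side) : (reflect ε s).isVertical = s.isVertical := by
  unfold reflect; split_ifs <;> cases s <;> rfl

/-- Gluing of the abelian origami `(x, y)`: the right edge of `i` to the left edge of `x i`, the top
edge of `i` to the bottom edge of `y i`. -/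
def permGlue (x y : Equiv.Perm ι) : ι × Side → ι × Side
  | (i, .right) => (x i, .left)
  | (i, .left) => (x⁻¹ i, .right)
  | (i, .top) => (y i, .bottom)
  | (i, .bottom) => (y⁻¹ i, .top)

theorem permGlue_permGlue (x y : Equiv.Perm ι) (e : ι × Side) :
    permGlue x y (permGlue x y e) = e := by
  obtain ⟨i, s⟩ := e
  cases s <;> simp [permGlue]

theorem permGlue_snd (x y : Equiv.Perm ι) (e : ι × Side) : (permGlue x y e).2 = e.2.opp := by
  obtain ⟨i, s⟩ := e
  cases s <;> rfl

/-- The origami `(x, y, ε)`: cut the abelian origami `(x, y)` at all edges, reflect the squares `i`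
with `ε i = -1` in a horizontal axis, and glue the same pairs of edges again, by maps
`z ↦ ± z + c`. -/
def ofPerms (x y : Equiv.Perm ι) (ε : ι → ℤˣ) : Origami ι where
  glue e :=
    let e' := permGlue x y (e.1, reflect (ε e.1) e.2)
    (e'.1, reflect (ε e'.1) e'.2)
  glue_glue e := by
    simp only [reflect_reflect, Prod.mk.eta, permGlue_permGlue]
  glue_ne e h := by
    have h1 := congrArg Prod.fst h
    have h2 := congrArg Prod.snd h
    simp only at h1 h2
    rw [h1, permGlue_snd] at h2
    have h3 := congrArg (reflect (ε e.1)) h2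
    rw [reflect_reflect] at h3
    revert h3
    generalize reflect (ε e.1) e.2 = t
    cases t <;> simp [Side.opp]
  isVertical_glue e := by
    simp only [isVertical_reflect, permGlue_snd]
    have h := isVertical_reflect (ε e.1) e.2
    revert h
    generalize reflect (ε e.1) e.2 = t
    cases t <;> exact id

/-- The canonical double cover: take two copies of every square, the copy `(i, true)` upright and
the copy `(i, false)` rotated by `π`, and glue the edges over the glued pairs of edges
in such a way that all gluings are translations. -/
def canonicalDouble (O : Origami ι) : Origami (ι × Bool) where
  glue e :=
    let s := if e.1.2 then e.2 else e.2.opp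
    let e' := O.glue (e.1.1, s)
    ((e'.1, decide (e'.2 = e.2.opp)), e.2.opp)
  glue_glue e := by
    obtain ⟨⟨i, b⟩, s⟩ := e
    have key : ∀ r : Side, r.isVertical = s.isVertical →
        (if decide (r = s.opp) = true then s.opp else s.opp.opp) = r := by
      intro r; revert s; cases r <;> intro s <;> cases s <;> decide
    have hv : (O.glue (i, if b then s else s.opp)).2.isVertical = s.isVertical := by
      rw [O.isVertical_glue]; cases b <;> cases s <;> rfl
    simp only [key _ hv, Prod.mk.eta, O.glue_glue]
    cases b <;> cases s <;> rfl
  glue_ne e h := by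
    have h2 := congrArg Prod.snd h
    revert h2
    generalize e.2 = t
    cases t <;> simp [Side.opp]
  isVertical_glue e := by
    generalize e.2 = t
    cases t <;> rfl

/-- Sheet shifts for the edges of the front face of the pillowcase, when the local monodromies at
its lower left, lower right and upper right corners are `a₁`, `a₂`, `a₃`. -/
def sheetShift {N : ℕ} (a₁ a₂ a₃ : ZMod N) : Side → ZMod N
  | .left => 0
  | .bottom => a₁
  | .right => a₁ + a₂
  | .top => a₁ + a₂ + a₃

/-- The square-tiled cyclic cover `M_N(a₁, a₂, a₃, a₄)`, `a₁ + a₂ + a₃ + a₄ = 0` in `ℤ/N`. The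
pillowcase consists of a front square (`true`) and a back square (`false`), glued along
their boundaries; the cover consists of `N` copies of both, and crossing an edge from the front
to the back changes the sheet by the shift of the edge, so that a small loop around the `k`-th
corner changes the sheet by `a_k`. It is the normalisation of the curve
`w ^ N = (z - z₁) ^ a₁ (z - z₂) ^ a₂ (z - z₃) ^ a₃ (z - z₄) ^ a₄`
with the pull-back of the flat structure of the pillowcase with corners `z₁, z₂, z₃, z₄`. -/
def cyclicCover {N : ℕ} (a₁ a₂ a₃ : ZMod N) : Origami (ZMod N × Bool) where
  glue e := match e with
    | ((j, true), s) => ((j + sheetShift a₁ a₂ a₃ s, false), s.flipLR)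
    | ((j, false), s) => ((j - sheetShift a₁ a₂ a₃ s.flipLR, true), s.flipLR)
  glue_glue e := by
    obtain ⟨⟨j, b⟩, s⟩ := e
    cases b <;> cases s <;> simp [Side.flipLR]
  glue_ne e := by
    obtain ⟨⟨j, b⟩, s⟩ := e
    cases b <;> simp
  isVertical_glue e := by
    obtain ⟨⟨j, b⟩, s⟩ := e
    cases b <;> cases s <;> rfl

/-- The Ornithorynque origami, `M_6(1, 1, 1, 3)`, with 12 squares. -/
def ornithorynque : Origami (ZMod 6 × Bool) := cyclicCover 1 1 1

end Origami

/-- `PSL(2,ℤ)` as a subgroup of `PSL(2,ℝ)`. -/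
def modularGroup : Subgroup (Matrix.ProjectiveSpecialLinearGroup (Fin 2) ℝ) :=
  ((QuotientGroup.mk' (Subgroup.center (Matrix.SpecialLinearGroup (Fin 2) ℝ))).comp
    (Matrix.SpecialLinearGroup.map (Int.castRingHom ℝ))).range

/-- The origami `((1,2,3,4,5,6), (1,2,5,6,3,4), (-,+,-,+,-,+))`, with labels lowered by one. -/
def charactaOrigami : Origami (Fin 6) :=
  Origami.ofPerms c[0, 1, 2, 3, 4, 5] c[0, 1, 4, 5, 2, 3] ![-1, 1, -1, 1, -1, 1]

/-! The group of the maps `v ↦ ± v + n` with `n` integral has a pillowcase as quotient, with four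
cone points: the classes of a vertex of the unit squares, of the centre of a square, and of the
midpoints of the vertical and of the horizontal edges. An origami is a covering of this pillowcase,
with arbitrary branching over the first point and branching of order exactly two over the three
others. In combinatorial terms, let `a`, `b`, `c` act on the `2 * d` placed squares (upright or
rotated by `π`) as the half rotations about the centre and about the midpoints of the left and of
the lower edge. These are involutions without fixed points, they generate a transitive group if the
surface is connected, and a bijection of placed squares that respects them is an isomorphism. Going
around a vertex is `c * a * b`, so this is not an involution if some cone angle exceeds `2 π`.

An affine homeomorphism lies over a linear map of the pillowcase, so its derivative is integral
(`IsAffine.exists_isOver`). Conversely, homeomorphisms over integral linear maps are affine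
(`IsOver.isAffine`), and those over the identity are relabellings of the placed squares
(`exists_equiv_of_isOver_one`). Since `S` and `T` generate `SL(2,ℤ)`, the Veech group is `PSL(2,ℤ)`
if there are homeomorphisms over these two matrices; and if it is, `(a, b, c)` is conjugate to `(b,
b * a * b, c)` and to `(a, a * c * a, b)` (`isModularTriple`).

This invariance makes `b * a` conjugate to `c * a * (b * a) ^ k` for all `k`, and to some further
words. In degree at most six there are at most twelve placed squares. If `b * a` has order at most
two, then `a`, `b`, `c` commute and `c * a * b` is an involution, which is the trivial case.
Otherwise a count shows that `b * a` has no fixed point (`mul_apply_ne`). A search evaluated by the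
kernel then starts from a longest orbit of `a` and `b` and rejects all tables in which a conjugate
of `b * a` has a fixed point or too long a cycle, or in which conjugate words have different numbers
of fixed points. One triple remains, and it has exactly twelve points (`Admissible.exists_equiv`),
which gives the minimal degree and the uniqueness at once. The assertions about the origami itself
are verified on explicit permutations of its placed squares. -/

/-! ### Enumeration of triples of involutions

The functions of this section are evaluated by the kernel; they are defined by recursors, which
makes this fast. -/

namespace TripleSearch

/-- The `i`-th hexadecimal digit of `t`. -/
def digit (t i : ℕ) : ℕ := Nat.mod (Nat.div t (Nat.pow 16 i)) 16

/-- A partial table of three maps on the labels `0, 1, …` is coded by a number whose digit at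
`3 * x + g` is `0` if the value of the `g`-th map at `x` is unknown, and the value plus `1`
otherwise. `eval t w (x + 1)` applies the letters of `w` to `x` one after the other, and returns
the result plus `1`, or `0` if it is unknown. -/
def eval (t : ℕ) (w : List ℕ) : ℕ → ℕ :=
  List.rec (fun v => v) (fun g _ ih v =>
    Nat.rec 0 (fun x _ => ih (digit t (Nat.add (Nat.mul 3 x) g))) v) w

/-- Starting from `v`, the word `w` may lead to `x` after at most `j` repetitions. -/
def mayReturn (t : ℕ) (w : List ℕ) (x : ℕ) (j : ℕ) : ℕ → Bool :=
  Nat.rec (fun _ => false) (fun _ ih v =>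
    Nat.rec true (fun y _ => Bool.rec (ih (Nat.succ y)) true (Nat.beq y x)) (eval t w v)) j

/-- The word `w` may move `x` and return to it after at most `m` repetitions. -/
def mayCycle (t m : ℕ) (w : List ℕ) (x : ℕ) : Bool :=
  Nat.rec true (fun y _ =>
    Bool.rec (mayReturn t w x (Nat.pred m) (Nat.succ y)) false (Nat.beq y x))
    (eval t w (Nat.succ x))

/-- `mayCycle` for a list of words. -/
def allCycle (t m : ℕ) (x : ℕ) (l : List (List ℕ)) : Bool :=
  List.rec true (fun w _ ih => Bool.rec false ih (mayCycle t m w x)) l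

/-- The words tested after a new entry for the `g`-th map. -/
def cycleWords (g : ℕ) : List (List ℕ) :=
  -- Each word starts with the letter `g`, because it is evaluated at the label whose `g`-th entry
  -- is new. All of them are conjugates of `b * a` in an invariant triple.
  Nat.rec [[0, 1], [0, 2], [0, 1, 2, 1]] (fun g _ => Nat.rec [[1, 0], [1, 2]] (fun _ _ =>
    [[2, 0], [2, 1], [2, 0, 1, 0], [2, 1, 0, 1], [2, 0, 1, 0, 1, 0], [2, 1, 0, 1, 0, 1]]) g) g

/-- Look for the first unknown entry of a table with `k` labels, in the given list of labels. -/
def findSlot (t k : ℕ) (l : List ℕ) (ifNone : Bool) (ifSome : ℕ → ℕ → Bool) : Bool :=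
  List.rec ifNone (fun x _ ih => Bool.rec ih
    (Nat.rec (ifSome 0 x) (fun _ _ => Nat.rec (ifSome 1 x) (fun _ _ =>
      Nat.rec (ifSome 2 x) (fun _ _ => ih) (digit t (Nat.add (Nat.mul 3 x) 2)))
      (digit t (Nat.add (Nat.mul 3 x) 1))) (digit t (Nat.add (Nat.mul 3 x) 0)))
    (Nat.blt x k)) l

/-- The number of labels below `k` fixed by a word. -/
def countFix (t : ℕ) (w : List ℕ) (k : ℕ) : ℕ :=
  Nat.rec 0 (fun k ih => Bool.rec ih (Nat.succ ih)
    (Nat.beq (eval t w (Nat.succ k)) (Nat.succ k))) k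

/-- The table of the origami `charactaOrigami`. -/
def targetTable : ℕ := 0x61b9ac4b9b8a297568c75746a531248313c2

/-- Relabelings of the tables found by the search. -/
def renamings : List ℕ :=
  [0xba9876543210, 0x456789ab0123, 0x23456789ab01, 0x10ba98765432]

/-- `p` renames the complete table `t` of `k` labels into the table `t'`. -/
def renames (t t' p : ℕ) (k : ℕ) : Bool :=
  Nat.rec true (fun k ih => [0, 1, 2].all (fun g =>
      Nat.beq (digit t' (Nat.add (Nat.mul 3 (digit p k)) g))
        (Nat.succ (digit p (Nat.pred (digit t (Nat.add (Nat.mul 3 k) g)))))) && ih) k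

/-- The words whose numbers of fixed points are compared. -/
def fixWords : List (List ℕ) := [[0, 2], [1, 2], [2, 0, 1, 0], [2, 1, 0, 1], [2, 1, 2, 0]]

/-- The test for complete tables. -/
def acceptLeaf (k t : ℕ) : Bool :=
  -- A complete table is harmless if words that ought to be conjugate, or their squares, have
  -- different numbers of fixed points.
  fixWords.any (fun w =>
    !Nat.beq (countFix t w k) (countFix t [0, 1] k) ||
    !Nat.beq (countFix t (w ++ w) k) (countFix t [0, 1, 0, 1] k)) ||
  (Nat.beq k 12 && renamings.any (fun p => renames t targetTable p 12))

/-- The available labels. -/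
def labels : List ℕ := [0, 1, 2, 3, 4, 5, 6, 7, 8, 9, 10, 11]

/-- The table `t` with the value `y` at `x` and `x` at `y` for the `g`-th map. -/
def addPair (t g x y : ℕ) : ℕ :=
  Nat.add (Nat.add t (Nat.mul (Nat.succ y) (Nat.pow 16 (Nat.add (Nat.mul 3 x) g))))
    (Nat.mul (Nat.succ x) (Nat.pow 16 (Nat.add (Nat.mul 3 y) g)))

/-- Branching over the possible values of the `g`-th map at `x`: one of the `k` labels in use, or
the next label. -/
def branch (t m g x k : ℕ) (next : ℕ → ℕ → Bool) (l : List ℕ) : Bool :=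
  List.rec true (fun y _ ih => Bool.rec (Bool.rec (Nat.rec
      (Nat.rec false (fun t' _ => Bool.rec ih (Bool.rec false ih
          (Bool.rec (next k (Nat.succ t')) (next (Nat.succ k) (Nat.succ t')) (Nat.beq y k)))
          (allCycle (Nat.succ t') m x (cycleWords g)))
        (addPair t g x y))
      -- For involutions the entry at `y` cannot be `x` while the entry at `x` is unknown. With the
      -- value `false` here, a successful search certifies that this does not occur.
      (fun z _ => Bool.rec ih false (Nat.beq z x))
      (digit t (Nat.add (Nat.mul 3 y) g)))
    ih (Nat.blt k y)) ih (Nat.beq y x)) l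

/-- All completions of the partial table `t` with `k` labels pass the test for complete tables. -/
def search (m : ℕ) (f : ℕ) : ℕ → ℕ → Bool :=
  Nat.rec (fun _ _ => false) (fun _ ih k t =>
    findSlot t k labels (acceptLeaf k t) (fun g x => branch t m g x k ih labels)) f

/-- The table of a single cycle with `2 * m` labels of two involutions. -/
def cycleTable : ℕ → ℕ
  | 3 => 0x15046053024031062
  | 4 => 0x17068075046053024031082
  | 5 => 0x1908a0970680750460530240310a2
  | 6 => 0x1b0ac0b908a0970680750460530240310c2
  | _ => 0

/-- The four start tables are the possible longest orbits of `a` and `b`. The fuel `40` is ample, as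
every level fills a pair of entries and twelve labels have eighteen pairs; exhausted fuel gives
`false`, so `true` certifies a complete search. -/
theorem search_three : search 3 40 6 (cycleTable 3) = true := by decide +kernel
theorem search_four : search 4 40 8 (cycleTable 4) = true := by decide +kernel
theorem search_five : search 5 40 10 (cycleTable 5) = true := by decide +kernel
theorem search_six : search 6 40 12 (cycleTable 6) = true := by decide +kernel

end TripleSearch

/-! ### Partial tables and the meaning of the search functions. -/

namespace TripleSearch

theorem digit_eq (t i : ℕ) : digit t i = t / 16 ^ i % 16 := rfl

/-- The digit to be filled is zero and `v` is below the base, so there is no carry. -/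
theorem digit_add {t i v : ℕ} (ht : digit t i = 0) (hv : v < 16) (j : ℕ) :
    digit (t + v * 16 ^ i) j = if j = i then v else digit t j := by
  rw [digit_eq] at ht
  simp only [digit_eq]
  rcases lt_trichotomy j i with h | h | h
  · rw [if_neg h.ne]
    obtain ⟨e, rfl⟩ := Nat.exists_eq_add_of_lt h
    rw [show v * 16 ^ (j + e + 1) = 16 ^ j * (16 * (v * 16 ^ e)) by ring,
      Nat.add_mul_div_left _ _ (by positivity), Nat.add_mul_mod_self_left]
  · subst h
    rw [if_pos rfl, mul_comm, Nat.add_mul_div_left _ _ (by positivity)]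
    omega
  · rw [if_neg h.ne']
    obtain ⟨e, rfl⟩ := Nat.exists_eq_add_of_lt h
    rw [show 16 ^ (i + e + 1) = 16 ^ i * (16 * 16 ^ e) by ring, ← Nat.div_div_eq_div_mul,
      ← Nat.div_div_eq_div_mul, ← Nat.div_div_eq_div_mul, ← Nat.div_div_eq_div_mul, mul_comm v,
      Nat.add_mul_div_left _ _ (by positivity)]
    congr 2
    omega

variable {Ω : Type*}

/-- The effect of a word on a point; the letters act from left to right. -/
def wordAct (act : ℕ → Ω → Ω) : List ℕ → Ω → Ω
  | [], p => p
  | g :: w, p => wordAct act w (act g p)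

/-- The partial table `t` with `k` labels is correct for the labelling `lab` of points. -/
structure Models (act : ℕ → Ω → Ω) (lab : ℕ → Ω) (k t : ℕ) : Prop where
  inj : ∀ x < k, ∀ y < k, lab x = lab y → x = y
  le : k ≤ 12
  entry : ∀ g < 3, ∀ x z, digit t (3 * x + g) = z + 1 → x < k ∧ z < k ∧ act g (lab x) = lab z

variable {act : ℕ → Ω → Ω} {lab : ℕ → Ω} {k t : ℕ}

theorem Models.eval_eq (h : Models act lab k t) {w : List ℕ} (hw : ∀ g ∈ w, g < 3) {x y : ℕ}
    (hx : x < k) (he : eval t w (x + 1) = y + 1) : y < k ∧ wordAct act w (lab x) = lab y := by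
  induction w generalizing x with
  | nil => obtain rfl : x = y := Nat.succ_injective he; exact ⟨hx, rfl⟩
  | cons g w ih =>
    replace he : eval t w (digit t (3 * x + g)) = y + 1 := he
    rcases hd : digit t (3 * x + g) with _ | z
    · rw [hd] at he
      have : eval t w 0 = 0 := by cases w <;> rfl
      omega
    · obtain ⟨-, hz, hg⟩ := h.entry g (hw g (by simp)) x z hd
      rw [hd] at he
      have := ih (fun g hg => hw g (by simp [hg])) hz he
      exact ⟨this.1, by rw [← this.2, ← hg]; rfl⟩

/-- Unknown values count as success. Hence the test fails only if the known entries show that the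
orbit misses `x` during all `j` repetitions. -/
theorem Models.mayReturn (h : Models act lab k t) {w : List ℕ} (hw : ∀ g ∈ w, g < 3) {x z j : ℕ}
    (hx : x < k) (hz : z < k) (i : ℕ) (hi : i < j)
    (hr : (wordAct act w)^[i + 1] (lab z) = lab x) : mayReturn t w x j (z + 1) = true := by
  induction j generalizing z i with
  | zero => omega
  | succ j ih =>
    show Nat.rec true (fun y _ => Bool.rec (TripleSearch.mayReturn t w x j (Nat.succ y)) true
      (Nat.beq y x)) (eval t w (z + 1)) = true
    rcases he : eval t w (z + 1) with _ | y
    · rfl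
    · obtain ⟨hy, hwy⟩ := h.eval_eq hw hz he
      dsimp only
      rcases hb : Nat.beq y x with _ | _
      · rcases i with _ | i
        · have : y = x := h.inj y hy x hx (by rw [← hwy, ← hr]; rfl)
          rw [this, Nat.beq_refl] at hb
          cases hb
        · refine ih hy i (by omega) ?_
          rw [← hwy, ← hr, Function.iterate_succ_apply _ (i + 1)]
      · rfl

theorem Models.mayCycle (h : Models act lab k t) {w : List ℕ} (hw : ∀ g ∈ w, g < 3) {x m : ℕ}
    (hx : x < k) (hm : ∀ p, wordAct act w p ≠ p ∧ ∃ i < m, (wordAct act w)^[i + 1] p = p) :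
    mayCycle t m w x = true := by
  show Nat.rec true (fun y _ => Bool.rec (TripleSearch.mayReturn t w x (Nat.pred m) (Nat.succ y))
    false (Nat.beq y x)) (eval t w (x + 1)) = true
  rcases he : eval t w (x + 1) with _ | y
  · rfl
  · obtain ⟨hy, hwy⟩ := h.eval_eq hw hx he
    obtain ⟨h1, i, hi, h2⟩ := hm (lab x)
    dsimp only
    rcases hb : Nat.beq y x with _ | _
    · rcases i with _ | i
      · exact absurd h2 h1
      · refine h.mayReturn hw hx hy i (by rw [Nat.pred_eq_sub_one]; omega) ?_
        rw [← hwy]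
        exact h2
    · rw [Nat.eq_of_beq_eq_true hb] at hwy
      exact absurd hwy h1

theorem Models.allCycle (h : Models act lab k t) {l : List (List ℕ)}
    (hw : ∀ w ∈ l, ∀ g ∈ w, g < 3) {x m : ℕ} (hx : x < k)
    (hm : ∀ w ∈ l, ∀ p, wordAct act w p ≠ p ∧ ∃ i < m, (wordAct act w)^[i + 1] p = p) :
    allCycle t m x l = true := by
  induction l with
  | nil => rfl
  | cons w l ih =>
    show Bool.rec false (TripleSearch.allCycle t m x l) (TripleSearch.mayCycle t m w x) = true
    rw [h.mayCycle (hw w (by simp)) hx (hm w (by simp))]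
    exact ih (fun w hw' => hw w (by simp [hw'])) (fun w hw' => hm w (by simp [hw']))

/-- The recursor in `branch` is a conjunction over the list in disguise; this isolates the conjunct
that belongs to a single value `y`. -/
theorem branch_spec {t m g x k : ℕ} {next : ℕ → ℕ → Bool} {l : List ℕ}
    (hb : branch t m g x k next l = true) {y : ℕ} (hy : y ∈ l) (hyx : y ≠ x) (hyk : y ≤ k) :
    (∀ z, digit t (3 * y + g) = z + 1 → z ≠ x) ∧
    (digit t (3 * y + g) = 0 → allCycle (addPair t g x y) m x (cycleWords g) = true →
      next (if y = k then k + 1 else k) (addPair t g x y) = true) := by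
  induction l with
  | nil => simp at hy
  | cons y' l ih =>
    replace hb : Bool.rec (Bool.rec (Nat.rec
        (Nat.rec false (fun t' _ => Bool.rec (branch t m g x k next l) (Bool.rec false
            (branch t m g x k next l)
            (Bool.rec (next k (Nat.succ t')) (next (Nat.succ k) (Nat.succ t')) (Nat.beq y' k)))
            (allCycle (Nat.succ t') m x (cycleWords g)))
          (addPair t g x y'))
        (fun z _ => Bool.rec (branch t m g x k next l) false (Nat.beq z x))
        (digit t (3 * y' + g)))
      (branch t m g x k next l) (Nat.blt k y')) (branch t m g x k next l) (Nat.beq y' x) = true :=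
      hb
    have key : branch t m g x k next l = true ∧ (y' ≠ x → y' ≤ k →
        (∀ z, digit t (3 * y' + g) = z + 1 → z ≠ x) ∧
        (digit t (3 * y' + g) = 0 → allCycle (addPair t g x y') m x (cycleWords g) = true →
          next (if y' = k then k + 1 else k) (addPair t g x y') = true)) := by
      generalize branch t m g x k next l = br at hb
      rcases h1 : Nat.beq y' x with _ | _
      · rw [h1] at hb
        rcases h2 : Nat.blt k y' with _ | _
        · rw [h2] at hb
          dsimp only at hb
          rcases hd : digit t (3 * y' + g) with _ | z
          · rw [hd] at hb
            have ha : addPair t g x y' ≠ 0 := by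
              simp [addPair]
            obtain ⟨t', ht'⟩ := Nat.exists_eq_succ_of_ne_zero ha
            rw [ht'] at hb ⊢
            dsimp only at hb
            rcases h3 : allCycle (Nat.succ t') m x (cycleWords g) with _ | _
            · rw [h3] at hb
              exact ⟨hb, fun _ _ => ⟨by simp, by simp⟩⟩
            · rw [h3] at hb
              rcases h4 : Nat.beq y' k with _ | _
              · rw [h4] at hb
                have h4' : y' ≠ k := Nat.ne_of_beq_eq_false h4
                rw [if_neg h4']
                rcases h5 : next k (Nat.succ t') with _ | _
                · rw [h5] at hb; cases hb
                · rw [h5] at hb; exact ⟨hb, fun _ _ => ⟨by simp, by simp⟩⟩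
              · rw [h4] at hb
                have h4' : y' = k := Nat.eq_of_beq_eq_true h4
                rw [if_pos h4']
                rcases h5 : next (k + 1) (Nat.succ t') with _ | _
                · dsimp only at hb; rw [h5] at hb; cases hb
                · dsimp only at hb; rw [h5] at hb; exact ⟨hb, fun _ _ => ⟨by simp, by simp⟩⟩
          · rw [hd] at hb
            dsimp only at hb
            rcases h3 : Nat.beq z x with _ | _
            · rw [h3] at hb
              refine ⟨hb, fun _ _ => ⟨fun z' hz' => ?_, by simp⟩⟩
              obtain rfl : z = z' := Nat.succ_injective hz'
              exact Nat.ne_of_beq_eq_false h3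
            · rw [h3] at hb; cases hb
        · rw [h2] at hb
          refine ⟨hb, fun _ h => ?_⟩
          simp only [Nat.blt_eq] at h2
          omega
      · rw [h1] at hb
        exact ⟨hb, fun h => absurd (Nat.eq_of_beq_eq_true h1) h⟩
    rcases List.mem_cons.1 hy with rfl | hy
    · exact key.2 hyx hyk
    · exact ih key.1 hy

theorem findSlot_spec {t k : ℕ} {l : List ℕ} {ifNone : Bool} {ifSome : ℕ → ℕ → Bool}
    (h : findSlot t k l ifNone ifSome = true) :
    (∃ x ∈ l, x < k ∧ ∃ g < 3, digit t (3 * x + g) = 0 ∧ ifSome g x = true) ∨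
    (ifNone = true ∧ ∀ x ∈ l, x < k → ∀ g < 3, digit t (3 * x + g) ≠ 0) := by
  induction l with
  | nil => exact Or.inr ⟨h, by simp⟩
  | cons x l ih =>
    replace h : Bool.rec (findSlot t k l ifNone ifSome)
      (Nat.rec (ifSome 0 x) (fun _ _ => Nat.rec (ifSome 1 x) (fun _ _ =>
      Nat.rec (ifSome 2 x) (fun _ _ => (findSlot t k l ifNone ifSome)) (digit t (3 * x + 2)))
      (digit t (3 * x + 1))) (digit t (3 * x + 0))) (Nat.blt x k) = true := h
    have lift : findSlot t k l ifNone ifSome = true →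
        (x < k → ∀ g < 3, digit t (3 * x + g) ≠ 0) →
        (∃ x' ∈ x :: l, x' < k ∧ ∃ g < 3, digit t (3 * x' + g) = 0 ∧ ifSome g x' = true) ∨
        (ifNone = true ∧ ∀ x' ∈ x :: l, x' < k → ∀ g < 3, digit t (3 * x' + g) ≠ 0) := by
      intro h1 h2
      rcases ih h1 with ⟨y, hy, h3⟩ | ⟨h3, h4⟩
      · exact Or.inl ⟨y, by simp [hy], h3⟩
      · refine Or.inr ⟨h3, fun y hy => ?_⟩
        rcases List.mem_cons.1 hy with rfl | hy
        · exact h2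
        · exact h4 y hy
    rcases hx : Nat.blt x k with _ | _
    · rw [hx] at h
      refine lift h fun h' => ?_
      rw [← Nat.blt_eq, hx] at h'
      cases h'
    · rw [hx] at h
      dsimp only at h
      rw [Nat.blt_eq] at hx
      rcases h0 : digit t (3 * x + 0) with _ | d0
      · rw [h0] at h
        exact Or.inl ⟨x, by simp, hx, 0, by norm_num, h0, h⟩
      rw [h0] at h
      dsimp only at h
      rcases h1 : digit t (3 * x + 1) with _ | d1
      · rw [h1] at h
        exact Or.inl ⟨x, by simp, hx, 1, by norm_num, h1, h⟩
      rw [h1] at h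
      dsimp only at h
      rcases h2 : digit t (3 * x + 2) with _ | d2
      · rw [h2] at h
        exact Or.inl ⟨x, by simp, hx, 2, by norm_num, h2, h⟩
      rw [h2] at h
      refine lift h fun _ g hg => ?_
      interval_cases g <;> omega

end TripleSearch

/-! ### Completeness of the search for admissible triples. -/

namespace TripleSearch

variable {Ω : Type*} {act : ℕ → Ω → Ω} {lab : ℕ → Ω} {k t m : ℕ}

/-- The hypotheses on three maps under which the search is complete. -/
structure Admissible (act : ℕ → Ω → Ω) (m : ℕ) : Prop where
  invol : ∀ g < 3, ∀ p, act g (act g p) = p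
  ne : ∀ g < 3, ∀ p, act g p ≠ p
  cycle : ∀ g < 3, ∀ w ∈ cycleWords g, ∀ p, wordAct act w p ≠ p ∧
    ∃ i < m, (wordAct act w)^[i + 1] p = p
  trans : ∀ S : Set Ω, S.Nonempty → (∀ g < 3, ∀ p ∈ S, act g p ∈ S) → S = Set.univ
  fix : ∀ w ∈ fixWords,
    {p | wordAct act w p = p}.ncard = {p | wordAct act [0, 1] p = p}.ncard ∧
    {p | wordAct act (w ++ w) p = p}.ncard = {p | wordAct act [0, 1, 0, 1] p = p}.ncard

theorem Models.addPair (h : Models act lab k t) {g x y : ℕ} (hg : g < 3) (hx : x < k) (hy : y < k)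
    (hxy : y ≠ x) (hdx : digit t (3 * x + g) = 0) (hdy : digit t (3 * y + g) = 0)
    (h1 : act g (lab x) = lab y) (h2 : act g (lab y) = lab x) :
    Models act lab k (addPair t g x y) := by
  have hk := h.le
  have hd : ∀ j, digit (TripleSearch.addPair t g x y) j = if j = 3 * y + g then x + 1 else
      if j = 3 * x + g then y + 1 else digit t j := by
    intro j
    show digit (t + (y + 1) * 16 ^ (3 * x + g) + (x + 1) * 16 ^ (3 * y + g)) j = _
    rw [digit_add _ (by omega), digit_add hdx (by omega)]
    rw [digit_add hdx (by omega), if_neg (by omega), hdy]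
  refine ⟨h.inj, h.le, fun g' hg' x' z hz => ?_⟩
  rw [hd] at hz
  split_ifs at hz with h3 h4
  · obtain rfl : x = z := Nat.succ_injective hz
    obtain rfl : x' = y := by omega
    obtain rfl : g' = g := by omega
    exact ⟨hy, hx, h2⟩
  · obtain rfl : y = z := Nat.succ_injective hz
    obtain rfl : x' = x := by omega
    obtain rfl : g' = g := by omega
    exact ⟨hx, hy, h1⟩
  · exact h.entry g' hg' x' z hz

/-- Distinct labels name distinct points, so the number of labels stays below the number of points
and the bound of twelve survives. -/
theorem Models.newLabel [Finite Ω] (hcard : Nat.card Ω ≤ 12) (h : Models act lab k t) {q : Ω}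
    (hq : ∀ y < k, q ≠ lab y) :
    Models act (Function.update lab k q) (k + 1) t := by
  have hold : ∀ x < k, Function.update lab k q x = lab x := fun x hx =>
    Function.update_of_ne hx.ne _ _
  have hinj : ∀ x < k + 1, ∀ y < k + 1,
      Function.update lab k q x = Function.update lab k q y → x = y := by
    intro x hx y hy hxy
    rcases Nat.lt_succ_iff_lt_or_eq.1 hx with hx | rfl <;>
      rcases Nat.lt_succ_iff_lt_or_eq.1 hy with hy | rfl
    · rw [hold x hx, hold y hy] at hxy
      exact h.inj x hx y hy hxy
    · rw [hold x hx, Function.update_self] at hxy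
      exact absurd hxy.symm (hq x hx)
    · rw [hold y hy, Function.update_self] at hxy
      exact absurd hxy (hq y hy)
    · rfl
  refine ⟨hinj, ?_, fun g hg x z hz => ?_⟩
  · refine le_trans ?_ hcard
    have : Function.Injective (fun i : Fin (k + 1) => Function.update lab k q i) :=
      fun i j hij => Fin.ext (hinj i i.2 j j.2 hij)
    simpa using Nat.card_le_card_of_injective _ this
  · obtain ⟨h1, h2, h3⟩ := h.entry g hg x z hz
    exact ⟨by omega, by omega, by rw [hold x h1, hold z h2, h3]⟩

theorem cycleWords_lt {g : ℕ} (hg : g < 3) : ∀ w ∈ cycleWords g, ∀ g ∈ w, g < 3 := by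
  interval_cases g <;> decide

theorem mem_labels {y : ℕ} (hy : y < 12) : y ∈ labels := by
  interval_cases y <;> decide

/-- The actual value of the `g`-th map at `lab x` is a labelled point or a new one. The branch for
this value is not cut off, because the cycle test never rejects a correct table; so the search
succeeds on a larger correct table. -/
theorem Admissible.branch [Finite Ω] (hcard : Nat.card Ω ≤ 12) (ha : Admissible act m)
    (h : Models act lab k t) {g x : ℕ} {next : ℕ → ℕ → Bool} (hg : g < 3) (hx : x < k)
    (hd : digit t (3 * x + g) = 0) (hb : branch t m g x k next labels = true) :
    ∃ lab' k' t', Models act lab' k' t' ∧ 0 < k' ∧ next k' t' = true := by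
  by_cases hq : ∃ y < k, act g (lab x) = lab y
  · obtain ⟨y, hy, hxy⟩ := hq
    have hyx : y ≠ x := by
      rintro rfl
      exact ha.ne g hg _ hxy
    have hk := h.le
    obtain ⟨h1, h2⟩ := branch_spec hb (mem_labels (by omega)) hyx hy.le
    have hyx' : act g (lab y) = lab x := by rw [← hxy, ha.invol g hg]
    have hdy : digit t (3 * y + g) = 0 := by
      rcases hz : digit t (3 * y + g) with _ | z
      · rfl
      · obtain ⟨-, h3, h4⟩ := h.entry g hg y z hz
        exact absurd (h.inj z h3 x hx (by rw [← h4, hyx'])) (h1 z hz)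
    have h' := h.addPair hg hx hy hyx hd hdy hxy hyx'
    refine ⟨lab, k, _, h', by omega, ?_⟩
    have h3 := h2 hdy (h'.allCycle (cycleWords_lt hg) hx (ha.cycle g hg))
    rwa [if_neg hy.ne] at h3
  · push Not at hq
    have h0 := h.newLabel hcard hq
    have hk := h0.le
    have e1 : Function.update lab k (act g (lab x)) x = lab x := Function.update_of_ne hx.ne _ _
    obtain ⟨-, h2⟩ := branch_spec hb (y := k) (mem_labels (by omega)) hx.ne' le_rfl
    have hdy : digit t (3 * k + g) = 0 := by
      rcases hz : digit t (3 * k + g) with _ | z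
      · rfl
      · exact absurd (h.entry g hg k z hz).1 (lt_irrefl k)
    have h' := h0.addPair hg (hx.trans (Nat.lt_succ_self k)) (Nat.lt_succ_self k) hx.ne' hd hdy
      (by rw [e1, Function.update_self]) (by rw [e1, Function.update_self, ha.invol g hg])
    refine ⟨_, k + 1, _, h', by omega, ?_⟩
    have h3 := h2 hdy (h'.allCycle (cycleWords_lt hg) (hx.trans (Nat.lt_succ_self k))
      (ha.cycle g hg))
    rwa [if_pos rfl] at h3

/-- Follow the path through the search tree that the actual maps dictate. It must end at a complete
table, since exhausted fuel would make the search fail. -/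
theorem Admissible.search [Finite Ω] (hcard : Nat.card Ω ≤ 12) (ha : Admissible act m) {f : ℕ}
    (h : Models act lab k t) (hk : 0 < k) (hs : search m f k t = true) :
    ∃ lab' k' t', Models act lab' k' t' ∧ 0 < k' ∧ acceptLeaf k' t' = true ∧
      ∀ x < k', ∀ g < 3, digit t' (3 * x + g) ≠ 0 := by
  induction f generalizing lab k t with
  | zero => cases hs
  | succ f ih =>
    replace hs : findSlot t k labels (acceptLeaf k t)
      (fun g x => TripleSearch.branch t m g x k (TripleSearch.search m f) labels) = true := hs
    rcases findSlot_spec hs with ⟨x, -, hx, g, hg, hd, hb⟩ | ⟨h1, h2⟩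
    · obtain ⟨lab', k', t', h', hk', hs'⟩ := ha.branch hcard h hg hx hd hb
      exact ih h' hk' hs'
    · have := h.le
      exact ⟨lab, k, t, h, hk, h1, fun x hx => h2 x (mem_labels (by omega)) hx⟩

/-- In a table without unknown entries the labelled points are closed under the three maps, so
transitivity applies. -/
theorem Models.surjective (ha : Admissible act m) (h : Models act lab k t) (hk : 0 < k)
    (hd : ∀ x < k, ∀ g < 3, digit t (3 * x + g) ≠ 0) (p : Ω) : ∃ x < k, lab x = p := by
  have : {p | ∃ x < k, lab x = p} = Set.univ := by
    refine ha.trans _ ⟨lab 0, 0, hk, rfl⟩ ?_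
    rintro g hg p ⟨x, hx, rfl⟩
    obtain ⟨z, hz⟩ := Nat.exists_eq_succ_of_ne_zero (hd x hx g hg)
    obtain ⟨-, h1, h2⟩ := h.entry g hg x z hz
    exact ⟨z, h1, h2.symm⟩
  have hp : p ∈ {p | ∃ x < k, lab x = p} := by rw [this]; trivial
  exact hp

theorem countFix_eq (t : ℕ) (w : List ℕ) (k : ℕ) :
    countFix t w k = ((Finset.range k).filter fun x => eval t w (x + 1) = x + 1).card := by
  induction k with
  | zero => rfl
  | succ k ih =>
    have : countFix t w (k + 1) = if eval t w (k + 1) = k + 1 then countFix t w k + 1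
        else countFix t w k := by
      show (Bool.rec (countFix t w k) (Nat.succ (countFix t w k))
        (Nat.beq (eval t w (k + 1)) (k + 1)) : ℕ) = _
      rcases hb : Nat.beq (eval t w (k + 1)) (k + 1) with _ | _
      · rw [if_neg (Nat.ne_of_beq_eq_false hb)]
      · rw [if_pos (Nat.eq_of_beq_eq_true hb)]
    rw [this, Finset.range_add_one, Finset.filter_insert, ih]
    split_ifs with h
    · rw [Finset.card_insert_of_notMem (by simp)]
    · rfl

theorem Models.countFix_eq_ncard (ha : Admissible act m) (h : Models act lab k t) (hk : 0 < k)
    (hd : ∀ x < k, ∀ g < 3, digit t (3 * x + g) ≠ 0) {w : List ℕ} (hw : ∀ g ∈ w, g < 3) :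
    countFix t w k = {p | wordAct act w p = p}.ncard := by
  have total : ∀ w : List ℕ, (∀ g ∈ w, g < 3) → ∀ x < k, eval t w (x + 1) ≠ 0 := by
    intro w
    induction w with
    | nil => intro _ x _; exact Nat.succ_ne_zero x
    | cons g w ih =>
      intro hw x hx
      show eval t w (digit t (3 * x + g)) ≠ 0
      obtain ⟨z, hz⟩ := Nat.exists_eq_succ_of_ne_zero (hd x hx g (hw g (by simp)))
      rw [hz]
      exact ih (fun g hg => hw g (by simp [hg])) z (h.entry g (hw g (by simp)) x z hz).2.1
  rw [countFix_eq]
  have himg : {p | wordAct act w p = p} =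
      lab '' (((Finset.range k).filter fun x => eval t w (x + 1) = x + 1 : Finset ℕ) : Set ℕ) := by
    ext p
    simp only [Set.mem_ofPred_eq, Set.mem_image, Finset.coe_filter, Finset.mem_range]
    obtain ⟨x, hx, rfl⟩ := h.surjective ha hk hd p
    obtain ⟨y, hy⟩ := Nat.exists_eq_succ_of_ne_zero (total w hw x hx)
    obtain ⟨hyk, hwy⟩ := h.eval_eq hw hx hy
    constructor
    · intro hp
      obtain rfl : y = x := h.inj y hyk x hx (by rw [← hwy, hp])
      exact ⟨y, ⟨hx, hy⟩, rfl⟩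
    · rintro ⟨x', ⟨hx', he⟩, hxx⟩
      obtain rfl : x' = x := h.inj x' hx' x hx hxx
      exact (h.eval_eq hw hx he).2
  rw [himg, Set.InjOn.ncard_image, Set.ncard_coe_finset]
  intro x hx y hy hxy
  simp only [Finset.coe_filter, Finset.mem_range, Set.mem_ofPred_eq] at hx hy
  exact h.inj x hx.1 y hy.1 hxy

theorem renames_spec {t t' p k : ℕ} (h : renames t t' p k = true) {x g : ℕ} (hx : x < k)
    (hg : g < 3) : digit t' (3 * digit p x + g) = digit p (digit t (3 * x + g) - 1) + 1 := by
  induction k with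
  | zero => omega
  | succ k ih =>
    replace h : ([0, 1, 2].all (fun g =>
      Nat.beq (digit t' (Nat.add (Nat.mul 3 (digit p k)) g))
        (Nat.succ (digit p (Nat.pred (digit t (Nat.add (Nat.mul 3 k) g)))))) &&
          renames t t' p k) = true := h
    rw [Bool.and_eq_true, List.all_eq_true] at h
    rcases Nat.lt_succ_iff_lt_or_eq.1 hx with hx | rfl
    · exact ih h.2 hx
    · exact Nat.eq_of_beq_eq_true (h.1 g (by interval_cases g <;> simp))

theorem renamings_spec : ∀ p ∈ renamings, (∀ x < 12, digit p x < 12) ∧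
    ∀ x < 12, ∀ y < 12, digit p x = digit p y → x = y := by
  decide +kernel

theorem fixWords_lt : ∀ w ∈ fixWords, ∀ g ∈ w, g < 3 := by decide

/-- The only admissible triple of involutions, up to renaming. -/
theorem Admissible.exists_equiv [Finite Ω] (hcard : Nat.card Ω ≤ 12) (ha : Admissible act m)
    (h : Models act lab k t) (hk : 0 < k) {f : ℕ} (hs : TripleSearch.search m f k t = true) :
    ∃ φ : Ω ≃ Fin 12, ∀ p, ∀ g < 3,
      digit targetTable (3 * (φ p : ℕ) + g) = (φ (act g p) : ℕ) + 1 := by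
  obtain ⟨lab, k, t, h, hk, hl, hd⟩ := ha.search hcard h hk hs
  have hc : ∀ w : List ℕ, (∀ g ∈ w, g < 3) →
      countFix t w k = {p | wordAct act w p = p}.ncard :=
    fun w hw => h.countFix_eq_ncard ha hk hd hw
  rw [acceptLeaf, Bool.or_eq_true, List.any_eq_true, Bool.and_eq_true, List.any_eq_true] at hl
  rcases hl with ⟨w, hw, hl⟩ | ⟨hk12, p, hp, hl⟩
  -- This leaf was accepted because two numbers of fixed points differ, which `ha.fix` excludes.
  · have hw' := fixWords_lt w hw
    rw [hc w hw', hc (w ++ w) (by intro g hg; simp only [List.mem_append, or_self] at hg; exact hw' g hg),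
      hc [0, 1] (by decide), hc [0, 1, 0, 1] (by decide), (ha.fix w hw).1, (ha.fix w hw).2] at hl
    simp [Nat.beq_refl] at hl
  · obtain rfl : k = 12 := Nat.eq_of_beq_eq_true hk12
    obtain ⟨hp1, hp2⟩ := renamings_spec p hp
    have hbij : Function.Bijective (fun i : Fin 12 => lab i) := by
      refine ⟨fun i j hij => Fin.ext (h.inj i i.2 j j.2 hij), fun q => ?_⟩
      obtain ⟨x, hx, rfl⟩ := h.surjective ha hk hd q
      exact ⟨⟨x, hx⟩, rfl⟩
    have hpbij : Function.Bijective (fun i : Fin 12 => (⟨digit p i, hp1 i i.2⟩ : Fin 12)) := by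
      rw [← Finite.injective_iff_bijective]
      exact fun i j hij => Fin.ext (hp2 i i.2 j j.2 (congrArg Fin.val hij))
    refine ⟨(Equiv.ofBijective _ hbij).symm.trans (Equiv.ofBijective _ hpbij), fun q g hg => ?_⟩
    obtain ⟨i, rfl⟩ := hbij.2 q
    obtain ⟨z, hz⟩ := Nat.exists_eq_succ_of_ne_zero (hd i i.2 g hg)
    obtain ⟨-, hz12, hact⟩ := h.entry g hg i z hz
    have e1 : (Equiv.ofBijective _ hbij).symm (lab i) = i :=
      (Equiv.ofBijective _ hbij).symm_apply_apply i
    have e2 : (Equiv.ofBijective _ hbij).symm (act g (lab i)) = ⟨z, hz12⟩ := by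
      rw [hact]
      exact (Equiv.ofBijective _ hbij).symm_apply_apply ⟨z, hz12⟩
    simp only [Equiv.trans_apply, e1, e2, Equiv.ofBijective_apply]
    rw [renames_spec hl i.2 hg, hz]
    rfl

end TripleSearch

/-! ### Triples of involutions that are invariant under the modular group -/

section

open Equiv

/-- Three involutions without fixed points that generate a transitive group. -/
structure IsInvolutionTriple {Ω : Type*} (a b c : Perm Ω) : Prop where
  mul_self_a : a * a = 1
  mul_self_b : b * b = 1
  mul_self_c : c * c = 1
  a_ne : ∀ p, a p ≠ p
  b_ne : ∀ p, b p ≠ p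
  c_ne : ∀ p, c p ≠ p
  trans : ∀ S : Set Ω, S.Nonempty → (∀ p ∈ S, a p ∈ S ∧ b p ∈ S ∧ c p ∈ S) → S = Set.univ

/-- The class of the triple is invariant under the two generators of the modular group. -/
structure IsModularTriple {Ω : Type*} (a b c : Perm Ω) : Prop extends IsInvolutionTriple a b c where
  shear : ∃ g : Perm Ω, SemiconjBy g a b ∧ SemiconjBy g b (b * a * b) ∧ SemiconjBy g c c
  rotation : ∃ h : Perm Ω, SemiconjBy h a a ∧ SemiconjBy h b (a * c * a) ∧ SemiconjBy h c b

namespace IsInvolutionTriple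

variable {Ω : Type*} {a b c : Perm Ω}

theorem a_a (h : IsInvolutionTriple a b c) (p : Ω) : a (a p) = p := by
  rw [← Perm.mul_apply, h.mul_self_a, Perm.one_apply]

theorem b_b (h : IsInvolutionTriple a b c) (p : Ω) : b (b p) = p := by
  rw [← Perm.mul_apply, h.mul_self_b, Perm.one_apply]

theorem c_c (h : IsInvolutionTriple a b c) (p : Ω) : c (c p) = p := by
  rw [← Perm.mul_apply, h.mul_self_c, Perm.one_apply]

/-- Two involutions generate a dihedral group: conjugation by `a` inverts the rotation `b * a`. -/
theorem a_mul_zpow (h : IsInvolutionTriple a b c) (n : ℤ) : a * (b * a) ^ n = (b * a) ^ (-n) * a := by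
  have hinv : a⁻¹ = a := inv_eq_of_mul_eq_one_left h.mul_self_a
  have hinv' : b⁻¹ = b := inv_eq_of_mul_eq_one_left h.mul_self_b
  have h1 : a * (b * a) * a⁻¹ = (b * a)⁻¹ := by
    rw [mul_inv_rev, hinv, hinv', mul_assoc, mul_assoc, h.mul_self_a, mul_one]
  have h2 : a * (b * a) ^ n * a⁻¹ = (b * a) ^ (-n) := by
    rw [← conj_zpow, h1, inv_zpow, zpow_neg]
  rw [← h2, inv_mul_cancel_right]

/-- The reflection `a * (b * a) ^ n` is conjugate to `a` or to `b`, depending on the parity of `n`,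
and neither of them has a fixed point. -/
theorem a_zpow_ne (h : IsInvolutionTriple a b c) (n : ℤ) (p : Ω) : a (((b * a) ^ n) p) ≠ p := by
  intro hp
  rw [← Perm.mul_apply] at hp
  obtain ⟨l, rfl | rfl⟩ := Int.even_or_odd' n
  · rw [two_mul, zpow_add, ← mul_assoc, h.a_mul_zpow, zpow_neg, mul_assoc, Perm.mul_apply,
      Perm.inv_eq_iff_eq, Perm.mul_apply] at hp
    exact h.a_ne _ hp
  · rw [show 2 * l + 1 = l + (1 + l) by ring, zpow_add, ← mul_assoc, h.a_mul_zpow, zpow_neg,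
      mul_assoc, Perm.mul_apply, Perm.inv_eq_iff_eq, zpow_add, zpow_one, Perm.mul_apply,
      Perm.mul_apply, Perm.mul_apply] at hp
    have := congrArg a hp
    rw [h.a_a] at this
    exact h.b_ne _ this

/-- The points of the orbit of `p` under `a` and `b`. -/
def orbitPoint (a b : Perm Ω) (p : Ω) (x : ℕ × Bool) : Ω :=
  if x.2 then a (((b * a) ^ x.1) p) else ((b * a) ^ x.1) p

theorem zpow_eq_of_lt_minimalPeriod {u : Perm Ω} {p : Ω} {i j : ℕ}
    (hi : i < Function.minimalPeriod u p) (hj : j < Function.minimalPeriod u p)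
    (hij : (u ^ i) p = (u ^ j) p) : i = j := by
  have := Function.iterate_injOn_Iio_minimalPeriod (f := u) (x := p) hi hj
  simp only [Perm.iterate_eq_pow] at this
  exact this hij

/-- If a rotation and a reflection agreed at `p`, some reflection would have a fixed point. This is
why an orbit has twice as many points as the period of `b * a`. -/
theorem orbitPoint_injOn (h : IsInvolutionTriple a b c) (p : Ω) :
    Set.InjOn (orbitPoint a b p) {x | x.1 < Function.minimalPeriod (b * a) p} := by
  rintro ⟨i, s⟩ hi ⟨j, t⟩ hj hij
  simp only [Set.mem_ofPred_eq] at hi hj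
  have key : ∀ i j : ℕ, a (((b * a) ^ i) p) ≠ ((b * a) ^ j) p := by
    intro i j hij
    rw [← zpow_natCast, ← zpow_natCast, ← Perm.mul_apply, h.a_mul_zpow, zpow_neg, Perm.mul_apply,
      Perm.inv_eq_iff_eq, ← Perm.mul_apply, ← zpow_add] at hij
    have h2 := h.a_zpow_ne ((i : ℤ) + j) p
    rw [← hij, h.a_a] at h2
    exact h2 rfl
  cases s <;> cases t <;> simp only [orbitPoint, if_true, Bool.false_eq_true, if_false] at hij
  · rw [zpow_eq_of_lt_minimalPeriod hi hj hij]
  · exact absurd hij.symm (key j i)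
  · exact absurd hij (key i j)
  · rw [zpow_eq_of_lt_minimalPeriod hi hj (a.injective hij)]

/-- The orbit of `p` under `a` and `b`. -/
def orbitSet (a b : Perm Ω) (p : Ω) : Set Ω :=
  {q | ∃ n : ℤ, q = ((b * a) ^ n) p ∨ q = a (((b * a) ^ n) p)}

theorem orbitSet_a (h : IsInvolutionTriple a b c) {p q : Ω} (hq : q ∈ orbitSet a b p) :
    a q ∈ orbitSet a b p := by
  obtain ⟨n, rfl | rfl⟩ := hq
  · exact ⟨n, Or.inr rfl⟩
  · exact ⟨n, Or.inl (h.a_a _)⟩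

theorem orbitSet_zpow (h : IsInvolutionTriple a b c) {p q : Ω} (hq : q ∈ orbitSet a b p) (k : ℤ) :
    ((b * a) ^ k) q ∈ orbitSet a b p := by
  obtain ⟨n, rfl | rfl⟩ := hq
  · exact ⟨k + n, Or.inl (by rw [zpow_add, Perm.mul_apply])⟩
  · refine ⟨n - k, Or.inr ?_⟩
    have e : (b * a) ^ k * (a * (b * a) ^ n) = a * (b * a) ^ (n - k) := by
      rw [h.a_mul_zpow, h.a_mul_zpow, ← mul_assoc, ← zpow_add, neg_sub, sub_eq_add_neg]
    exact congrArg (fun x : Perm Ω => x p) e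

theorem orbitSet_b (h : IsInvolutionTriple a b c) {p q : Ω} (hq : q ∈ orbitSet a b p) :
    b q ∈ orbitSet a b p := by
  have h1 := h.orbitSet_zpow (h.orbitSet_a hq) 1
  rwa [zpow_one, Perm.mul_apply, h.a_a] at h1

theorem mem_orbitSet_self (p : Ω) : p ∈ orbitSet a b p := ⟨0, Or.inl rfl⟩

theorem orbitSet_eq_image [Finite Ω] (p : Ω) : orbitSet a b p =
    orbitPoint a b p '' {x | x.1 < Function.minimalPeriod (b * a) p} := by
  have hper : 0 < Function.minimalPeriod (b * a) p :=
    Function.minimalPeriod_pos_of_mem_periodicPts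
      (Function.Injective.mem_periodicPts (b * a).injective p)
  have hz : ∀ n : ℤ, ∃ i < Function.minimalPeriod (b * a) p, ((b * a) ^ n) p = ((b * a) ^ i) p := by
    intro n
    have h1 : 0 ≤ n % (Function.minimalPeriod (b * a) p : ℤ) := Int.emod_nonneg _ (by omega)
    have h2 : n % (Function.minimalPeriod (b * a) p : ℤ) < Function.minimalPeriod (b * a) p :=
      Int.emod_lt_of_pos _ (by omega)
    refine ⟨(n % (Function.minimalPeriod (b * a) p : ℤ)).toNat, by omega, ?_⟩
    rw [← zpow_natCast, Int.toNat_of_nonneg h1]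
    conv_lhs => rw [← Int.emod_add_mul_ediv n (Function.minimalPeriod (b * a) p), zpow_add,
      Perm.mul_apply, zpow_mul, zpow_natCast]
    congr 1
    apply Perm.zpow_apply_eq_self_of_apply_eq_self
    rw [← Perm.iterate_eq_pow]
    exact Function.iterate_minimalPeriod
  ext q
  constructor
  · rintro ⟨n, rfl | rfl⟩ <;> obtain ⟨i, hi, he⟩ := hz n
    · exact ⟨(i, false), hi, by simp [orbitPoint, he]⟩
    · exact ⟨(i, true), hi, by simp [orbitPoint, he]⟩
  · rintro ⟨⟨i, s⟩, -, rfl⟩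
    refine ⟨i, ?_⟩
    cases s <;> simp [orbitPoint]

theorem ncard_orbitSet [Finite Ω] (h : IsInvolutionTriple a b c) (p : Ω) :
    (orbitSet a b p).ncard = 2 * Function.minimalPeriod (b * a) p := by
  rw [orbitSet_eq_image, (h.orbitPoint_injOn p).ncard_image]
  have : {x : ℕ × Bool | x.1 < Function.minimalPeriod (b * a) p} =
      ((Finset.range (Function.minimalPeriod (b * a) p) ×ˢ (Finset.univ : Finset Bool) :
        Finset (ℕ × Bool)) : Set (ℕ × Bool)) := by
    ext x
    simp
  rw [this, Set.ncard_coe_finset, Finset.card_product, Finset.card_range, Finset.card_univ,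
    Fintype.card_bool, mul_comm]

end IsInvolutionTriple

end

/-! ### Consequences of modular invariance for the dihedral orbits. -/

section

open Equiv

theorem ncard_fixed_eq_of_semiconjBy {Ω : Type*} {g x y : Perm Ω} (h : SemiconjBy g x y) :
    {p | x p = p}.ncard = {p | y p = p}.ncard := by
  have h' : ∀ p, g (x p) = y (g p) := fun p => congrArg (fun f : Perm Ω => f p) h.eq
  have : {p | y p = p} = g '' {p | x p = p} := by
    ext p
    constructor
    · intro hp
      refine ⟨g⁻¹ p, ?_, by simp⟩
      apply g.injective
      rw [h']
      simpa using hp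
    · rintro ⟨p, hp, rfl⟩
      show y (g p) = g p
      rw [← h', show x p = p from hp]
  rw [this, Set.ncard_image_of_injective _ g.injective]

theorem two_mul_le_ncard {Ω : Type*} [Finite Ω] {f : ℕ → Set Ω} {m : ℕ}
    (hd : ∀ i < m, ∀ j < m, i ≠ j → Disjoint (f i) (f j)) (h2 : ∀ i < m, 1 < (f i).ncard) :
    2 * m ≤ {q | ∃ k < m, q ∈ f k}.ncard := by
  induction m with
  | zero => simp
  | succ m ih =>
    have h1 := ih (fun i hi j hj => hd i (by omega) j (by omega)) (fun i hi => h2 i (by omega))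
    have h3 : {q | ∃ k < m + 1, q ∈ f k} = {q | ∃ k < m, q ∈ f k} ∪ f m := by
      ext q
      constructor
      · rintro ⟨k, hk, hq⟩
        rcases Nat.lt_succ_iff_lt_or_eq.1 hk with hk | rfl
        · exact Or.inl ⟨k, hk, hq⟩
        · exact Or.inr hq
      · rintro (⟨k, hk, hq⟩ | hq)
        · exact ⟨k, by omega, hq⟩
        · exact ⟨m, by omega, hq⟩
    rw [h3, Set.ncard_union_eq]
    · have := h2 m (by omega)
      omega
    · refine Set.disjoint_left.2 ?_
      rintro q ⟨k, hk, hq⟩ hq'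
      exact Set.disjoint_left.1 (hd k (by omega) m (by omega) hk.ne) hq hq'

namespace IsModularTriple

variable {Ω : Type*} {a b c : Perm Ω}

open IsInvolutionTriple

theorem semiconjBy_ca (h : IsModularTriple a b c) : ∃ g, SemiconjBy g (b * a) (c * a) := by
  obtain ⟨g, h1, h2, -⟩ := h.rotation
  refine ⟨a * g, SemiconjBy.mul_left ?_ (h2.mul_right h1)⟩
  show a * (a * c * a * a) = c * a * a
  simp only [mul_assoc, h.mul_self_a, mul_one]
  rw [← mul_assoc, h.mul_self_a, one_mul]

/-- The conjugation that realizes the shear fixes `c` and `b * a` and turns `a` into `b`, so it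
lowers the exponent by one. The rotation supplies the exponent zero. -/
theorem isConj_c_mul_a_mul_zpow (h : IsModularTriple a b c) (k : ℤ) :
    IsConj (b * a) (c * (a * (b * a) ^ k)) := by
  obtain ⟨s, h1, h2, h3⟩ := h.shear
  have step : ∀ k : ℤ, IsConj (c * (a * (b * a) ^ (k + 1))) (c * (a * (b * a) ^ k)) := by
    intro k
    have h4 : SemiconjBy s (b * a) (b * a) := by
      have := h2.mul_right h1
      rwa [mul_assoc, h.mul_self_b, mul_one] at this
    have h5 := h3.mul_right (h1.mul_right (h4.zpow_right (k + 1)))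
    rw [add_comm k 1, zpow_add, zpow_one, ← mul_assoc b, ← mul_assoc b b a, h.mul_self_b,
      one_mul, ← mul_assoc, mul_assoc c] at h5
    rw [add_comm k 1, zpow_add, zpow_one]
    exact ⟨toUnits s, h5⟩
  induction k using Int.induction_on with
  | zero =>
    obtain ⟨g, hg⟩ := h.semiconjBy_ca
    rw [zpow_zero, mul_one]
    exact ⟨toUnits g, hg⟩
  | succ k ih => exact ih.trans (step k).symm
  | pred k ih =>
    have := step (-k - 1)
    rw [sub_add_cancel] at this
    exact ih.trans this

/-- As `c` is an involution, it agrees with the reflection exactly at the fixed points of `c * a *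
(b * a) ^ k`. So all reflections agree with `c` equally often. -/
theorem ncard_c_eq (h : IsModularTriple a b c) (k : ℕ) :
    {p | c p = a (((b * a) ^ k) p)}.ncard = {p | (b * a) p = p}.ncard := by
  obtain ⟨g, hg⟩ := h.isConj_c_mul_a_mul_zpow k
  rw [zpow_natCast] at hg
  rw [ncard_fixed_eq_of_semiconjBy hg]
  congr 1
  ext p
  show c p = _ ↔ c (a (((b * a) ^ k) p)) = p
  constructor
  · intro h1; rw [← h1, h.c_c]
  · intro h1; rw [← h1, h.c_c, h1]

theorem orbitSet_eq_univ (h : IsModularTriple a b c) {p : Ω}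
    (hc : ∀ q ∈ orbitSet a b p, c q ∈ orbitSet a b p) : orbitSet a b p = Set.univ :=
  h.trans _ ⟨p, mem_orbitSet_self p⟩ fun q hq => ⟨h.orbitSet_a hq, h.orbitSet_b hq, hc q hq⟩

theorem orbitSet_eq_of_mem (h : IsModularTriple a b c) {p q : Ω} (hq : q ∈ orbitSet a b p) :
    p ∈ orbitSet a b q := by
  obtain ⟨n, rfl | rfl⟩ := hq
  · have := h.orbitSet_zpow (mem_orbitSet_self (a := a) (b := b) (((b * a) ^ n) p)) (-n)
    rwa [← Perm.mul_apply, ← zpow_add, neg_add_cancel, zpow_zero, Perm.one_apply] at this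
  · have := h.orbitSet_zpow (h.orbitSet_a (mem_orbitSet_self (a := a) (b := b)
      (a (((b * a) ^ n) p)))) (-n)
    rwa [h.a_a, ← Perm.mul_apply ((b * a) ^ (-n)), ← zpow_add, neg_add_cancel, zpow_zero,
      Perm.one_apply] at this

theorem orbitSet_trans (h : IsModularTriple a b c) {p q r : Ω} (hq : q ∈ orbitSet a b p)
    (hr : r ∈ orbitSet a b q) : r ∈ orbitSet a b p := by
  obtain ⟨n, rfl | rfl⟩ := hr
  · exact h.orbitSet_zpow hq n
  · exact h.orbitSet_a (h.orbitSet_zpow hq n)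

theorem disjoint_orbitSet (h : IsModularTriple a b c) {p q : Ω} (hq : q ∉ orbitSet a b p) :
    Disjoint (orbitSet a b p) (orbitSet a b q) :=
  Set.disjoint_left.2 fun _ h1 h2 => hq (h.orbitSet_trans h1 (h.orbitSet_eq_of_mem h2))

/-- The size of the orbit is twice the period of each of its points. -/
theorem minimalPeriod_eq_of_mem [Finite Ω] (h : IsModularTriple a b c) {p q : Ω}
    (hq : q ∈ orbitSet a b p) :
    Function.minimalPeriod (b * a) q = Function.minimalPeriod (b * a) p := by
  have : orbitSet a b q = orbitSet a b p :=
    Set.Subset.antisymm (fun _ => h.orbitSet_trans hq)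
      (fun _ => h.orbitSet_trans (h.orbitSet_eq_of_mem hq))
  have h1 := h.ncard_orbitSet q
  rw [this, h.ncard_orbitSet p] at h1
  omega

theorem pow_minimalPeriod_apply [Finite Ω] (h : IsModularTriple a b c) {p q : Ω}
    (hq : q ∈ orbitSet a b p) : ((b * a) ^ Function.minimalPeriod (b * a) p) q = q := by
  rw [← h.minimalPeriod_eq_of_mem hq, ← Perm.iterate_eq_pow]
  exact Function.iterate_minimalPeriod

/-- In every orbit of `a` and `b` of more than two points that is not everything, some reflection
agrees with `c` at no more than one point. -/
theorem exists_ncard_inter_le_one [Finite Ω] (h : IsModularTriple a b c) {p : Ω}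
    (hp : orbitSet a b p ≠ Set.univ) : ∃ k < Function.minimalPeriod (b * a) p,
      ({q | c q = a (((b * a) ^ k) q)} ∩ orbitSet a b p).ncard ≤ 1 := by
  by_contra! hk
  set m := Function.minimalPeriod (b * a) p with hm
  apply hp
  apply h.orbitSet_eq_univ
  have hdisj : ∀ i < m, ∀ j < m, i ≠ j →
      Disjoint ({q | c q = a (((b * a) ^ i) q)} ∩ orbitSet a b p)
        ({q | c q = a (((b * a) ^ j) q)} ∩ orbitSet a b p) := by
    intro i hi j hj hij
    refine Set.disjoint_left.2 fun q hq1 hq2 => hij ?_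
    have h1 : a (((b * a) ^ i) q) = a (((b * a) ^ j) q) := hq1.1.symm.trans hq2.1
    have h2 := h.minimalPeriod_eq_of_mem hq1.2
    refine zpow_eq_of_lt_minimalPeriod (p := q) ?_ ?_ (a.injective h1)
    · rw [h2]; exact hi
    · rw [h2]; exact hj
  -- If each of the `m` reflections agreed with `c` at two points or more, these disjoint sets would
  -- exhaust the `2 * m` points of the orbit, and `c` would preserve it.
  have hU : {q | ∃ k < m, q ∈ {q | c q = a (((b * a) ^ k) q)} ∩ orbitSet a b p} =
      orbitSet a b p := by
    refine Set.eq_of_subset_of_ncard_le (by rintro q ⟨k, -, -, hq⟩; exact hq) ?_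
    rw [h.ncard_orbitSet, ← hm]
    exact two_mul_le_ncard hdisj fun k hk' => hk k hk'
  intro q hq
  rw [← hU] at hq
  obtain ⟨k, -, hq1, hq2⟩ := hq
  rw [show c q = a (((b * a) ^ k) q) from hq1]
  have := h.orbitSet_a (h.orbitSet_zpow hq2 k)
  rwa [zpow_natCast] at this

end IsModularTriple

end

/-! ### Absence of fixed points of `b * a`. -/

section

open Equiv

namespace IsModularTriple

variable {Ω : Type*} {a b c : Perm Ω}

open IsInvolutionTriple

/-- The orbit of `q` consists of `q` and `a q` only. If `c` agreed with a reflection there, it would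
preserve this orbit, which would then be everything and leave no room for a point of period three.
-/
theorem c_ne_of_fixed [Finite Ω] (h : IsModularTriple a b c) {p q : Ω}
    (hp : 3 ≤ Function.minimalPeriod (b * a) p) (hq : (b * a) q = q) (k : ℕ) :
    c q ≠ a (((b * a) ^ k) q) := by
  intro hc
  have hz : ∀ n : ℤ, ((b * a) ^ n) q = q := fun n => Perm.zpow_apply_eq_self_of_apply_eq_self hq n
  rw [← zpow_natCast, hz] at hc
  have huniv : orbitSet a b q = Set.univ := by
    apply h.orbitSet_eq_univ
    rintro r ⟨n, rfl | rfl⟩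
    · rw [hz, hc]; exact h.orbitSet_a (mem_orbitSet_self q)
    · rw [hz, ← hc, h.c_c]; exact mem_orbitSet_self q
  have h1 := h.minimalPeriod_eq_of_mem (huniv.symm ▸ Set.mem_univ p : p ∈ orbitSet a b q)
  have h2 : Function.minimalPeriod (b * a) q = 1 := Function.minimalPeriod_eq_one_iff_isFixedPt.2 hq
  omega

/-- If some orbit of `a` and `b` has more than four points, then all have more than two. -/
theorem mul_apply_ne [Finite Ω] (h : IsModularTriple a b c) (hcard : Nat.card Ω ≤ 12) {p : Ω}
    (hp : 3 ≤ Function.minimalPeriod (b * a) p) (q : Ω) : (b * a) q ≠ q := by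
  intro hq
  set F : Set Ω := {q | (b * a) q = q} with hF
  set O : Set Ω := orbitSet a b p with hO
  have period_one : ∀ r, r ∈ F ↔ Function.minimalPeriod (b * a) r = 1 := fun r =>
    Function.minimalPeriod_eq_one_iff_isFixedPt.symm
  have hOF : Disjoint O F := Set.disjoint_left.2 fun r h1 h2 => by
    have := h.minimalPeriod_eq_of_mem h1
    rw [(period_one r).1 h2] at this
    omega
  have hF2 : 2 ≤ F.ncard := by
    have h1 := h.ncard_orbitSet q
    rw [(period_one q).1 hq, mul_one] at h1
    rw [← h1]
    refine Set.ncard_le_ncard (fun r hr => ?_) (Set.toFinite _)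
    rw [period_one, h.minimalPeriod_eq_of_mem hr, (period_one q).1 hq]
  have hOne : O ≠ Set.univ := fun hu => Set.disjoint_left.1 hOF (hu.symm ▸ Set.mem_univ q) hq
  obtain ⟨k, -, hk⟩ := h.exists_ncard_inter_le_one hOne
  -- The points where `c` agrees with the reflection are as many as those of `F`, at least two, and
  -- none lies in `F`. If at most one lies in `O`, another one lies outside both.
  have out : ∀ j, ({q | c q = a (((b * a) ^ j) q)} ∩ O).ncard ≤ 1 →
      ∃ r, c r = a (((b * a) ^ j) r) ∧ r ∉ O ∧ r ∉ F := by
    intro j hj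
    by_contra! hcon
    have : {q | c q = a (((b * a) ^ j) q)} ⊆ {q | c q = a (((b * a) ^ j) q)} ∩ O := by
      intro r hr
      refine ⟨hr, ?_⟩
      by_contra hrO
      exact h.c_ne_of_fixed hp (hcon r hr hrO) j hr
    have h1 := Set.ncard_le_ncard this (Set.toFinite _)
    have h0 : {q | c q = a (((b * a) ^ j) q)}.ncard = F.ncard := h.ncard_c_eq j
    rw [h0] at h1
    omega
  obtain ⟨r, hr, hrO, hrF⟩ := out k hk
  have hper : 2 ≤ Function.minimalPeriod (b * a) r := by
    have h0 : 0 < Function.minimalPeriod (b * a) r :=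
      Function.minimalPeriod_pos_of_mem_periodicPts
        (Function.Injective.mem_periodicPts (b * a).injective r)
    have h1 := mt (period_one r).2 hrF
    omega
  have hOr : Disjoint O (orbitSet a b r) := h.disjoint_orbitSet hrO
  have hFr : Disjoint F (orbitSet a b r) := Set.disjoint_left.2 fun x h1 h2 => by
    have := h.minimalPeriod_eq_of_mem h2
    rw [(period_one x).1 h1] at this
    omega
  have hsum : (O ∪ orbitSet a b r ∪ F).ncard = O.ncard + (orbitSet a b r).ncard + F.ncard := by
    rw [Set.ncard_union_eq (Set.disjoint_union_left.2 ⟨hOF, hFr.symm⟩), Set.ncard_union_eq hOr]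
  have hO' : O.ncard = 2 * Function.minimalPeriod (b * a) p := h.ncard_orbitSet p
  have hr' : (orbitSet a b r).ncard = 2 * Function.minimalPeriod (b * a) r := h.ncard_orbitSet r
  have hle := Set.ncard_le_card (O ∪ orbitSet a b r ∪ F)
  -- The orbit `O`, the orbit of `r` and `F` have at least 6, 4 and 2 points, so the bound of twelve
  -- forces equality everywhere.
  have hm : Function.minimalPeriod (b * a) p = 3 := by omega
  have hr2 : Function.minimalPeriod (b * a) r = 2 := by omega
  have huniv : O ∪ orbitSet a b r ∪ F = Set.univ := by
    apply Set.eq_of_subset_of_ncard_le (Set.subset_univ _) _ (Set.toFinite _)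
    rw [Set.ncard_univ]
    omega
  -- Adding three to the exponent gives the same reflection on `O`, where the period is three, and a
  -- different one on the orbit of `r`, where the period is two.
  have hk3 : ({q | c q = a (((b * a) ^ (k + 3)) q)} ∩ O).ncard ≤ 1 := by
    refine le_trans (le_of_eq ?_) hk
    congr 1
    ext x
    refine and_congr_left fun hx => ?_
    have := h.pow_minimalPeriod_apply hx
    rw [hm] at this
    show c x = a (((b * a) ^ (k + 3)) x) ↔ c x = a (((b * a) ^ k) x)
    rw [pow_add, Perm.mul_apply, this]
  obtain ⟨r', hr'1, hr'O, hr'F⟩ := out (k + 3) hk3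
  have hr'r : r' ∈ orbitSet a b r := by
    have : r' ∈ O ∪ orbitSet a b r ∪ F := huniv.symm ▸ Set.mem_univ r'
    simpa [hr'O, hr'F] using this
  have two : ∀ j x, x ∈ orbitSet a b r → c x = a (((b * a) ^ j) x) →
      1 < ({q | c q = a (((b * a) ^ j) q)} ∩ orbitSet a b r).ncard := by
    intro j x hx hcx
    rw [Set.one_lt_ncard]
    refine ⟨x, ⟨hcx, hx⟩, c x, ⟨?_, ?_⟩, (h.c_ne x).symm⟩
    · show c (c x) = a (((b * a) ^ j) (c x))
      rw [h.c_c, hcx, ← zpow_natCast]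
      have h2 : a * (b * a) ^ (j : ℤ) * (a * (b * a) ^ (j : ℤ)) = 1 := by
        nth_rewrite 1 [h.a_mul_zpow]
        rw [mul_assoc, ← mul_assoc a a, h.mul_self_a, one_mul, ← zpow_add, neg_add_cancel, zpow_zero]
      exact (congrArg (fun f : Perm Ω => f x) h2).symm
    · rw [hcx, ← zpow_natCast]
      exact h.orbitSet_a (h.orbitSet_zpow hx j)
  have hd : Disjoint ({q | c q = a (((b * a) ^ k) q)} ∩ orbitSet a b r)
      ({q | c q = a (((b * a) ^ (k + 3)) q)} ∩ orbitSet a b r) := by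
    refine Set.disjoint_left.2 fun x h1 h2 => ?_
    have h3 : a (((b * a) ^ k) x) = a (((b * a) ^ (k + 3)) x) := h1.1.symm.trans h2.1
    rw [pow_add, Perm.mul_apply] at h3
    have h4 : ((b * a) ^ 3) x = x := (((b * a) ^ k).injective (a.injective h3)).symm
    have h5 := h.minimalPeriod_eq_of_mem h1.2
    rw [← Perm.iterate_eq_pow] at h4
    have h6 := Function.IsPeriodicPt.minimalPeriod_dvd h4
    rw [h5, hr2] at h6
    omega
  -- Two disjoint sets of at least two points fill the four points of the orbit of `r`. So `c`
  -- preserves this orbit, although it does not contain `p`.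
  have hU : ({q | c q = a (((b * a) ^ k) q)} ∩ orbitSet a b r) ∪
      ({q | c q = a (((b * a) ^ (k + 3)) q)} ∩ orbitSet a b r) = orbitSet a b r := by
    apply Set.eq_of_subset_of_ncard_le _ _ (Set.toFinite _)
    · exact Set.union_subset Set.inter_subset_right Set.inter_subset_right
    · rw [Set.ncard_union_eq hd, hr', hr2]
      have h1 := two k r (mem_orbitSet_self r) hr
      have h2 := two (k + 3) r' hr'r hr'1
      omega
  have : orbitSet a b r = Set.univ := by
    apply h.orbitSet_eq_univ
    intro x hx
    rw [← hU] at hx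
    rcases hx with ⟨h1, h2⟩ | ⟨h1, h2⟩ <;> rw [h1, ← zpow_natCast] <;>
      exact h.orbitSet_a (h.orbitSet_zpow h2 _)
  exact Set.disjoint_left.1 hOr (mem_orbitSet_self p) (this.symm ▸ Set.mem_univ p)

end IsModularTriple

end

/-! ### Words conjugate to `b * a`, and the reduction to the search. -/

section

open Equiv

theorem isConj_mul_comm {G : Type*} [Group G] (x y : G) : IsConj (x * y) (y * x) :=
  isConj_iff.2 ⟨y, by group⟩

/-- Three maps as a sequence. -/
def tripleAct {Ω : Type*} (a b c : Perm Ω) : ℕ → Perm Ω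
  | 0 => a
  | 1 => b
  | _ => c

/-- The permutation given by a word whose letters act from left to right. -/
def wordPerm {Ω : Type*} (act : ℕ → Perm Ω) : List ℕ → Perm Ω
  | [] => 1
  | g :: w => wordPerm act w * act g

theorem wordAct_eq_wordPerm {Ω : Type*} (act : ℕ → Perm Ω) (w : List ℕ) (p : Ω) :
    TripleSearch.wordAct (fun g => act g) w p = wordPerm act w p := by
  induction w generalizing p with
  | nil => rfl
  | cons g w ih => exact ih (act g p)

theorem wordPerm_append {Ω : Type*} (act : ℕ → Perm Ω) (w w' : List ℕ) :
    wordPerm act (w ++ w') = wordPerm act w' * wordPerm act w := by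
  induction w with
  | nil => simp [wordPerm]
  | cons g w ih => simp [wordPerm, ih, mul_assoc]

namespace IsModularTriple

variable {Ω : Type*} {a b c : Perm Ω}

open IsInvolutionTriple TripleSearch

theorem isConj_mul_a_mul_zpow_mul (h : IsModularTriple a b c) (k : ℤ) :
    IsConj (b * a) (a * (b * a) ^ k * c) :=
  (h.isConj_c_mul_a_mul_zpow k).trans (isConj_mul_comm _ _)

/-- The words used by the search are conjugates of `b * a`. -/
theorem isConj_wordPerm (h : IsModularTriple a b c) :
    (∀ g < 3, ∀ w ∈ cycleWords g, IsConj (b * a) (wordPerm (tripleAct a b c) w)) ∧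
    ∀ w ∈ fixWords, IsConj (b * a) (wordPerm (tripleAct a b c) w) := by
  have ia : a⁻¹ = a := inv_eq_of_mul_eq_one_left h.mul_self_a
  have ib : b⁻¹ = b := inv_eq_of_mul_eq_one_left h.mul_self_b
  have aa : ∀ x, a * (a * x) = x := fun x => by rw [← mul_assoc, h.mul_self_a, one_mul]
  have bb : ∀ x, b * (b * x) = x := fun x => by rw [← mul_assoc, h.mul_self_b, one_mul]
  have e0 : a * (b * a) ^ (0 : ℤ) = a := by simp
  have e1 : a * (b * a) ^ (1 : ℤ) = a * (b * a) := by simp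
  have e2 : a * (b * a) ^ (2 : ℤ) = a * (b * (a * (b * a))) := by
    rw [show (2 : ℤ) = 1 + 1 by norm_num, zpow_add]; simp [mul_assoc]
  have em1 : a * (b * a) ^ (-1 : ℤ) = b := by simp [ia, ib, aa]
  have em2 : a * (b * a) ^ (-2 : ℤ) = b * (a * b) := by
    rw [show (-2 : ℤ) = -1 + -1 by norm_num, zpow_add]; simp [ia, ib, aa, mul_assoc]
  have em3 : a * (b * a) ^ (-3 : ℤ) = b * (a * (b * (a * b))) := by
    rw [show (-3 : ℤ) = -1 + (-1 + -1) by norm_num, zpow_add, zpow_add]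
    simp [ia, ib, aa, mul_assoc]
  have L0 := h.isConj_c_mul_a_mul_zpow 0
  have Lm1 := h.isConj_c_mul_a_mul_zpow (-1)
  have L2 := h.isConj_c_mul_a_mul_zpow 2
  have Lm2 := h.isConj_c_mul_a_mul_zpow (-2)
  have R0 := h.isConj_mul_a_mul_zpow_mul 0
  have R1 := h.isConj_mul_a_mul_zpow_mul 1
  have R2 := h.isConj_mul_a_mul_zpow_mul 2
  have Rm1 := h.isConj_mul_a_mul_zpow_mul (-1)
  have Rm2 := h.isConj_mul_a_mul_zpow_mul (-2)
  have Rm3 := h.isConj_mul_a_mul_zpow_mul (-3)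
  rw [e0] at L0 R0
  rw [e1] at R1
  rw [e2] at L2 R2
  rw [em1] at Lm1 Rm1
  rw [em2] at Lm2 Rm2
  rw [em3] at Rm3
  have H1 : IsConj (b * a) (b * (c * (b * a))) := by
    refine Lm2.trans ?_
    have := isConj_mul_comm (c * (b * a)) b
    simpa only [mul_assoc] using this
  -- Permute `c * a * (b * a) ^ 2` cyclically to `b * a * c * a * b * a`, and apply the rotation of
  -- the triple, which turns `b` into `a * c * a` and `c` into `b`.
  have H2 : IsConj (b * a) (a * (c * (b * c))) := by
    have h1 : IsConj (b * a) (b * (a * (c * (a * (b * a))))) := by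
      refine L2.trans ?_
      have := isConj_mul_comm (c * (a * (b * a))) (b * a)
      simpa only [mul_assoc] using this
    refine h1.trans ?_
    obtain ⟨r, r1, r2, r3⟩ := h.rotation
    have := r2.mul_right (r1.mul_right (r3.mul_right (r1.mul_right (r2.mul_right r1))))
    simp only [mul_assoc, aa, h.mul_self_a, mul_one] at this
    exact ⟨toUnits r, this⟩
  constructor
  · intro g hg w hw
    interval_cases g <;> fin_cases hw <;>
      simp only [wordPerm, tripleAct, one_mul, mul_assoc] <;> simp only [mul_assoc] at *
    · exact IsConj.refl _
    · exact L0
    · exact H1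
    · exact isConj_mul_comm _ _
    · exact Lm1
    · exact R0
    · exact Rm1
    · exact R1
    · exact Rm2
    · exact R2
    · exact Rm3
  · intro w hw
    fin_cases hw <;>
      simp only [wordPerm, tripleAct, one_mul, mul_assoc] <;> simp only [mul_assoc] at *
    · exact L0
    · exact Lm1
    · exact R1
    · exact Rm2
    · exact H2

/-- The tested words are conjugates of `b * a` and share its cycle lengths, which are at least two
by `hne` and at most `m` by `hm`. -/
theorem admissible [Finite Ω] (h : IsModularTriple a b c) {m : ℕ}
    (hm : ∀ p, Function.minimalPeriod (b * a) p ≤ m) (hne : ∀ p, (b * a) p ≠ p) :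
    Admissible (fun g => tripleAct a b c g) m where
  invol g hg p := by
    interval_cases g
    exacts [h.a_a p, h.b_b p, h.c_c p]
  ne g hg p := by
    interval_cases g
    exacts [h.a_ne p, h.b_ne p, h.c_ne p]
  cycle g hg w hw p := by
    obtain ⟨r, hr⟩ := isConj_iff.1 (h.isConj_wordPerm.1 g hg w hw)
    have hw' : wordAct (fun g => tripleAct a b c g) w = wordPerm (tripleAct a b c) w :=
      funext (wordAct_eq_wordPerm _ w)
    have e : ∀ q, wordPerm (tripleAct a b c) w q = r ((b * a) (r⁻¹ q)) := fun q => by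
      rw [← hr]; rfl
    rw [hw']
    constructor
    · intro hp
      apply hne (r⁻¹ p)
      rw [e] at hp
      rw [Perm.eq_inv_iff_eq, hp]
    · have h0 : 0 < Function.minimalPeriod (b * a) (r⁻¹ p) :=
        Function.minimalPeriod_pos_of_mem_periodicPts
          (Function.Injective.mem_periodicPts (b * a).injective _)
      refine ⟨Function.minimalPeriod (b * a) (r⁻¹ p) - 1, ?_, ?_⟩
      · have := hm (r⁻¹ p)
        omega
      · rw [Nat.sub_add_cancel h0, Perm.iterate_eq_pow, ← hr, conj_pow, Perm.mul_apply,
          Perm.mul_apply, ← Perm.iterate_eq_pow, Function.iterate_minimalPeriod,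
          ← Perm.mul_apply, mul_inv_cancel, Perm.one_apply]
  trans S hS hg := h.trans S hS fun p hp =>
    ⟨hg 0 (by norm_num) p hp, hg 1 (by norm_num) p hp, hg 2 (by norm_num) p hp⟩
  fix w hw := by
    have key : ∀ w w', IsConj (wordPerm (tripleAct a b c) w) (wordPerm (tripleAct a b c) w') →
        {p | wordAct (fun g => tripleAct a b c g) w' p = p}.ncard =
        {p | wordAct (fun g => tripleAct a b c g) w p = p}.ncard := by
      rintro w w' ⟨r, hr⟩
      simp only [wordAct_eq_wordPerm]
      exact (ncard_fixed_eq_of_semiconjBy hr).symm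
    have h1 : IsConj (wordPerm (tripleAct a b c) [0, 1]) (wordPerm (tripleAct a b c) w) :=
      h.isConj_wordPerm.2 w hw
    refine ⟨key _ _ h1, key [0, 1, 0, 1] _ ?_⟩
    rw [show [0, 1, 0, 1] = [0, 1] ++ [0, 1] from rfl, wordPerm_append, wordPerm_append, ← pow_two,
      ← pow_two]
    exact h1.pow 2

/-- Along the orbit, `a` exchanges the labels `2 * j` and `2 * j + 1`, and `b` exchanges `2 * j + 1`
and `2 * j + 2` modulo `2 * m`; the wrap-around is the periodicity of `p`. -/
theorem models_cycleTable [Finite Ω] (h : IsModularTriple a b c) {p : Ω}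
    {m : ℕ} (hm : Function.minimalPeriod (b * a) p = m) (h3 : 3 ≤ m) (h6 : m ≤ 6) :
    Models (fun g => tripleAct a b c g) (fun x => orbitPoint a b p (x / 2, x % 2 == 1)) (2 * m)
      (cycleTable m) where
  inj x hx y hy hxy := by
    have := h.orbitPoint_injOn p (by show x / 2 < _; omega) (by show y / 2 < _; omega) hxy
    have h1 : x / 2 = y / 2 := congrArg Prod.fst this
    have h2 : (x % 2 == 1) = (y % 2 == 1) := congrArg Prod.snd this
    simp only [beq_eq_beq] at h2
    omega
  le := by omega
  entry g hg x z hz := by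
    have key : ∀ (m : Fin 7) (x : Fin 16) (g : Fin 3) (z : Fin 16), 3 ≤ m.1 →
        digit (cycleTable m) (3 * x + g) = z + 1 → x.1 < 2 * m ∧ z.1 < 2 * m ∧
          ((g = 0 ∧ x.1 % 2 = 0 ∧ z.1 = x + 1) ∨ (g = 0 ∧ x.1 % 2 = 1 ∧ x.1 = z + 1) ∨
          (g = 1 ∧ x.1 % 2 = 1 ∧ z.1 = (x + 1) % (2 * m)) ∨
          (g = 1 ∧ x.1 % 2 = 0 ∧ x.1 = (z + 1) % (2 * m) ∧ z.1 % 2 = 1)) := by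
      decide +kernel
    have hx : x < 16 := by
      by_contra hx
      have : cycleTable m < 16 ^ (3 * x + g) := by
        calc cycleTable m < 16 ^ 36 := by interval_cases m <;> decide +kernel
          _ ≤ _ := Nat.pow_le_pow_right (by norm_num) (by omega)
      rw [digit_eq, Nat.div_eq_of_lt this] at hz
      simp at hz
    have hz' : z < 16 := by
      rw [digit_eq] at hz
      omega
    obtain ⟨h1, h2, h4⟩ := key ⟨m, by omega⟩ ⟨x, hx⟩ ⟨g, hg⟩ ⟨z, hz'⟩ h3 hz
    have hlab : ∀ j, orbitPoint a b p (2 * j / 2, 2 * j % 2 == 1) = ((b * a) ^ j) p := by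
      intro j; simp [orbitPoint]
    have hlab' : ∀ j, orbitPoint a b p ((2 * j + 1) / 2, (2 * j + 1) % 2 == 1) =
        a (((b * a) ^ j) p) := by
      intro j
      have : (2 * j + 1) / 2 = j := by omega
      simp [orbitPoint, this]
    have hper : ((b * a) ^ m) p = p := by
      rw [← hm, ← Perm.iterate_eq_pow]
      exact Function.iterate_minimalPeriod
    have hb : ∀ x < 2 * m, x % 2 = 1 → b (orbitPoint a b p (x / 2, x % 2 == 1)) =
        orbitPoint a b p ((x + 1) % (2 * m) / 2, (x + 1) % (2 * m) % 2 == 1) := by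
      intro x hx hx2
      obtain ⟨j, rfl⟩ : ∃ j, x = 2 * j + 1 := ⟨x / 2, by omega⟩
      rw [hlab', show 2 * j + 1 + 1 = 2 * (j + 1) by ring, Nat.mul_mod_mul_left, hlab,
        ← Perm.mul_apply, ← Perm.mul_apply, ← pow_succ']
      rcases Nat.lt_or_eq_of_le (show j + 1 ≤ m by omega) with h5 | h5
      · rw [Nat.mod_eq_of_lt h5]
      · rw [h5, Nat.mod_self, hper]; rfl
    refine ⟨h1, h2, ?_⟩
    simp only [Fin.ext_iff, Fin.val_zero, Fin.val_one] at h1 h2 h4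
    rcases h4 with ⟨rfl, h5, rfl⟩ | ⟨rfl, h5, rfl⟩ | ⟨rfl, h5, rfl⟩ | ⟨rfl, h5, h6, h7⟩
    · obtain ⟨j, rfl⟩ : ∃ j, x = 2 * j := ⟨x / 2, by omega⟩
      simp only [hlab, hlab']
      rfl
    · obtain ⟨j, rfl⟩ : ∃ j, z = 2 * j := ⟨z / 2, by omega⟩
      simp only [hlab, hlab']
      exact h.a_a _
    · exact hb x h1 h5
    · have := hb z h2 h7
      rw [← h6] at this
      show b _ = _
      rw [← this, h.b_b]

/-- A triple of involutions on at most twelve points that is invariant under the modular group and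
such that `c * a * b` is not an involution is the one given by `targetTable`. -/
theorem exists_equiv_targetTable [Finite Ω] (h : IsModularTriple a b c) (hcard : Nat.card Ω ≤ 12)
    (hne : c * a * b * (c * a * b) ≠ 1) : ∃ φ : Ω ≃ Fin 12, ∀ p, ∀ g < 3,
      digit targetTable (3 * (φ p : ℕ) + g) = (φ (tripleAct a b c g p) : ℕ) + 1 := by
  have hΩ : Nonempty Ω := by
    by_contra hcon
    rw [not_nonempty_iff] at hcon
    exact hne (Subsingleton.elim _ _)
  -- By maximality the period on the start orbit bounds the cycles of all tested words.
  obtain ⟨p, hp⟩ := Finite.exists_max fun p => Function.minimalPeriod (b * a) p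
  have h6 : Function.minimalPeriod (b * a) p ≤ 6 := by
    have h1 := h.ncard_orbitSet p
    have h2 := Set.ncard_le_card (orbitSet a b p)
    omega
  have h3 : 3 ≤ Function.minimalPeriod (b * a) p := by
    by_contra hlt
    -- If all periods are at most two, the conjugates `c * a` and `c * b` of `b * a` also square to
    -- one. Then `a`, `b`, `c` commute, and `c * a * b` is an involution.
    have hsq : (b * a) ^ 2 = 1 := by
      ext q
      have h1 := hp q
      have h0 : 0 < Function.minimalPeriod (b * a) q :=
        Function.minimalPeriod_pos_of_mem_periodicPts
          (Function.Injective.mem_periodicPts (b * a).injective _)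
      have hd : Function.minimalPeriod (b * a) q ∣ 2 := by
        have h4 : Function.minimalPeriod (b * a) q = 1 ∨ Function.minimalPeriod (b * a) q = 2 := by
          omega
        rcases h4 with h4 | h4 <;> rw [h4]
        exact one_dvd 2
      have h5 := (Function.isPeriodicPt_iff_minimalPeriod_dvd (f := (b * a)) (x := q)).2 hd
      rw [Perm.one_apply, ← Perm.iterate_eq_pow]
      exact h5
    have hsq' : ∀ x, IsConj (b * a) x → x * x = 1 := by
      intro x hx
      have := hx.pow 2
      rw [hsq, isConj_one_right, pow_two] at this
      exact this
    have comm : ∀ x y : Perm Ω, x * x = 1 → y * y = 1 → x * y * (x * y) = 1 → x * y = y * x := by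
      intro x y hx hy hxy
      have h1 : x⁻¹ = x := inv_eq_of_mul_eq_one_left hx
      have h2 : y⁻¹ = y := inv_eq_of_mul_eq_one_left hy
      rw [← inv_eq_of_mul_eq_one_left hxy, mul_inv_rev, h1, h2]
    have k0 := h.isConj_c_mul_a_mul_zpow 0
    have k1 := h.isConj_c_mul_a_mul_zpow (-1)
    have ia : a⁻¹ = a := inv_eq_of_mul_eq_one_left h.mul_self_a
    have ib : b⁻¹ = b := inv_eq_of_mul_eq_one_left h.mul_self_b
    rw [zpow_zero, mul_one] at k0
    rw [zpow_neg, zpow_one, mul_inv_rev, ia, ib, ← mul_assoc a, h.mul_self_a, one_mul] at k1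
    have cab := comm b a h.mul_self_b h.mul_self_a (hsq' _ (IsConj.refl _))
    have cca := comm c a h.mul_self_c h.mul_self_a (hsq' _ k0)
    have ccb := comm c b h.mul_self_c h.mul_self_b (hsq' _ k1)
    apply hne
    calc c * a * b * (c * a * b) = c * a * (b * c) * a * b := by simp only [mul_assoc]
      _ = c * (a * c) * (b * a) * b := by rw [← ccb]; simp only [mul_assoc]
      _ = c * c * (a * a) * (b * b) := by rw [cab, ← cca]; simp only [mul_assoc]
      _ = 1 := by rw [h.mul_self_a, h.mul_self_b, h.mul_self_c]; simp
  have ha := h.admissible hp (h.mul_apply_ne hcard h3)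
  have hM := h.models_cycleTable rfl h3 h6
  have hs : ∃ f, search (Function.minimalPeriod (b * a) p) f
      (2 * Function.minimalPeriod (b * a) p) (cycleTable (Function.minimalPeriod (b * a) p)) =
      true := by
    refine ⟨40, ?_⟩
    generalize Function.minimalPeriod (b * a) p = m at *
    interval_cases m
    exacts [search_three, search_four, search_five, search_six]
  obtain ⟨f, hs⟩ := hs
  exact ha.exists_equiv hcard hM (by omega) hs

end IsModularTriple

end

/-! ### Squares placed upright or rotated by `π` -/

namespace Origami

variable {ι κ : Type}

/-- The change between the two placements of a square. -/
def flip (ω : ι × Bool) : ι × Bool := (ω.1, !ω.2)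

@[simp] theorem flip_flip (ω : ι × Bool) : flip (flip ω) = ω := by simp [flip]

theorem flip_ne (ω : ι × Bool) : flip ω ≠ ω := by simp [flip, Prod.ext_iff]

/-- The left (`d = true`) or lower (`d = false`) edge of an upright (`b = false`) or rotated
(`b = true`) square. -/
def side (d b : Bool) : Side :=
  if d then (if b then .right else .left) else (if b then .top else .bottom)

theorem isVertical_side (d b : Bool) : (side d b).isVertical = d := by
  cases d <;> cases b <;> rfl

theorem side_injective (d : Bool) : Function.Injective (side d) := by
  cases d <;> decide

theorem exists_side_eq (s : Side) : ∃ b, side s.isVertical b = s := by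
  cases s <;> decide

/-- The placed square adjacent to a placed square, after the half rotation about the midpoint of the
left (`d = true`) or lower (`d = false`) edge. -/
def inv (O : Origami ι) (d : Bool) (ω : ι × Bool) : ι × Bool :=
  ((O.glue (ω.1, side d ω.2)).1, decide ((O.glue (ω.1, side d ω.2)).2 = side d true))

theorem glue_side (O : Origami ι) (d : Bool) (ω : ι × Bool) :
    O.glue (ω.1, side d ω.2) = ((O.inv d ω).1, side d (O.inv d ω).2) := by
  have h := O.isVertical_glue (ω.1, side d ω.2)
  rw [isVertical_side] at h
  obtain ⟨b, hb⟩ := exists_side_eq (O.glue (ω.1, side d ω.2)).2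
  rw [h] at hb
  refine Prod.ext rfl ?_
  simp only [inv]
  rw [← hb]
  congr 1
  cases b
  · simpa using fun h => by simpa using side_injective d h
  · simp

theorem inv_eq_iff (O : Origami ι) {d : Bool} {ω ω' : ι × Bool} :
    O.inv d ω = ω' ↔ O.glue (ω.1, side d ω.2) = (ω'.1, side d ω'.2) := by
  rw [glue_side, Prod.ext_iff, Prod.ext_iff]
  simp only [(side_injective d).eq_iff]

@[simp] theorem inv_inv (O : Origami ι) (d : Bool) (ω : ι × Bool) : O.inv d (O.inv d ω) = ω := by
  rw [inv_eq_iff, ← glue_side, O.glue_glue]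

theorem inv_ne (O : Origami ι) (d : Bool) (ω : ι × Bool) : O.inv d ω ≠ ω := by
  rw [Ne, inv_eq_iff]
  exact O.glue_ne _

/-- The origami with given adjacencies of placed squares. -/
def ofInvs (t : Bool → ι × Bool → ι × Bool) (ht : ∀ d ω, t d (t d ω) = ω) (ht' : ∀ d ω, t d ω ≠ ω) :
    Origami ι where
  glue e := let ω := t e.2.isVertical (e.1, decide (e.2 = side e.2.isVertical true))
    (ω.1, side e.2.isVertical ω.2)
  glue_glue e := by
    obtain ⟨i, s⟩ := e
    obtain ⟨b, hb⟩ := exists_side_eq s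
    have key : ∀ d b, decide (side d b = side d true) = b := by decide
    generalize s.isVertical = d at hb
    subst hb
    simp only [isVertical_side, key, Prod.mk.eta, ht]
  glue_ne e h := by
    obtain ⟨i, s⟩ := e
    obtain ⟨b, hb⟩ := exists_side_eq s
    have key : ∀ d b, decide (side d b = side d true) = b := by decide
    generalize s.isVertical = d at hb
    subst hb
    simp only [isVertical_side, key] at h
    rw [Prod.mk.injEq, (side_injective d).eq_iff] at h
    exact ht' d (i, b) (Prod.ext h.1 h.2)
  isVertical_glue e := isVertical_side _ _

/-- Any two involutions of the placed squares without fixed points arise from an origami; no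
compatibility with `flip` is needed. Transformed triples are realized in this way. -/
theorem inv_ofInvs (t : Bool → ι × Bool → ι × Bool) (ht : ∀ d ω, t d (t d ω) = ω)
    (ht' : ∀ d ω, t d ω ≠ ω) (d : Bool) (ω : ι × Bool) : (ofInvs t ht ht').inv d ω = t d ω := by
  rw [inv_eq_iff]
  have key : ∀ d b, decide (side d b = side d true) = b := by decide
  simp only [ofInvs, isVertical_side, key, Prod.mk.eta]

/-- The closed unit square. -/
abbrev UnitSquare : Type := unitInterval × unitInterval

open unitInterval (symm)

/-- The half rotation of the unit square. -/
def rot (z : UnitSquare) : UnitSquare := (symm z.1, symm z.2)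

@[simp] theorem rot_rot (z : UnitSquare) : rot (rot z) = z := by simp [rot]

theorem continuous_rot : Continuous rot := by unfold rot; fun_prop

/-- Points of the unit square, with exchanged coordinates for `d = false`. -/
def mkPt {α : Type*} (d : Bool) (x y : α) : α × α := if d then (x, y) else (y, x)

theorem mkPt_injective {α : Type*} {d : Bool} {x y x' y' : α} (h : mkPt d x y = mkPt d x' y') :
    x = x' ∧ y = y' := by
  cases d <;> simp_all [mkPt]

theorem rot_mkPt (d : Bool) (x y : unitInterval) : rot (mkPt d x y) = mkPt d (symm x) (symm y) := by
  cases d <;> rfl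

theorem continuous_mkPt {α X : Type*} [TopologicalSpace α] [TopologicalSpace X] (d : Bool)
    {f g : X → α} (hf : Continuous f) (hg : Continuous g) : Continuous fun x => mkPt d (f x) (g x) := by
  cases d
  · exact hg.prodMk hf
  · exact hf.prodMk hg

/-- The point of the disjoint union of the squares given by a point of a placed square. -/
def rep (ω : ι × Bool) (z : UnitSquare) : Squares ι := ⟨ω.1, if ω.2 then rot z else z⟩

theorem rep_flip (ω : ι × Bool) (z : UnitSquare) : rep (flip ω) (rot z) = rep ω z := by
  obtain ⟨i, b⟩ := ω
  cases b <;> simp [rep, flip]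

theorem rep_injective (ω : ι × Bool) : Function.Injective (rep ω) := by
  obtain ⟨i, b⟩ := ω
  intro z w h
  cases b
  · simpa [rep] using h
  · have : rot z = rot w := by simpa [rep] using h
    rw [← rot_rot z, this, rot_rot]

theorem rep_eq_rep {ω ω' : ι × Bool} {z w : UnitSquare} (h : rep ω z = rep ω' w) :
    (ω' = ω ∧ w = z) ∨ (ω' = flip ω ∧ w = rot z) := by
  have h1 : ω.1 = ω'.1 := congrArg Sigma.fst h
  by_cases h2 : ω' = ω
  · subst h2
    exact Or.inl ⟨rfl, (rep_injective ω' h).symm⟩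
  · have h3 : ω' = flip ω := by
      obtain ⟨i, b⟩ := ω
      obtain ⟨j, b'⟩ := ω'
      obtain rfl : i = j := h1
      cases b <;> cases b' <;> simp_all [flip]
    subst h3
    rw [← rep_flip ω z] at h
    exact Or.inr ⟨rfl, (rep_injective _ h).symm⟩

theorem continuous_rep (ω : ι × Bool) : Continuous (rep ω) := by
  obtain ⟨i, b⟩ := ω
  cases b
  · exact continuous_sigmaMk (σ := fun _ : ι => UnitSquare)
  · exact (continuous_sigmaMk (σ := fun _ : ι => UnitSquare)).comp continuous_rot

theorem exists_rep_eq (p : Squares ι) : ∃ ω z, rep ω z = p := ⟨(p.1, false), p.2, by simp [rep]⟩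

/-- Every edge is the left or the lower edge of one of the two placements of its square. In these
terms the translations and the half rotations in `Rel` become one formula, a half rotation about the
midpoint of the edge. -/
theorem rel_iff (O : Origami ι) {p q : Squares ι} : O.Rel p q ↔ ∃ (d : Bool) (ω : ι × Bool)
    (u : unitInterval), p = rep ω (mkPt d 0 u) ∧ q = rep (O.inv d ω) (mkPt d 0 (symm u)) := by
  have hp : ∀ d b u, (side d b).point u = if b then rot (mkPt d 0 (symm u)) else mkPt d 0 u := by
    intro d b u
    cases d <;> cases b <;> simp [side, Side.point, rot, mkPt]
  constructor
  · rintro ⟨s, t, u, h1, h2, h3⟩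
    obtain ⟨b, hb⟩ := exists_side_eq s
    generalize s.isVertical = d at hb
    subst hb
    have h4 := O.glue_side d (p.1, b)
    simp only [h1, Prod.mk.injEq] at h4
    obtain ⟨h4, rfl⟩ := h4
    generalize hb' : (O.inv d (p.1, b)) = ω' at h3 h4
    refine ⟨d, (p.1, b), if b then symm u else u, ?_, ?_⟩
    · refine Sigma.ext rfl (heq_of_eq ?_)
      rw [h2, hp]
      cases b <;> simp [rep]
    · rw [hb']
      refine Sigma.ext h4 (heq_of_eq ?_)
      rw [h3, hp]
      simp only [(side_injective d).eq_iff]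
      obtain ⟨i, b'⟩ := ω'
      cases b <;> cases b' <;> simp [rep]
  · rintro ⟨d, ω, u, rfl, rfl⟩
    refine ⟨side d ω.2, side d (O.inv d ω).2, if ω.2 then symm u else u, O.glue_side d ω, ?_, ?_⟩
    · rw [hp]
      obtain ⟨i, b⟩ := ω
      cases b <;> simp [rep]
    · rw [hp]
      simp only [(side_injective d).eq_iff]
      generalize O.inv d ω = ω'
      obtain ⟨i, b⟩ := ω
      obtain ⟨i, b'⟩ := ω'
      cases b <;> cases b' <;> simp [rep]

/-- The point of the surface given by a point of a placed square. -/
def opt (O : Origami ι) (ω : ι × Bool) (z : UnitSquare) : O.Surface := Quot.mk _ (rep ω z)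

theorem opt_false (O : Origami ι) (i : ι) (z : UnitSquare) : O.opt (i, false) z = O.pt i z := rfl

theorem exists_opt_eq (O : Origami ι) (p : O.Surface) : ∃ ω z, O.opt ω z = p := by
  induction p using Quot.ind with
  | _ p => exact ⟨(p.1, false), p.2, rfl⟩

theorem opt_flip_rot (O : Origami ι) (ω : ι × Bool) (z : UnitSquare) :
    O.opt (flip ω) (rot z) = O.opt ω z := by
  rw [opt, rep_flip, opt]

theorem opt_flip (O : Origami ι) (ω : ι × Bool) (z : UnitSquare) :
    O.opt (flip ω) z = O.opt ω (rot z) := by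
  rw [← opt_flip_rot O ω, rot_rot]

theorem opt_inv (O : Origami ι) (d : Bool) (ω : ι × Bool) (u : unitInterval) :
    O.opt (O.inv d ω) (mkPt d 0 (symm u)) = O.opt ω (mkPt d 0 u) :=
  (Quot.sound (O.rel_iff.2 ⟨d, ω, u, rfl, rfl⟩)).symm

theorem continuous_opt (O : Origami ι) (ω : ι × Bool) : Continuous (O.opt ω) :=
  continuous_quot_mk.comp (continuous_rep ω)

/-- Maps from the surface that are given on the placed squares. -/
def lift (O : Origami ι) {Y : Type*} (F : ι × Bool → UnitSquare → Y)
    (h1 : ∀ ω z, F (flip ω) (rot z) = F ω z)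
    (h2 : ∀ d ω u, F (O.inv d ω) (mkPt d 0 (symm u)) = F ω (mkPt d 0 u)) : O.Surface → Y :=
  Quot.lift (fun p => F (p.1, false) p.2) fun p q hpq => by
    have key : ∀ ω z, F ((rep ω z).1, false) (rep ω z).2 = F ω z := by
      rintro ⟨i, b⟩ z
      cases b
      · rfl
      · exact h1 (i, true) z
    obtain ⟨d, ω, u, rfl, rfl⟩ := O.rel_iff.1 hpq
    rw [key, key, h2]

section

variable {O : Origami ι} {Y : Type*} {F : ι × Bool → UnitSquare → Y}
    {h1 : ∀ ω z, F (flip ω) (rot z) = F ω z}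
    {h2 : ∀ d ω u, F (O.inv d ω) (mkPt d 0 (symm u)) = F ω (mkPt d 0 u)}

theorem lift_opt (ω : ι × Bool) (z : UnitSquare) : O.lift F h1 h2 (O.opt ω z) = F ω z := by
  obtain ⟨i, b⟩ := ω
  cases b
  · rfl
  · exact h1 (i, true) z

theorem continuous_lift [TopologicalSpace Y] (hF : ∀ ω, Continuous (F ω)) :
    Continuous (O.lift F h1 h2) :=
  continuous_quot_lift _ (continuous_sigma fun i => hF (i, false))

end

end Origami

/-! ### The topology of the surface -/

namespace Origami

variable {ι κ : Type}

open unitInterval (symm)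

theorem isCorner_rot {z : UnitSquare} : IsCorner (rot z) ↔ IsCorner z := by
  simp only [IsCorner, rot, unitInterval.symm_eq_zero, unitInterval.symm_eq_one]
  tauto

theorem isCorner_rep {ω : ι × Bool} {z : UnitSquare} : IsCorner (rep ω z).2 ↔ IsCorner z := by
  obtain ⟨i, b⟩ := ω
  cases b
  · rfl
  · exact isCorner_rot

theorem isCorner_mkPt {d : Bool} {x y : unitInterval} :
    IsCorner (mkPt d x y) ↔ (x = 0 ∨ x = 1) ∧ (y = 0 ∨ y = 1) := by
  cases d
  · exact and_comm
  · rfl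

theorem Rel.symm {O : Origami ι} {p q : Squares ι} (h : O.Rel p q) : O.Rel q p := by
  obtain ⟨d, ω, u, rfl, rfl⟩ := O.rel_iff.1 h
  exact O.rel_iff.2 ⟨d, O.inv d ω, unitInterval.symm u, rfl, by simp⟩

theorem Rel.isCorner_iff {O : Origami ι} {p q : Squares ι} (h : O.Rel p q) :
    IsCorner p.2 ↔ IsCorner q.2 := by
  obtain ⟨d, ω, u, rfl, rfl⟩ := O.rel_iff.1 h
  simp only [isCorner_rep, isCorner_mkPt, unitInterval.symm_eq_zero, unitInterval.symm_eq_one]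
  tauto

/-- A boundary point that is not a corner lies on one edge only, so it has a single partner and a
second identification leads back. -/
theorem Rel.eq_of_not_isCorner {O : Origami ι} {p q r : Squares ι} (h : O.Rel p q) (h' : O.Rel q r)
    (hq : ¬ IsCorner q.2) : p = r := by
  obtain ⟨d, ω, u, rfl, rfl⟩ := O.rel_iff.1 h
  obtain ⟨d', ω', u', h1, rfl⟩ := O.rel_iff.1 h'
  rw [isCorner_rep] at hq
  by_cases hd : d' = d
  · subst hd
    rcases rep_eq_rep h1 with ⟨rfl, h2⟩ | ⟨rfl, h2⟩
    · rw [(mkPt_injective h2).2]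
      simp
    · rw [rot_mkPt] at h2
      simpa using (mkPt_injective h2).1
  · exfalso
    -- A vertical and a horizontal edge meet only in a corner.
    obtain rfl : d' = !d := by cases d <;> cases d' <;> simp_all
    rw [isCorner_mkPt] at hq
    refine hq ⟨Or.inl rfl, ?_⟩
    rcases rep_eq_rep h1 with ⟨rfl, h2⟩ | ⟨rfl, h2⟩
    · left
      cases d
      · exact (congrArg Prod.fst h2).symm
      · exact (congrArg Prod.snd h2).symm
    · right
      rw [rot_mkPt, unitInterval.symm_symm] at h2
      rw [unitInterval.symm_eq_one]
      cases d
      · exact (congrArg Prod.fst h2).symm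
      · exact (congrArg Prod.snd h2).symm

/-- Away from the corners chains of identifications collapse, so the generated equivalence relation
adds identifications among corners only. -/
theorem eq_or_rel_of_mk_eq_mk {O : Origami ι} {p q : Squares ι}
    (h : Quot.mk O.Rel p = Quot.mk O.Rel q) :
    p = q ∨ O.Rel p q ∨ (IsCorner p.2 ∧ IsCorner q.2) := by
  replace h := Quot.eqvGen_exact h
  induction h with
  | rel p q h => exact Or.inr (Or.inl h)
  | refl p => exact Or.inl rfl
  | symm p q _ ih =>
    rcases ih with rfl | h | h
    · exact Or.inl rfl
    · exact Or.inr (Or.inl h.symm)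
    · exact Or.inr (Or.inr h.symm)
  | trans p q r _ _ ih1 ih2 =>
    rcases ih1 with rfl | h1 | h1
    · exact ih2
    · rcases ih2 with rfl | h2 | h2
      · exact Or.inr (Or.inl h1)
      · by_cases hq : IsCorner q.2
        · exact Or.inr (Or.inr ⟨h1.isCorner_iff.2 hq, h2.isCorner_iff.1 hq⟩)
        · exact Or.inl (h1.eq_of_not_isCorner h2 hq)
      · exact Or.inr (Or.inr ⟨h1.isCorner_iff.2 h2.1, h2.2⟩)
    · rcases ih2 with rfl | h2 | h2
      · exact Or.inr (Or.inr h1)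
      · exact Or.inr (Or.inr ⟨h1.1, h2.isCorner_iff.1 h1.2⟩)
      · exact Or.inr (Or.inr ⟨h1.1, h2.2⟩)

/-- Lying in the interior of the square. -/
def IsInner (z : UnitSquare) : Prop := (z.1 ≠ 0 ∧ z.1 ≠ 1) ∧ (z.2 ≠ 0 ∧ z.2 ≠ 1)

theorem isInner_rot {z : UnitSquare} : IsInner (rot z) ↔ IsInner z := by
  simp only [IsInner, rot, ne_eq, unitInterval.symm_eq_zero, unitInterval.symm_eq_one]
  tauto

theorem IsInner.not_isCorner {z : UnitSquare} (h : IsInner z) : ¬ IsCorner z := by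
  rintro ⟨h1 | h1, -⟩
  · exact h.1.1 h1
  · exact h.1.2 h1

theorem not_isInner_mkPt {d : Bool} {u : unitInterval} : ¬ IsInner (mkPt d 0 u) := by
  cases d <;> simp [IsInner, mkPt]

theorem rep_eq_of_isInner {O : Origami ι} {ω ω' : ι × Bool} {z w : UnitSquare} (hz : IsInner z)
    (h : O.opt ω z = O.opt ω' w) : rep ω z = rep ω' w := by
  rcases eq_or_rel_of_mk_eq_mk h with h | h | h
  · exact h
  · exfalso
    obtain ⟨d, θ, u, h1, -⟩ := O.rel_iff.1 h
    rcases rep_eq_rep h1 with ⟨-, h2⟩ | ⟨-, h2⟩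
    · exact not_isInner_mkPt (h2 ▸ hz)
    · rw [← isInner_rot, ← h2] at hz
      exact not_isInner_mkPt hz
  · exact absurd (isCorner_rep.1 h.1) hz.not_isCorner

theorem rep_eq_of_edge {O : Origami ι} {d : Bool} {ω ω' : ι × Bool} {u : unitInterval} {w : UnitSquare}
    (h0 : u ≠ 0) (h1 : u ≠ 1) (h : O.opt ω (mkPt d 0 u) = O.opt ω' w) :
    rep ω (mkPt d 0 u) = rep ω' w ∨ rep (O.inv d ω) (mkPt d 0 (symm u)) = rep ω' w := by
  have hc : ¬ IsCorner (mkPt d 0 u) := by simp [isCorner_mkPt, h0, h1]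
  rcases eq_or_rel_of_mk_eq_mk h with h | h | h
  · exact Or.inl h
  · refine Or.inr (Rel.eq_of_not_isCorner (O.rel_iff.2 ?_) h ?_)
    · exact ⟨d, O.inv d ω, symm u, rfl, by simp⟩
    · rwa [isCorner_rep]
  · exact absurd (isCorner_rep.1 h.1) hc

theorem opt_mem_vertices {O : Origami ι} {ω : ι × Bool} {z : UnitSquare} :
    O.opt ω z ∈ O.vertices ↔ IsCorner z := by
  constructor
  · rintro ⟨i, w, hw, h⟩
    rcases eq_or_rel_of_mk_eq_mk h with h | h | h
    · rw [← isCorner_rep (ω := ω), ← h]; exact hw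
    · rw [← isCorner_rep (ω := ω), ← h.isCorner_iff]; exact hw
    · exact isCorner_rep.1 h.2
  · intro h
    exact ⟨(rep ω z).1, (rep ω z).2, isCorner_rep.2 h, rfl⟩

theorem finite_setOf_isCorner [Finite ι] : {p : Squares ι | IsCorner p.2}.Finite := by
  have : {p : Squares ι | IsCorner p.2} ⊆ Set.range fun x : ι × Bool × Bool =>
      (⟨x.1, (if x.2.1 then 0 else 1, if x.2.2 then 0 else 1)⟩ : Squares ι) := by
    rintro ⟨i, x, y⟩ ⟨h1, h2⟩
    rcases h1 with h1 | h1 <;> rcases h2 with h2 | h2 <;> obtain rfl : x = _ := h1 <;>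
      obtain rfl : y = _ := h2
    exacts [⟨(i, true, true), rfl⟩, ⟨(i, true, false), rfl⟩, ⟨(i, false, true), rfl⟩,
      ⟨(i, false, false), rfl⟩]
  exact (Set.finite_range _).subset this

/-- The saturation of a closed set is the union of this set, of finitely many compact pieces of
edges, and of some of the finitely many corners. -/
theorem isClosedMap_mk [Finite ι] (O : Origami ι) : IsClosedMap (Quot.mk O.Rel) := by
  intro C hC
  have e : Quot.mk O.Rel ⁻¹' (Quot.mk O.Rel '' C) = C ∪ (⋃ x : Bool × (ι × Bool),
      (fun u => rep (O.inv x.1 x.2) (mkPt x.1 0 (symm u))) ''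
        {u | rep x.2 (mkPt x.1 0 u) ∈ C}) ∪
      {p | IsCorner p.2 ∧ Quot.mk O.Rel p ∈ Quot.mk O.Rel '' C} := by
    ext p
    constructor
    · rintro ⟨q, hq, h⟩
      rcases eq_or_rel_of_mk_eq_mk h with rfl | h' | h'
      · exact Or.inl (Or.inl hq)
      · obtain ⟨d, ω, u, rfl, rfl⟩ := O.rel_iff.1 h'
        exact Or.inl (Or.inr (Set.mem_iUnion.2 ⟨(d, ω), u, hq, rfl⟩))
      · exact Or.inr ⟨h'.2, q, hq, h⟩
    · rintro ((h | h) | h)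
      · exact ⟨p, h, rfl⟩
      · obtain ⟨⟨d, ω⟩, u, hu, rfl⟩ := Set.mem_iUnion.1 h
        exact ⟨_, hu, Quot.sound (O.rel_iff.2 ⟨d, ω, u, rfl, rfl⟩)⟩
      · exact h.2
  have hq : IsQuotientMap (Quot.mk O.Rel) := isQuotientMap_quot_mk
  rw [← hq.isClosed_preimage, e]
  have hcont : ∀ d (ω : ι × Bool), Continuous fun u => rep ω (mkPt d 0 u) := fun d ω =>
    (continuous_rep ω).comp (continuous_mkPt d continuous_const continuous_id)
  refine (hC.union (isClosed_iUnion_of_finite fun x => ?_)).union ?_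
  · exact ((hC.preimage (hcont _ _)).isCompact.image
      ((hcont _ _).comp unitInterval.continuous_symm)).isClosed
  · exact (finite_setOf_isCorner.subset fun p hp => hp.1).isClosed

/-- Fibres are finite, so two of them have disjoint neighbourhoods in the squares, and a closed
quotient map turns these into disjoint neighbourhoods of the points. -/
instance [Finite ι] (O : Origami ι) : T2Space O.Surface := by
  rw [t2Space_iff_disjoint_nhds]
  intro p q hpq
  have hfin : ∀ p : O.Surface, (Quot.mk O.Rel ⁻¹' {p}).Finite := by
    intro p
    obtain ⟨x, rfl⟩ := Quot.exists_rep p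
    have : Quot.mk O.Rel ⁻¹' {Quot.mk O.Rel x} ⊆ {x} ∪ {y | O.Rel x y} ∪ {y | IsCorner y.2} := by
      intro y hy
      rcases eq_or_rel_of_mk_eq_mk (show Quot.mk O.Rel x = Quot.mk O.Rel y from hy.symm) with h | h | h
      · exact Or.inl (Or.inl h.symm)
      · exact Or.inl (Or.inr h)
      · exact Or.inr h.2
    refine (((Set.finite_singleton _).union ?_).union finite_setOf_isCorner).subset this
    by_cases hx : IsCorner x.2
    · exact finite_setOf_isCorner.subset fun y hy => (Rel.isCorner_iff hy).1 hx
    · refine Set.Subsingleton.finite fun y hy z hz => ?_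
      exact (Rel.symm hy).eq_of_not_isCorner hz hx
  have hd : Disjoint (Quot.mk O.Rel ⁻¹' {p}) (Quot.mk O.Rel ⁻¹' {q}) :=
    Disjoint.preimage _ (Set.disjoint_singleton.2 hpq)
  obtain ⟨U, V, hU, hV, hpU, hqV, hUV⟩ :=
    SeparatedNhds.of_isCompact_isCompact (hfin p).isCompact (hfin q).isCompact hd
  have h1 := O.isClosedMap_mk.eventually_nhds_fiber p (p := fun x => x ∈ U)
    fun x hx => hU.mem_nhds (hpU hx)
  have h2 := O.isClosedMap_mk.eventually_nhds_fiber q (p := fun x => x ∈ V)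
    fun x hx => hV.mem_nhds (hqV hx)
  rw [Filter.disjoint_iff]
  refine ⟨_, h1, _, h2, Set.disjoint_left.2 fun r hr1 hr2 => ?_⟩
  obtain ⟨x, rfl⟩ := Quot.exists_rep r
  exact Set.disjoint_left.1 hUV (hr1 x rfl) (hr2 x rfl)

/-- A property holds near a point of the surface if it holds near all its preimages in the
squares. -/
theorem eventually_nhds_of_opt [Finite ι] {O : Origami ι} {P : O.Surface → Prop} {p : O.Surface}
    (h : ∀ ω z, O.opt ω z = p → ∀ᶠ w in 𝓝 z, P (O.opt ω w)) : ∀ᶠ q in 𝓝 p, P q := by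
  have := O.isClosedMap_mk.eventually_nhds_fiber p (p := fun x => P (Quot.mk _ x)) ?_
  · filter_upwards [this] with q hq
    obtain ⟨x, rfl⟩ := Quot.exists_rep q
    exact hq x rfl
  · rintro ⟨i, z⟩ hx
    rw [Sigma.nhds_mk, Filter.eventually_map]
    exact h (i, false) z hx

theorem eventually_opt [Finite ι] {O : Origami ι} {P : O.Surface → Prop} {ω : ι × Bool} {z : UnitSquare}
    (h : ∀ᶠ q in 𝓝 (O.opt ω z), P q) : ∀ᶠ w in 𝓝 z, P (O.opt ω w) :=
  (O.continuous_opt ω).continuousAt.eventually h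

end Origami

/-! ### The map to the pillowcase -/

namespace Origami

variable {ι κ : Type}

open unitInterval (symm)

/-- The map whose fibres are the orbits of the group of the maps `v ↦ ± v + n`, `n` integral. -/
noncomputable def pillow (v : ℝ × ℝ) : ℝ × ℝ × ℝ :=
  (Real.cos (2 * Real.pi * v.1), Real.cos (2 * Real.pi * v.2),
    Real.sin (2 * Real.pi * v.1) * Real.sin (2 * Real.pi * v.2))

/-- The vector with given integral coordinates. -/
def intVec (n : ℤ × ℤ) : ℝ × ℝ := (n.1, n.2)

theorem intVec_zero : intVec 0 = 0 := by simp [intVec]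

theorem intVec_units_smul (s : ℤˣ) (n : ℤ × ℤ) : intVec (s • n) = s • intVec n := by
  rcases Int.units_eq_one_or s with rfl | rfl <;> simp [intVec]

theorem continuous_pillow : Continuous pillow := by unfold pillow; fun_prop

theorem pillow_smul_add (s : ℤˣ) (v : ℝ × ℝ) (n : ℤ × ℤ) :
    pillow (s • v + intVec n) = pillow v := by
  have h1 : ∀ (x : ℝ) (k : ℤ), Real.cos (2 * Real.pi * (x + k)) = Real.cos (2 * Real.pi * x) := by
    intro x k
    rw [mul_add, mul_comm _ (k : ℝ), Real.cos_add_int_mul_two_pi]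
  have h2 : ∀ (x : ℝ) (k : ℤ), Real.sin (2 * Real.pi * (x + k)) = Real.sin (2 * Real.pi * x) := by
    intro x k
    rw [mul_add, mul_comm _ (k : ℝ), Real.sin_add_int_mul_two_pi]
  rcases Int.units_eq_one_or s with rfl | rfl <;> simp [pillow, intVec, h1, h2]

/-- The cosines determine each coordinate up to an integer and a sign of its own. If the two signs
differ, the product of the sines forces one of the sines to vanish; that coordinate is then half an
integer and its sign can be switched. -/
theorem pillow_eq_pillow {v w : ℝ × ℝ} (h : pillow v = pillow w) :
    ∃ (s : ℤˣ) (n : ℤ × ℤ), v = s • w + intVec n := by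
  simp only [pillow, Prod.mk.injEq] at h
  obtain ⟨h1, h2, h3⟩ := h
  have hpi := Real.pi_pos
  have key : ∀ x y : ℝ, Real.cos (2 * Real.pi * x) = Real.cos (2 * Real.pi * y) →
      ∃ k : ℤ, x = y + k ∨ x = -y + k := by
    intro x y hxy
    obtain ⟨k, hk | hk⟩ := Real.cos_eq_cos_iff.1 hxy.symm
    · exact ⟨k, Or.inl (by apply mul_left_cancel₀ hpi.ne'; linarith)⟩
    · exact ⟨k, Or.inr (by apply mul_left_cancel₀ hpi.ne'; linarith)⟩
  have half : ∀ x : ℝ, Real.sin (2 * Real.pi * x) = 0 → ∃ k : ℤ, x = -x + k := by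
    intro x hx
    obtain ⟨k, hk⟩ := Real.sin_eq_zero_iff.1 hx
    exact ⟨k, by apply mul_left_cancel₀ hpi.ne'; linarith⟩
  have s1 : ∀ (x : ℝ) (k : ℤ), Real.sin (2 * Real.pi * (x + k)) = Real.sin (2 * Real.pi * x) := by
    intro x k
    rw [mul_add, mul_comm _ (k : ℝ), Real.sin_add_int_mul_two_pi]
  obtain ⟨v1, v2⟩ := v
  obtain ⟨w1, w2⟩ := w
  simp only at h1 h2 h3
  have conc : ∀ k l : ℤ, (v1 = w1 + k ∧ v2 = w2 + l) ∨ (v1 = -w1 + k ∧ v2 = -w2 + l) →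
      ∃ (s : ℤˣ) (n : ℤ × ℤ), ((v1, v2) : ℝ × ℝ) = s • (w1, w2) + intVec n := by
    rintro k l (⟨e1, e2⟩ | ⟨e1, e2⟩)
    · exact ⟨1, (k, l), by simp [intVec, e1, e2]⟩
    · exact ⟨-1, (k, l), by simp [intVec, e1, e2]⟩
  obtain ⟨k, rfl | rfl⟩ := key _ _ h1 <;> obtain ⟨l, rfl | rfl⟩ := key _ _ h2
  · exact conc k l (Or.inl ⟨rfl, rfl⟩)
  · have h4 : Real.sin (2 * Real.pi * w1) = 0 ∨ Real.sin (2 * Real.pi * w2) = 0 := by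
      rw [s1, s1, mul_neg, Real.sin_neg] at h3
      rw [← mul_eq_zero]
      linarith
    rcases h4 with h4 | h4 <;> obtain ⟨m, hm⟩ := half _ h4
    · exact conc (k + m) l (Or.inr ⟨by push_cast; linarith, rfl⟩)
    · exact conc k (l - m) (Or.inl ⟨rfl, by push_cast; linarith⟩)
  · have h4 : Real.sin (2 * Real.pi * w1) = 0 ∨ Real.sin (2 * Real.pi * w2) = 0 := by
      rw [s1, s1, mul_neg, Real.sin_neg] at h3
      rw [← mul_eq_zero]
      linarith
    rcases h4 with h4 | h4 <;> obtain ⟨m, hm⟩ := half _ h4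
    · exact conc (k - m) l (Or.inl ⟨by push_cast; linarith, rfl⟩)
    · exact conc k (l + m) (Or.inr ⟨rfl, by push_cast; linarith⟩)
  · exact conc k l (Or.inr ⟨rfl, rfl⟩)

theorem pillow_eq_zero {v : ℝ × ℝ} (h : pillow v = pillow 0) : ∃ n, v = intVec n := by
  obtain ⟨s, n, h⟩ := pillow_eq_pillow h
  exact ⟨n, by rw [h, smul_zero, zero_add]⟩

theorem pillow_intVec (n : ℤ × ℤ) : pillow (intVec n) = pillow 0 := by
  have := pillow_smul_add 1 0 n
  rwa [smul_zero, zero_add] at this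

theorem coord_rot (z : UnitSquare) : coord (rot z) = (-1 : ℤˣ) • coord z + intVec (1, 1) := by
  simp [coord, rot, intVec, sub_eq_neg_add]

theorem continuous_coord : Continuous coord := by unfold coord; fun_prop

theorem coord_injective : Function.Injective coord := by
  rintro ⟨a, b⟩ ⟨c, d⟩ h
  simp only [coord, Prod.mk.injEq] at h
  exact Prod.ext (Subtype.ext h.1) (Subtype.ext h.2)

theorem coord_mkPt (d : Bool) (x y : unitInterval) : coord (mkPt d x y) = mkPt d (x : ℝ) y := by
  cases d <;> rfl

theorem isCorner_iff_pillow {z : UnitSquare} : IsCorner z ↔ pillow (coord z) = pillow 0 := by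
  constructor
  · rintro ⟨h1, h2⟩
    obtain ⟨x, y⟩ := z
    rcases h1 with h1 | h1 <;> rcases h2 with h2 | h2 <;> obtain rfl : x = _ := h1 <;>
      obtain rfl : y = _ := h2
    · convert pillow_intVec (0, 0); simp [coord, intVec]
    · convert pillow_intVec (0, 1); simp [coord, intVec]
    · convert pillow_intVec (1, 0); simp [coord, intVec]
    · convert pillow_intVec (1, 1); simp [coord, intVec]
  · intro h
    obtain ⟨n, hn⟩ := pillow_eq_zero h
    have key : ∀ (x : unitInterval) (k : ℤ), (x : ℝ) = k → x = 0 ∨ x = 1 := by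
      intro x k hk
      have h0 := x.2.1
      have h1 := x.2.2
      rw [hk] at h0 h1
      have h0' : 0 ≤ k := by exact_mod_cast h0
      have h1' : k ≤ 1 := by exact_mod_cast h1
      have : k = 0 ∨ k = 1 := by omega
      rcases this with rfl | rfl
      · exact Or.inl (Subtype.ext (by simpa using hk))
      · exact Or.inr (Subtype.ext (by simpa using hk))
    exact ⟨key _ _ (congrArg Prod.fst hn), key _ _ (congrArg Prod.snd hn)⟩

/-- The map from the surface to the pillowcase given by the natural coordinates. -/
noncomputable def dev (O : Origami ι) : O.Surface → ℝ × ℝ × ℝ :=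
  O.lift (fun _ z => pillow (coord z))
    (fun _ z => by rw [coord_rot, pillow_smul_add])
    (fun d ω u => by
      have : coord (mkPt d 0 (symm u)) = (-1 : ℤˣ) • coord (mkPt d 0 u) +
          intVec (mkPt d 0 1) := by
        cases d <;> simp [coord, mkPt, intVec, sub_eq_neg_add]
      rw [this, pillow_smul_add])

theorem dev_opt (O : Origami ι) (ω : ι × Bool) (z : UnitSquare) :
    O.dev (O.opt ω z) = pillow (coord z) := lift_opt ω z

theorem continuous_dev (O : Origami ι) : Continuous O.dev :=
  continuous_lift fun _ => continuous_pillow.comp continuous_coord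

theorem mem_vertices_iff_dev {O : Origami ι} {p : O.Surface} : p ∈ O.vertices ↔ O.dev p = pillow 0 := by
  obtain ⟨ω, z, rfl⟩ := O.exists_opt_eq p
  rw [opt_mem_vertices, dev_opt, isCorner_iff_pillow]

/-! ### Natural charts -/

theorem units_smul_cancel (s : ℤˣ) (v : ℝ × ℝ) : s • s • v = v := by
  rw [smul_smul, Int.units_mul_self, one_smul]

theorem IsNatural.exists_opt {O : Origami ι} {e : OpenPartialHomeomorph O.Surface (ℝ × ℝ)}
    (he : O.IsNatural e) {ω : ι × Bool} {z : UnitSquare} (h : O.opt ω z ∈ e.source) :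
    ∃ (s : ℤˣ) (c : ℝ × ℝ), ∀ᶠ w in 𝓝 z, e (O.opt ω w) = s • coord w + c := by
  obtain ⟨i, b⟩ := ω
  cases b
  · exact he.2 i z h
  · obtain ⟨s, c, hc⟩ := he.2 i (rot z) h
    refine ⟨-s, s • intVec (1, 1) + c, ?_⟩
    filter_upwards [continuous_rot.continuousAt.eventually hc] with w hw
    rw [show O.opt (i, true) w = O.pt i (rot w) from rfl, hw, coord_rot, smul_add, smul_smul,
      mul_neg_one, add_assoc]

/-- Both formulas describe `e` on the common edge. Comparing them at `u` and at a nearby point `t`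
of the edge fixes the sign and the constant on the far side. -/
theorem IsNatural.exists_opt_inv {O : Origami ι} {e : OpenPartialHomeomorph O.Surface (ℝ × ℝ)}
    (he : O.IsNatural e) {d : Bool} {ω : ι × Bool} {u : unitInterval}
    (h : O.opt ω (mkPt d 0 u) ∈ e.source) : ∃ (s : ℤˣ) (c : ℝ × ℝ),
      (∀ᶠ w in 𝓝 (mkPt d 0 u), e (O.opt ω w) = s • coord w + c) ∧
      ∀ᶠ w in 𝓝 (mkPt d 0 (symm u)), e (O.opt (O.inv d ω) w) =
        (-s) • coord w + (c + s • intVec (mkPt d 0 1)) := by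
  obtain ⟨s, c, h1⟩ := he.exists_opt h
  rw [← O.opt_inv] at h
  obtain ⟨s', c', h2⟩ := he.exists_opt h
  refine ⟨s, c, h1, ?_⟩
  have k1 : ∀ᶠ u' in 𝓝 u, e (O.opt ω (mkPt d 0 u')) = s • coord (mkPt d 0 u') + c :=
    (continuous_mkPt d continuous_const continuous_id).continuousAt.eventually h1
  have k2 : ∀ᶠ u' in 𝓝 u, e (O.opt ω (mkPt d 0 u')) = s' • coord (mkPt d 0 (symm u')) + c' := by
    have := (continuous_mkPt d (continuous_const (y := (0 : unitInterval)))
      unitInterval.continuous_symm).continuousAt.eventually h2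
    simpa only [O.opt_inv] using this
  have k3 := k1.and k2
  obtain ⟨t, ⟨t1, t2⟩, ht⟩ := ((k3.filter_mono nhdsWithin_le_nhds).and
    (self_mem_nhdsWithin : {u}ᶜ ∈ 𝓝[≠] u)).exists
  obtain ⟨u1, u2⟩ := k3.self_of_nhds
  rw [u1] at u2
  rw [t1] at t2
  have htu : (t : ℝ) - u ≠ 0 := fun h => ht (Subtype.ext (sub_eq_zero.1 h))
  have goal : s' = -s ∧ c' = c + s • intVec (mkPt d 0 1) := by
    rw [coord_mkPt, coord_mkPt] at u2 t2
    obtain ⟨c1, c2⟩ := c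
    obtain ⟨c1', c2'⟩ := c'
    have hs : (t : ℝ) - u = u - t → False := fun h => htu (by linarith)
    cases d <;> rcases Int.units_eq_one_or s with rfl | rfl <;>
      rcases Int.units_eq_one_or s' with rfl | rfl <;>
      simp [mkPt, intVec, Prod.ext_iff] at u2 t2 ⊢ <;>
      first
        | (constructor <;> linarith)
        | (exfalso; apply hs; linarith)
  rw [← goal.1, ← goal.2]
  exact h2

theorem eventually_opt_of_rep_eq {O : Origami ι} {P : O.Surface → Prop} {ω ω' : ι × Bool}
    {z z' : UnitSquare} (h : rep ω z = rep ω' z') (hP : ∀ᶠ w in 𝓝 z, P (O.opt ω w)) :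
    ∀ᶠ w in 𝓝 z', P (O.opt ω' w) := by
  rcases rep_eq_rep h with ⟨rfl, rfl⟩ | ⟨rfl, rfl⟩
  · exact hP
  · rw [← rot_rot z] at hP
    filter_upwards [continuous_rot.continuousAt.eventually hP] with w hw
    rwa [opt_flip]

theorem exists_edge (ω : ι × Bool) {z : UnitSquare} (hz : ¬ IsInner z) (hz' : ¬ IsCorner z) :
    ∃ (d : Bool) (ω' : ι × Bool) (u : unitInterval), u ≠ 0 ∧ u ≠ 1 ∧
      rep ω z = rep ω' (mkPt d 0 u) := by
  obtain ⟨x, y⟩ := z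
  have key : ∀ z', rep ω (rot z') = rep (flip ω) z' := fun z' => by
    rw [← rep_flip ω, rot_rot]
  simp only [IsCorner] at hz'
  by_cases h1 : x = 0
  · subst h1
    exact ⟨true, ω, y, by tauto, by tauto, rfl⟩
  by_cases h2 : x = 1
  · subst h2
    refine ⟨true, flip ω, symm y, ?_, ?_, ?_⟩
    · rw [Ne, unitInterval.symm_eq_zero]; tauto
    · rw [Ne, unitInterval.symm_eq_one]; tauto
    · rw [← key, rot_mkPt]; simp [mkPt]
  by_cases h3 : y = 0
  · subst h3
    exact ⟨false, ω, x, by tauto, by tauto, rfl⟩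
  by_cases h4 : y = 1
  · subst h4
    refine ⟨false, flip ω, symm x, ?_, ?_, ?_⟩
    · rw [Ne, unitInterval.symm_eq_zero]; tauto
    · rw [Ne, unitInterval.symm_eq_one]; tauto
    · rw [← key, rot_mkPt]; simp [mkPt]
  · exact absurd ⟨⟨h1, h2⟩, ⟨h3, h4⟩⟩ hz

theorem eventually_of_inner [Finite ι] {O : Origami ι} {P : O.Surface → Prop} {ω : ι × Bool}
    {z : UnitSquare} (hz : IsInner z) (h : ∀ᶠ w in 𝓝 z, P (O.opt ω w)) :
    ∀ᶠ q in 𝓝 (O.opt ω z), P q :=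
  eventually_nhds_of_opt fun _ _ h' => eventually_opt_of_rep_eq (rep_eq_of_isInner hz h'.symm) h

theorem eventually_of_edge [Finite ι] {O : Origami ι} {P : O.Surface → Prop} {d : Bool}
    {ω : ι × Bool} {u : unitInterval} (h0 : u ≠ 0) (h1 : u ≠ 1)
    (h : ∀ᶠ w in 𝓝 (mkPt d 0 u), P (O.opt ω w))
    (h' : ∀ᶠ w in 𝓝 (mkPt d 0 (symm u)), P (O.opt (O.inv d ω) w)) :
    ∀ᶠ q in 𝓝 (O.opt ω (mkPt d 0 u)), P q :=
  eventually_nhds_of_opt fun _ _ hq => by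
    rcases rep_eq_of_edge h0 h1 hq.symm with hr | hr
    · exact eventually_opt_of_rep_eq hr h
    · exact eventually_opt_of_rep_eq hr h'

theorem opt_eq_of_rep_eq {O : Origami ι} {ω ω' : ι × Bool} {z w : UnitSquare}
    (h : rep ω z = rep ω' w) : O.opt ω z = O.opt ω' w := congrArg (Quot.mk _) h

/-- Natural coordinates determine the map to the pillowcase up to a translation. -/
theorem IsNatural.exists_dev_eq [Finite ι] {O : Origami ι}
    {e : OpenPartialHomeomorph O.Surface (ℝ × ℝ)} (he : O.IsNatural e) {p : O.Surface}
    (hp : p ∈ e.source) : ∃ c, ∀ᶠ q in 𝓝 p, O.dev q = pillow (e q + c) := by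
  have hv : p ∉ O.vertices := fun h => Set.disjoint_left.1 he.1 hp h
  obtain ⟨ω, z, rfl⟩ := O.exists_opt_eq p
  rw [opt_mem_vertices] at hv
  have key : ∀ (s : ℤˣ) (c w : ℝ × ℝ) (n : ℤ × ℤ),
      pillow w = pillow (s • w + (c + intVec n) + -c) := by
    intro s c w n
    rw [show s • w + (c + intVec n) + -c = s • w + intVec n by abel, pillow_smul_add]
  have key' : ∀ (s : ℤˣ) (c w : ℝ × ℝ), pillow w = pillow (s • w + c + -c) := by
    intro s c w
    have := key s c w 0
    rwa [intVec_zero, add_zero] at this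
  by_cases hz : IsInner z
  · obtain ⟨s, c, h⟩ := he.exists_opt hp
    refine ⟨-c, eventually_of_inner hz ?_⟩
    filter_upwards [h] with w hw
    rw [hw, dev_opt, ← key']
  · obtain ⟨d, ω', u, h0, h1, hr⟩ := exists_edge ω hz hv
    rw [opt_eq_of_rep_eq hr] at hp ⊢
    obtain ⟨s, c, h2, h3⟩ := he.exists_opt_inv hp
    refine ⟨-c, eventually_of_edge h0 h1 ?_ ?_⟩
    · filter_upwards [h2] with w hw
      rw [hw, dev_opt, ← key']
    · filter_upwards [h3] with w hw
      rw [hw, dev_opt, ← intVec_units_smul, ← key]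

end Origami

/-! ### Affine homeomorphisms have integral derivative -/

namespace Origami

variable {ι κ : Type}

open unitInterval (symm)

theorem planeMap_add (A : Matrix.SpecialLinearGroup (Fin 2) ℝ) (v w : ℝ × ℝ) :
    planeMap A (v + w) = planeMap A v + planeMap A w := by
  simp only [planeMap, Prod.fst_add, Prod.snd_add, Prod.mk_add_mk]
  congr 1 <;> ring

theorem planeMap_smul (A : Matrix.SpecialLinearGroup (Fin 2) ℝ) (s : ℤˣ) (v : ℝ × ℝ) :
    planeMap A (s • v) = s • planeMap A v := by
  rcases Int.units_eq_one_or s with rfl | rfl <;> simp [planeMap]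

theorem planeMap_one (v : ℝ × ℝ) : planeMap 1 v = v := by simp [planeMap]

theorem planeMap_mul (A B : Matrix.SpecialLinearGroup (Fin 2) ℝ) (v : ℝ × ℝ) :
    planeMap (A * B) v = planeMap A (planeMap B v) := by
  simp only [planeMap, Matrix.SpecialLinearGroup.coe_mul, Matrix.mul_apply, Fin.sum_univ_two]
  congr 1 <;> ring

theorem planeMap_neg (A : Matrix.SpecialLinearGroup (Fin 2) ℝ) (v : ℝ × ℝ) :
    planeMap (-A) v = (-1 : ℤˣ) • planeMap A v := by
  simp [planeMap]

theorem continuous_planeMap (A : Matrix.SpecialLinearGroup (Fin 2) ℝ) : Continuous (planeMap A) := by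
  unfold planeMap; fun_prop

/-- The matrix with real entries given by one with integral entries. -/
def toReal (B : Matrix.SpecialLinearGroup (Fin 2) ℤ) : Matrix.SpecialLinearGroup (Fin 2) ℝ :=
  Matrix.SpecialLinearGroup.map (Int.castRingHom ℝ) B

theorem toReal_apply (B : Matrix.SpecialLinearGroup (Fin 2) ℤ) (i j : Fin 2) :
    (toReal B).1 i j = (B.1 i j : ℝ) := rfl

theorem planeMap_intVec (B : Matrix.SpecialLinearGroup (Fin 2) ℤ) (n : ℤ × ℤ) :
    planeMap (toReal B) (intVec n) =
      intVec (B.1 0 0 * n.1 + B.1 0 1 * n.2, B.1 1 0 * n.1 + B.1 1 1 * n.2) := by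
  simp [planeMap, intVec, toReal_apply]

/-- Maps that are given by a matrix on the pillowcase. -/
def IsOver (O : Origami ι) (O' : Origami κ) (A : Matrix.SpecialLinearGroup (Fin 2) ℝ)
    (f : O.Surface → O'.Surface) : Prop :=
  ∀ ω z, O'.dev (f (O.opt ω z)) = pillow (planeMap A (coord z))

/-- The outer matrix must be integral, so that it maps fibres of `pillow` into fibres; the inner one
need not be. -/
theorem IsOver.comp {μ : Type} {O : Origami ι} {O' : Origami κ} {O'' : Origami μ}
    {A : Matrix.SpecialLinearGroup (Fin 2) ℝ} {B : Matrix.SpecialLinearGroup (Fin 2) ℤ}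
    {f : O.Surface → O'.Surface} {g : O'.Surface → O''.Surface} (hg : IsOver O' O'' (toReal B) g)
    (hf : IsOver O O' A f) : IsOver O O'' (toReal B * A) (g ∘ f) := by
  intro ω z
  obtain ⟨ω', w, hw⟩ := O'.exists_opt_eq (f (O.opt ω z))
  have h := hf ω z
  rw [← hw, dev_opt] at h
  obtain ⟨s, n, hn⟩ := pillow_eq_pillow h
  rw [Function.comp_apply, ← hw, hg, hn, planeMap_add, planeMap_intVec, planeMap_smul,
    pillow_smul_add, planeMap_mul]

theorem IsOver.neg {O : Origami ι} {O' : Origami κ} {A : Matrix.SpecialLinearGroup (Fin 2) ℝ}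
    {f : O.Surface → O'.Surface} (hf : IsOver O O' A f) : IsOver O O' (-A) f := by
  intro ω z
  have := pillow_smul_add (-1) (planeMap A (coord z)) 0
  rw [intVec_zero, add_zero] at this
  rw [hf, planeMap_neg, this]

theorem analyticOnNhd_pillow (A : Matrix.SpecialLinearGroup (Fin 2) ℝ) (c : ℝ × ℝ) (U : Set (ℝ × ℝ)) :
    AnalyticOnNhd ℝ (fun v => pillow (planeMap A v + c)) U := by
  intro v _
  simp only [pillow, planeMap, Prod.fst_add, Prod.snd_add]
  have h1 : AnalyticAt ℝ (fun v : ℝ × ℝ => 2 * Real.pi * (A.1 0 0 * v.1 + A.1 0 1 * v.2 + c.1)) v :=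
    analyticAt_const.mul (((analyticAt_const.mul analyticAt_fst).add
      (analyticAt_const.mul analyticAt_snd)).add analyticAt_const)
  have h2 : AnalyticAt ℝ (fun v : ℝ × ℝ => 2 * Real.pi * (A.1 1 0 * v.1 + A.1 1 1 * v.2 + c.2)) v :=
    analyticAt_const.mul (((analyticAt_const.mul analyticAt_fst).add
      (analyticAt_const.mul analyticAt_snd)).add analyticAt_const)
  exact (Real.analyticAt_cos.comp h1).prod ((Real.analyticAt_cos.comp h2).prod
    ((Real.analyticAt_sin.comp h1).mul (Real.analyticAt_sin.comp h2)))

theorem dense_isInner : Dense {z : UnitSquare | IsInner z} := by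
  have h : Dense {x : unitInterval | x ≠ 0 ∧ x ≠ 1} := by
    have : {x : unitInterval | x ≠ 0 ∧ x ≠ 1} = Set.univ \ {0, 1} := by
      ext x; simp
    rw [this]
    exact dense_univ.sdiff_finite (Set.toFinite _)
  exact h.prod h

theorem IsAffine.eventually_dev_eq [Finite ι] [Finite κ] {O : Origami ι} {O' : Origami κ}
    {A : Matrix.SpecialLinearGroup (Fin 2) ℝ} {f : O.Surface ≃ₜ O'.Surface} (hf : IsAffine O O' A f)
    (ω : ι × Bool) {z : UnitSquare} (hz : IsInner z) :
    ∃ c, ∀ᶠ w in 𝓝 z, O'.dev (f (O.opt ω w)) = pillow (planeMap A (coord w) + c) := by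
  have hv : O.opt ω z ∉ O.vertices := fun h => hz.not_isCorner (opt_mem_vertices.1 h)
  obtain ⟨e, e', he, he', hp, hp', c0, h0⟩ := hf.2 _ hv
  obtain ⟨c1, h1⟩ := he'.exists_dev_eq hp'
  obtain ⟨s, c2, h2⟩ := he.exists_opt hp
  refine ⟨s • (planeMap A c2 + c0 + c1), ?_⟩
  filter_upwards [h2, eventually_opt h0, eventually_opt (f.continuous.continuousAt.eventually h1)]
    with w w2 w0 w1
  rw [w1, w0, w2, planeMap_add, planeMap_smul]
  have := pillow_smul_add s (s • planeMap A (coord w) + planeMap A c2 + c0 + c1) 0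
  rw [intVec_zero, add_zero] at this
  rw [← this, add_assoc, add_assoc, smul_add, units_smul_cancel, ← add_assoc (planeMap A c2)]

/-- The point of the unit square closest to a point of the plane. -/
noncomputable def squareProj (v : ℝ × ℝ) : UnitSquare :=
  (Set.projIcc 0 1 zero_le_one v.1, Set.projIcc 0 1 zero_le_one v.2)

theorem continuous_squareProj : Continuous squareProj := by
  unfold squareProj
  exact (continuous_projIcc.comp continuous_fst).prodMk (continuous_projIcc.comp continuous_snd)

theorem squareProj_coord (z : UnitSquare) : squareProj (coord z) = z := by
  simp [squareProj, coord]

theorem coord_squareProj {v : ℝ × ℝ} (h1 : v.1 ∈ Set.Icc (0 : ℝ) 1) (h2 : v.2 ∈ Set.Icc (0 : ℝ) 1) :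
    coord (squareProj v) = v := by
  simp [squareProj, coord, Set.projIcc_of_mem _ h1, Set.projIcc_of_mem _ h2]

theorem isInner_squareProj {v : ℝ × ℝ} (h1 : v.1 ∈ Set.Ioo (0 : ℝ) 1) (h2 : v.2 ∈ Set.Ioo (0 : ℝ) 1) :
    IsInner (squareProj v) := by
  have key : ∀ x ∈ Set.Ioo (0 : ℝ) 1, Set.projIcc (0 : ℝ) 1 zero_le_one x ≠ 0 ∧
      Set.projIcc (0 : ℝ) 1 zero_le_one x ≠ 1 := by
    intro x hx
    rw [Set.projIcc_of_mem _ (Set.Ioo_subset_Icc_self hx)]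
    constructor <;> intro h
    · exact hx.1.ne' (congrArg Subtype.val h)
    · exact hx.2.ne (congrArg Subtype.val h)
  exact ⟨key _ h1, key _ h2⟩

theorem isInner_iff_coord {z : UnitSquare} : IsInner z ↔
    coord z ∈ Set.Ioo (0 : ℝ) 1 ×ˢ Set.Ioo (0 : ℝ) 1 := by
  constructor
  · intro h
    exact ⟨⟨lt_of_le_of_ne z.1.2.1 fun h' => h.1.1 (Subtype.ext h'.symm),
      lt_of_le_of_ne z.1.2.2 fun h' => h.1.2 (Subtype.ext h')⟩,
      ⟨lt_of_le_of_ne z.2.2.1 fun h' => h.2.1 (Subtype.ext h'.symm),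
      lt_of_le_of_ne z.2.2.2 fun h' => h.2.2 (Subtype.ext h')⟩⟩
  · rintro ⟨h1, h2⟩
    rw [← squareProj_coord z]
    exact isInner_squareProj h1 h2

/-- The constant is a priori only local. But the left side is real analytic on the open square, so
the identity theorem propagates the formula from the centre, and density extends it to the boundary.
-/
theorem IsAffine.exists_dev_eq [Finite ι] [Finite κ] {O : Origami ι} {O' : Origami κ}
    {A : Matrix.SpecialLinearGroup (Fin 2) ℝ} {f : O.Surface ≃ₜ O'.Surface} (hf : IsAffine O O' A f)
    (ω : ι × Bool) :
    ∃ c, ∀ z, O'.dev (f (O.opt ω z)) = pillow (planeMap A (coord z) + c) := by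
  set U : Set (ℝ × ℝ) := Set.Ioo (0 : ℝ) 1 ×ˢ Set.Ioo (0 : ℝ) 1 with hU
  have hUo : IsOpen U := isOpen_Ioo.prod isOpen_Ioo
  have hUp : IsPreconnected U := isPreconnected_Ioo.prod isPreconnected_Ioo
  have local_eq : ∀ v ∈ U, ∃ c, ∀ᶠ w in 𝓝 v,
      O'.dev (f (O.opt ω (squareProj w))) = pillow (planeMap A w + c) := by
    intro v hv
    obtain ⟨c, hc⟩ := hf.eventually_dev_eq ω (isInner_squareProj hv.1 hv.2)
    refine ⟨c, ?_⟩
    filter_upwards [continuous_squareProj.continuousAt.eventually hc, hUo.mem_nhds hv] with w h1 h2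
    rw [h1, coord_squareProj (Set.Ioo_subset_Icc_self h2.1) (Set.Ioo_subset_Icc_self h2.2)]
  have han : AnalyticOnNhd ℝ (fun w => O'.dev (f (O.opt ω (squareProj w)))) U := by
    intro v hv
    obtain ⟨c, hc⟩ := local_eq v hv
    exact (analyticOnNhd_pillow A c U v hv).congr (Filter.EventuallyEq.symm hc)
  have h0 : ((1 / 2, 1 / 2) : ℝ × ℝ) ∈ U := by simp only [hU]; norm_num
  obtain ⟨c, hc⟩ := local_eq _ h0
  have heq := han.eqOn_of_preconnected_of_eventuallyEq (analyticOnNhd_pillow A c U) hUp h0 hc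
  refine ⟨c, fun z => ?_⟩
  have hcl := Continuous.ext_on (f := fun z => O'.dev (f (O.opt ω z)))
    (g := fun z => pillow (planeMap A (coord z) + c)) dense_isInner
    (O'.continuous_dev.comp (f.continuous.comp (O.continuous_opt ω)))
    (continuous_pillow.comp (((continuous_planeMap A).comp continuous_coord).add continuous_const))
    fun z hz => by
      have := heq (isInner_iff_coord.1 hz)
      simp only [squareProj_coord] at this
      exact this
  exact congrFun hcl z

/-- Corners go to vertices, where `dev` takes the value `pillow 0`. Hence the constant is integral
and can be dropped inside `pillow`, and the images of `(1, 0)` and `(0, 1)`, the columns of `A`, are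
integral too. -/
theorem IsAffine.exists_isOver [Finite ι] [Nonempty ι] [Finite κ] {O : Origami ι} {O' : Origami κ}
    {A : Matrix.SpecialLinearGroup (Fin 2) ℝ} {f : O.Surface ≃ₜ O'.Surface}
    (hf : IsAffine O O' A f) : IsOver O O' A f ∧ ∃ B, A = toReal B := by
  have corner : ∀ ω c, (∀ z, O'.dev (f (O.opt ω z)) = pillow (planeMap A (coord z) + c)) →
      ∀ z, IsCorner z → ∃ n, planeMap A (coord z) + c = intVec n := by
    intro ω c hc z hz
    apply pillow_eq_zero
    rw [← hc, ← mem_vertices_iff_dev, ← hf.1]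
    exact ⟨_, opt_mem_vertices.2 hz, rfl⟩
  have c0 : ∀ ω c, (∀ z, O'.dev (f (O.opt ω z)) = pillow (planeMap A (coord z) + c)) →
      ∃ n, c = intVec n := by
    intro ω c hc
    obtain ⟨n, hn⟩ := corner ω c hc (0, 0) ⟨Or.inl rfl, Or.inl rfl⟩
    refine ⟨n, ?_⟩
    rw [← hn]
    simp [planeMap, coord]
  constructor
  · intro ω z
    obtain ⟨c, hc⟩ := hf.exists_dev_eq ω
    obtain ⟨n, rfl⟩ := c0 ω c hc
    have := pillow_smul_add 1 (planeMap A (coord z)) n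
    rw [one_smul] at this
    rw [hc, this]
  · have ω : ι × Bool := (Classical.arbitrary ι, false)
    obtain ⟨c, hc⟩ := hf.exists_dev_eq ω
    obtain ⟨n, rfl⟩ := c0 ω c hc
    obtain ⟨n1, h1⟩ := corner ω _ hc (1, 0) ⟨Or.inr rfl, Or.inl rfl⟩
    obtain ⟨n2, h2⟩ := corner ω _ hc (0, 1) ⟨Or.inl rfl, Or.inr rfl⟩
    simp only [planeMap, coord, intVec, Set.Icc.coe_one, Set.Icc.coe_zero, mul_one, mul_zero, add_zero,
      zero_add, Prod.mk_add_mk, Prod.mk.injEq] at h1 h2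
    have hM : A.1 = (!![n1.1 - n.1, n2.1 - n.1; n1.2 - n.2, n2.2 - n.2] :
        Matrix (Fin 2) (Fin 2) ℤ).map (Int.cast : ℤ → ℝ) := by
      ext i j
      fin_cases i <;> fin_cases j <;> simp <;> linarith [h1.1, h1.2, h2.1, h2.2]
    have hdet : (!![n1.1 - n.1, n2.1 - n.1; n1.2 - n.2, n2.2 - n.2] :
        Matrix (Fin 2) (Fin 2) ℤ).det = 1 := by
      have := A.2
      rw [hM] at this
      have h3 := Matrix.det_fin_two ((!![n1.1 - n.1, n2.1 - n.1; n1.2 - n.2, n2.2 - n.2] :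
        Matrix (Fin 2) (Fin 2) ℤ).map (Int.cast : ℤ → ℝ))
      rw [this] at h3
      rw [Matrix.det_fin_two]
      simp only [Matrix.map_apply] at h3
      exact_mod_cast h3.symm
    exact ⟨⟨_, hdet⟩, Subtype.ext hM⟩

end Origami

/-! ### Existence of natural charts -/

namespace Origami

variable {ι κ : Type}

open unitInterval (symm)

/-- The coordinate perpendicular to the left (`d = true`) or lower (`d = false`) edge. -/
def height (d : Bool) (v : ℝ × ℝ) : ℝ := if d then v.1 else v.2

theorem continuous_height (d : Bool) : Continuous (height d) := by
  cases d
  · exact continuous_snd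
  · exact continuous_fst

/-- The half rotation of the plane about the midpoint of the left or lower edge of the unit square. -/
def edgeRot (d : Bool) (v : ℝ × ℝ) : ℝ × ℝ := (-1 : ℤˣ) • v + mkPt d 0 1

theorem edgeRot_edgeRot (d : Bool) (v : ℝ × ℝ) : edgeRot d (edgeRot d v) = v := by
  simp [edgeRot]

theorem continuous_edgeRot (d : Bool) : Continuous (edgeRot d) :=
  (continuous_id.const_smul (-1 : ℤˣ)).add continuous_const

theorem height_edgeRot (d : Bool) (v : ℝ × ℝ) : height d (edgeRot d v) = -height d v := by
  cases d <;> simp [height, edgeRot, mkPt]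

theorem height_coord_nonneg (d : Bool) (z : UnitSquare) : 0 ≤ height d (coord z) := by
  cases d
  · exact z.2.2.1
  · exact z.1.2.1

theorem exists_mkPt_zero {d : Bool} {z : UnitSquare} (h : height d (coord z) = 0) :
    ∃ u, z = mkPt d 0 u := by
  cases d
  · exact ⟨z.1, Prod.ext rfl (Subtype.ext h)⟩
  · exact ⟨z.2, Prod.ext (Subtype.ext h) rfl⟩

theorem edgeRot_coord_mkPt (d : Bool) (u : unitInterval) :
    edgeRot d (coord (mkPt d 0 u)) = coord (mkPt d 0 (symm u)) := by
  cases d <;> simp [edgeRot, coord, mkPt, sub_eq_neg_add]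

/-- The inverse of a natural chart: a placed square is developed to the unit square, and the placed
square beyond its left or lower edge to the unit square on the other side of this edge. -/
noncomputable def chartInv (O : Origami ι) (d : Bool) (ω : ι × Bool) (v : ℝ × ℝ) : O.Surface :=
  if 0 ≤ height d v then O.opt ω (squareProj v) else O.opt (O.inv d ω) (squareProj (edgeRot d v))

theorem chartInv_coord (O : Origami ι) (d : Bool) (ω : ι × Bool) (w : UnitSquare) :
    O.chartInv d ω (coord w) = O.opt ω w := by
  rw [chartInv, if_pos (height_coord_nonneg d w), squareProj_coord]

theorem chartInv_edgeRot (O : Origami ι) (d : Bool) (ω : ι × Bool) (w : UnitSquare) :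
    O.chartInv d ω (edgeRot d (coord w)) = O.opt (O.inv d ω) w := by
  rcases (height_coord_nonneg d w).eq_or_lt' with h | h
  · obtain ⟨u, rfl⟩ := exists_mkPt_zero h
    rw [edgeRot_coord_mkPt, chartInv_coord, ← O.opt_inv, unitInterval.symm_symm]
  · rw [chartInv, if_neg (by rw [height_edgeRot]; linarith), edgeRot_edgeRot, squareProj_coord]

theorem continuous_chartInv (O : Origami ι) (d : Bool) (ω : ι × Bool) :
    Continuous (O.chartInv d ω) := by
  refine Continuous.if_le ((O.continuous_opt _).comp continuous_squareProj)
    ((O.continuous_opt _).comp (continuous_squareProj.comp (continuous_edgeRot d)))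
    continuous_const (continuous_height d) fun v hv => ?_
  have h1 : ∃ u, squareProj v = mkPt d 0 u ∧ squareProj (edgeRot d v) = mkPt d 0 (symm u) := by
    -- The line where the two formulas meet extends beyond the edge, so the projection to the unit
    -- interval has to commute with `y ↦ 1 - y`.
    have key : ∀ y : ℝ, Set.projIcc (0 : ℝ) 1 zero_le_one (-y + 1) =
        symm (Set.projIcc (0 : ℝ) 1 zero_le_one y) := by
      intro y
      apply Subtype.ext
      simp only [unitInterval.coe_symm_eq, Set.coe_projIcc]
      rcases le_total y 0 with h | h
      · rw [min_eq_right (by linarith : y ≤ 1), max_eq_left h, min_eq_left (by linarith)]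
        norm_num
      · rcases le_total y 1 with h' | h'
        · rw [min_eq_right h', max_eq_right h, min_eq_right (by linarith), max_eq_right (by linarith)]
          ring
        · rw [min_eq_left h', min_eq_right (by linarith), max_eq_left (by linarith)]
          norm_num
    cases d
    · refine ⟨Set.projIcc (0 : ℝ) 1 zero_le_one v.1, ?_, ?_⟩
      · have : v.2 = 0 := hv.symm
        simp [squareProj, mkPt, this]
      · have : v.2 = 0 := hv.symm
        simp [squareProj, mkPt, this, edgeRot, key]
    · refine ⟨Set.projIcc (0 : ℝ) 1 zero_le_one v.2, ?_, ?_⟩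
      · have : v.1 = 0 := hv.symm
        simp [squareProj, mkPt, this]
      · have : v.1 = 0 := hv.symm
        simp [squareProj, mkPt, this, edgeRot, key]
  obtain ⟨u, h1, h2⟩ := h1
  show O.opt ω (squareProj v) = O.opt (O.inv d ω) (squareProj (edgeRot d v))
  rw [h1, h2, O.opt_inv]

/-- The domain of the inverse charts. -/
def cell (d : Bool) : Set (ℝ × ℝ) :=
  {v | height d v ∈ Set.Ioo (-1 / 4 : ℝ) (3 / 4) ∧ height (!d) v ∈ Set.Ioo (0 : ℝ) 1}

theorem isOpen_cell (d : Bool) : IsOpen (cell d) :=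
  (isOpen_Ioo.preimage (continuous_height d)).inter (isOpen_Ioo.preimage (continuous_height !d))

/-- Every point of the cell lies in one of the two squares. -/
theorem cell_cases {d : Bool} {v : ℝ × ℝ} (hv : v ∈ cell d) :
    (∃ z, IsInner z ∧ height d (coord z) < 3 / 4 ∧ v = coord z) ∨
    (∃ z, IsInner z ∧ height d (coord z) < 1 / 4 ∧ v = edgeRot d (coord z)) ∨
    (∃ u : unitInterval, u ≠ 0 ∧ u ≠ 1 ∧ v = coord (mkPt d 0 u)) := by
  obtain ⟨⟨h1, h2⟩, h3⟩ := hv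
  have inner : ∀ v : ℝ × ℝ, height d v ∈ Set.Ioo (0 : ℝ) 1 → height (!d) v ∈ Set.Ioo (0 : ℝ) 1 →
      IsInner (squareProj v) ∧ coord (squareProj v) = v := by
    intro v h h'
    cases d
    · exact ⟨isInner_squareProj h' h, coord_squareProj (Set.Ioo_subset_Icc_self h')
        (Set.Ioo_subset_Icc_self h)⟩
    · exact ⟨isInner_squareProj h h', coord_squareProj (Set.Ioo_subset_Icc_self h)
        (Set.Ioo_subset_Icc_self h')⟩
  rcases lt_trichotomy (height d v) 0 with h | h | h
  · right; left
    have h4 : height (!d) (edgeRot d v) = 1 - height (!d) v := by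
      cases d <;> simp [height, edgeRot, mkPt, sub_eq_neg_add]
    obtain ⟨i1, i2⟩ := inner (edgeRot d v) (by rw [height_edgeRot]; constructor <;> linarith)
      (by rw [h4]; constructor <;> linarith [h3.1, h3.2])
    refine ⟨_, i1, ?_, ?_⟩
    · rw [i2, height_edgeRot]; linarith
    · rw [i2, edgeRot_edgeRot]
  · right; right
    refine ⟨⟨height (!d) v, h3.1.le, h3.2.le⟩, ?_, ?_, ?_⟩
    · exact fun h' => h3.1.ne' (congrArg Subtype.val h')
    · exact fun h' => h3.2.ne (congrArg Subtype.val h')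
    · cases d
      · exact Prod.ext rfl h
      · exact Prod.ext h rfl
  · left
    obtain ⟨i1, i2⟩ := inner v ⟨h, by linarith⟩ h3
    exact ⟨_, i1, by rwa [i2], i2.symm⟩

theorem height_coord_rot (d : Bool) (z : UnitSquare) :
    height d (coord (rot z)) = 1 - height d (coord z) := by
  cases d <;> simp [height, coord, rot]

/-- The bounds `-1 / 4` and `3 / 4` matter when an edge is glued to the opposite edge of the same
square: the part beyond the edge then has heights above `3 / 4` in that square, which the part on
this side does not reach. -/
theorem injOn_chartInv (O : Origami ι) (d : Bool) (ω : ι × Bool) :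
    Set.InjOn (O.chartInv d ω) (cell d) := by
  intro v hv v' hv' h
  have not_edge : ∀ {z : UnitSquare} {ω₁ ω₂ : ι × Bool} {u : unitInterval}, IsInner z →
      rep ω₁ z ≠ rep ω₂ (mkPt d 0 u) := by
    intro z ω₁ ω₂ u hz h
    rcases rep_eq_rep h with ⟨-, h⟩ | ⟨-, h⟩
    · exact not_isInner_mkPt (h ▸ hz)
    · exact not_isInner_mkPt (h ▸ isInner_rot.2 hz)
  rcases cell_cases hv with ⟨z, hz, hz', rfl⟩ | ⟨z, hz, hz', rfl⟩ | ⟨u, hu0, hu1, rfl⟩ <;>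
    rcases cell_cases hv' with ⟨w, hw, hw', rfl⟩ | ⟨w, hw, hw', rfl⟩ | ⟨t, ht0, ht1, rfl⟩ <;>
    simp only [chartInv_coord, chartInv_edgeRot] at h
  · rcases rep_eq_rep (rep_eq_of_isInner hz h) with ⟨-, rfl⟩ | ⟨h1, -⟩
    · rfl
    · exact absurd h1.symm (flip_ne ω)
  · rcases rep_eq_rep (rep_eq_of_isInner hz h) with ⟨h1, -⟩ | ⟨-, rfl⟩
    · exact absurd h1 (O.inv_ne d ω)
    · rw [height_coord_rot] at hw'
      linarith
  · exact absurd (rep_eq_of_isInner hz h) (not_edge hz)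
  · rcases rep_eq_rep (rep_eq_of_isInner hz h) with ⟨h1, -⟩ | ⟨-, rfl⟩
    · exact absurd h1.symm (O.inv_ne d ω)
    · rw [height_coord_rot] at hw'
      linarith
  · rcases rep_eq_rep (rep_eq_of_isInner hz h) with ⟨-, rfl⟩ | ⟨h1, -⟩
    · rfl
    · exact absurd h1.symm (flip_ne _)
  · exact absurd (rep_eq_of_isInner hz h) (not_edge hz)
  · exact absurd (rep_eq_of_isInner hw h.symm) (not_edge hw)
  · exact absurd (rep_eq_of_isInner hw h.symm) (not_edge hw)
  · rcases rep_eq_of_edge hu0 hu1 h with h1 | h1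
    · rw [rep_injective ω h1]
    · rcases rep_eq_rep h1 with ⟨h2, -⟩ | ⟨-, h2⟩
      · exact absurd h2.symm (O.inv_ne d ω)
      · rw [rot_mkPt] at h2
        simpa using (mkPt_injective h2).1

/-- Near every preimage of a point of the cell in the squares the inverse chart has an inverse of
the form `z ↦ ± z + c`. -/
theorem exists_chart_eq (O : Origami ι) {d : Bool} {ω : ι × Bool} {v : ℝ × ℝ} (hv : v ∈ cell d)
    {ω' : ι × Bool} {z : UnitSquare} (h : O.opt ω' z = O.chartInv d ω v) :
    ∃ (s : ℤˣ) (c : ℝ × ℝ), s • coord z + c = v ∧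
      ∀ w, O.chartInv d ω (s • coord w + c) = O.opt ω' w := by
  have trans : ∀ {ω₁ ω₂ : ι × Bool} {z₁ z₂ : UnitSquare}, rep ω₁ z₁ = rep ω₂ z₂ →
      (∃ (s : ℤˣ) (c : ℝ × ℝ), s • coord z₁ + c = v ∧
        ∀ w, O.chartInv d ω (s • coord w + c) = O.opt ω₁ w) →
      ∃ (s : ℤˣ) (c : ℝ × ℝ), s • coord z₂ + c = v ∧
        ∀ w, O.chartInv d ω (s • coord w + c) = O.opt ω₂ w := by
    rintro ω₁ ω₂ z₁ z₂ hr ⟨s, c, h1, h2⟩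
    rcases rep_eq_rep hr with ⟨rfl, rfl⟩ | ⟨rfl, rfl⟩
    · exact ⟨s, c, h1, h2⟩
    · have e : ∀ w, (-s) • coord w + (s • intVec (1, 1) + c) = s • coord (rot w) + c := by
        intro w
        rw [coord_rot, smul_add, smul_smul, mul_neg_one, add_assoc]
      refine ⟨-s, s • intVec (1, 1) + c, ?_, fun w => ?_⟩
      · rw [e, rot_rot, h1]
      · rw [e, h2, opt_flip]
  have here : ∀ z, v = coord z → ∃ (s : ℤˣ) (c : ℝ × ℝ), s • coord z + c = v ∧
      ∀ w, O.chartInv d ω (s • coord w + c) = O.opt ω w := fun z hz =>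
    ⟨1, 0, by rw [hz, one_smul, add_zero], fun w => by rw [one_smul, add_zero, chartInv_coord]⟩
  have there : ∀ z, v = edgeRot d (coord z) → ∃ (s : ℤˣ) (c : ℝ × ℝ), s • coord z + c = v ∧
      ∀ w, O.chartInv d ω (s • coord w + c) = O.opt (O.inv d ω) w := fun z hz =>
    ⟨-1, mkPt d 0 1, hz.symm, O.chartInv_edgeRot d ω⟩
  rcases cell_cases hv with ⟨z₀, hz, -, hz'⟩ | ⟨z₀, hz, -, hz'⟩ | ⟨u, hu0, hu1, hu⟩
  · rw [hz', chartInv_coord] at h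
    exact trans (rep_eq_of_isInner hz h.symm) (here _ hz')
  · rw [hz', chartInv_edgeRot] at h
    exact trans (rep_eq_of_isInner hz h.symm) (there _ hz')
  · rw [hu, chartInv_coord] at h
    rcases rep_eq_of_edge hu0 hu1 h.symm with h1 | h1
    · exact trans h1 (here _ hu)
    · refine trans h1 (there _ ?_)
      rw [edgeRot_coord_mkPt, unitInterval.symm_symm, hu]

theorem image_chartInv_mem_nhds [Finite ι] (O : Origami ι) {d : Bool} {ω : ι × Bool} {v : ℝ × ℝ}
    (hv : v ∈ cell d) {V : Set (ℝ × ℝ)} (hV : V ∈ 𝓝 v) :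
    O.chartInv d ω '' V ∈ 𝓝 (O.chartInv d ω v) := by
  refine eventually_nhds_of_opt (P := fun q => q ∈ O.chartInv d ω '' V) fun ω' z h => ?_
  obtain ⟨s, c, rfl, h2⟩ := O.exists_chart_eq hv h
  have hc : Continuous fun w => s • coord w + c := (continuous_coord.const_smul s).add continuous_const
  filter_upwards [hc.continuousAt.eventually hV] with w hw
  exact ⟨_, hw, h2 w⟩

/-- The natural chart at the left or lower edge of a placed square. -/
noncomputable def chart [Finite ι] (O : Origami ι) (d : Bool) (ω : ι × Bool) :
    OpenPartialHomeomorph O.Surface (ℝ × ℝ) :=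
  (OpenPartialHomeomorph.ofContinuousOpenRestrict ((O.injOn_chartInv d ω).toPartialEquiv _ _)
    (O.continuous_chartInv d ω).continuousOn
    (by
      intro V hV
      rw [isOpen_iff_mem_nhds]
      rintro _ ⟨⟨v, hv⟩, hvV, rfl⟩
      have h1 : Subtype.val '' V ∈ 𝓝 v :=
        ((isOpen_cell d).isOpenEmbedding_subtypeVal.isOpenMap V hV).mem_nhds ⟨⟨v, hv⟩, hvV, rfl⟩
      refine Filter.mem_of_superset (O.image_chartInv_mem_nhds hv h1) ?_
      rintro _ ⟨_, ⟨v', hv', rfl⟩, rfl⟩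
      exact ⟨v', hv', rfl⟩)
    (isOpen_cell d)).symm

theorem chart_chartInv [Finite ι] (O : Origami ι) {d : Bool} {ω : ι × Bool} {v : ℝ × ℝ}
    (hv : v ∈ cell d) : O.chart d ω (O.chartInv d ω v) = v :=
  OpenPartialHomeomorph.right_inv (O.chart d ω) hv

theorem isNatural_chart [Finite ι] (O : Origami ι) (d : Bool) (ω : ι × Bool) :
    O.IsNatural (O.chart d ω) := by
  constructor
  · rw [Set.disjoint_left]
    rintro _ ⟨v, hv, rfl⟩
    rcases cell_cases hv with ⟨z, hz, -, rfl⟩ | ⟨z, hz, -, rfl⟩ | ⟨u, hu0, hu1, rfl⟩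
    · rw [chartInv_coord, opt_mem_vertices]
      exact hz.not_isCorner
    · rw [chartInv_edgeRot, opt_mem_vertices]
      exact hz.not_isCorner
    · rw [chartInv_coord, opt_mem_vertices, isCorner_mkPt]
      tauto
  · rintro i z ⟨v, hv, h⟩
    obtain ⟨s, c, rfl, h2⟩ := O.exists_chart_eq (ω' := (i, false)) (z := z) hv h.symm
    refine ⟨s, c, ?_⟩
    have hc : Continuous fun w => s • coord w + c :=
      (continuous_coord.const_smul s).add continuous_const
    filter_upwards [hc.continuousAt.eventually ((isOpen_cell d).mem_nhds hv)] with w hw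
    rw [← opt_false, ← h2 w, chart_chartInv _ hw]

theorem exists_isNatural [Finite ι] (O : Origami ι) {p : O.Surface} (hp : p ∉ O.vertices) :
    ∃ e, O.IsNatural e ∧ p ∈ e.source := by
  obtain ⟨ω, z, rfl⟩ := O.exists_opt_eq p
  rw [opt_mem_vertices] at hp
  by_cases hz : IsInner z
  · have key : ∀ ω' w, IsInner w → (w.1 : ℝ) < 3 / 4 → O.opt ω' w = O.opt ω z →
        ∃ e, O.IsNatural e ∧ O.opt ω z ∈ e.source := by
      intro ω' w hw h1 h2
      refine ⟨_, O.isNatural_chart true ω', coord w, ?_, by rw [chartInv_coord, h2]⟩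
      obtain ⟨h3, h4⟩ := isInner_iff_coord.1 hw
      exact ⟨⟨by linarith [h3.1, show height true (coord w) = w.1 from rfl, show (coord w).1 = w.1 from rfl], h1⟩, h4⟩
    -- In at least one of the two placements of the square the point lies in the range of the chart.
    by_cases h : (z.1 : ℝ) < 3 / 4
    · exact key ω z hz h rfl
    · refine key (flip ω) (rot z) (isInner_rot.2 hz) ?_ (O.opt_flip_rot ω z)
      simp only [rot, unitInterval.coe_symm_eq]
      linarith
  · obtain ⟨d, ω', u, h0, h1, hr⟩ := exists_edge ω hz hp
    refine ⟨_, O.isNatural_chart d ω', coord (mkPt d 0 u), ?_, ?_⟩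
    · have h3 : (0 : ℝ) < u := lt_of_le_of_ne u.2.1 fun h' => h0 (Subtype.ext h'.symm)
      have h4 : (u : ℝ) < 1 := lt_of_le_of_ne u.2.2 fun h' => h1 (Subtype.ext h')
      cases d <;> simp [cell, height, coord, mkPt, h3, h4] <;> norm_num
    · rw [chartInv_coord, opt_eq_of_rep_eq hr]

theorem IsNatural.neg {O : Origami ι} {e : OpenPartialHomeomorph O.Surface (ℝ × ℝ)}
    (he : O.IsNatural e) : O.IsNatural (e.transHomeomorph (Homeomorph.neg (ℝ × ℝ))) := by
  refine ⟨he.1, fun i z h => ?_⟩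
  obtain ⟨s, c, h1⟩ := he.2 i z h
  refine ⟨-s, -c, ?_⟩
  filter_upwards [h1] with w hw
  show -(e (O.pt i w)) = _
  rw [hw, neg_add, Units.neg_smul]

end Origami

/-! ### Maps over a map of the pillowcase are affine -/

namespace Origami

variable {ι κ : Type}

open unitInterval (symm)

theorem isClosedEmbedding_intVec : IsClosedEmbedding intVec :=
  Int.isClosedEmbedding_coe_real.prodMap Int.isClosedEmbedding_coe_real

/-- A disc is homeomorphic to the plane, where complements of countable sets are connected. -/
theorem isPreconnected_ball_diff_countable {v : ℝ × ℝ} {r : ℝ} (hr : 0 < r) {D : Set (ℝ × ℝ)}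
    (hD : D.Countable) : IsPreconnected (Metric.ball v r \ D) := by
  have hrank : 1 < Module.rank ℝ (ℝ × ℝ) := by
    rw [rank_prod', Module.rank_self, one_add_one_eq_two]
    exact Cardinal.one_lt_two
  set φ := OpenPartialHomeomorph.univBall v r with hφ
  have hs : φ.source = Set.univ := OpenPartialHomeomorph.univBall_source v r
  have ht : φ.target = Metric.ball v r := OpenPartialHomeomorph.univBall_target v hr
  have hinj : Function.Injective φ := by
    have := φ.injOn
    rwa [hs, Set.injOn_univ] at this
  have h1 := ((hD.preimage hinj).isConnected_compl_of_one_lt_rank hrank).isPreconnected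
  have h2 := h1.image φ (OpenPartialHomeomorph.continuous_univBall v r).continuousOn
  convert h2 using 1
  ext w
  constructor
  · rintro ⟨hw, hwD⟩
    rw [← ht] at hw
    exact ⟨φ.symm w, by simpa [φ.right_inv hw] using hwD, φ.right_inv hw⟩
  · rintro ⟨x, hx, rfl⟩
    refine ⟨?_, hx⟩
    rw [← ht]
    exact φ.map_source (hs ▸ Set.mem_univ x)

/-- A continuous map that agrees with an injective map up to signs and integral translations agrees
with it up to one sign and one integral translation. -/
theorem exists_eq_smul_add {v : ℝ × ℝ} {r : ℝ} (hr : 0 < r) {G H : ℝ × ℝ → ℝ × ℝ}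
    (hG : ContinuousOn G (Metric.ball v r)) (hH : Continuous H) (hinj : Function.Injective H)
    (h : ∀ w ∈ Metric.ball v r, pillow (G w) = pillow (H w)) :
    ∃ (s : ℤˣ) (n : ℤ × ℤ), ∀ w ∈ Metric.ball v r, G w = s • H w + intVec n := by
  -- At the points of `D` both signs are possible. As `H` is injective, `D` is countable, so the
  -- disc without `D` is still connected. There exactly one sign is correct, and both conditions are
  -- closed; so the sign is constant, then also the integral translation, and density restores the
  -- points of `D`.
  set D : Set (ℝ × ℝ) := {w | H w + H w ∈ Set.range intVec} with hD
  have hDc : D.Countable := by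
    refine Set.Countable.preimage_of_injOn (f := fun w => H w + H w) (Set.countable_range intVec) ?_
    intro x _ y _ hxy
    apply hinj
    have h1 : (2 : ℝ) • H x = (2 : ℝ) • H y := by rw [two_smul, two_smul]; exact hxy
    exact smul_right_injective _ (two_ne_zero) h1
  set S := Metric.ball v r \ D with hS
  have hSp : IsPreconnected S := isPreconnected_ball_diff_countable hr hDc
  have hSd : Metric.ball v r ⊆ closure S :=
    (hDc.dense_compl ℝ).open_subset_closure_inter Metric.isOpen_ball
  have hGS : Continuous fun w : S => G w := (hG.mono Set.sdiff_subset).domRestrict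
  have hHS : Continuous fun w : S => H w := hH.comp continuous_subtype_val
  have : PreconnectedSpace S := Subtype.preconnectedSpace hSp
  have hSne : S.Nonempty := by
    rw [← closure_nonempty_iff]
    exact ⟨v, hSd (Metric.mem_ball_self hr)⟩
  have : Nonempty S := hSne.to_subtype
  let C : ℤˣ → Set S := fun s => {w | G w - s • H w ∈ Set.range intVec}
  have hC : ∀ s, IsClosed (C s) := fun s =>
    isClosedEmbedding_intVec.isClosed_range.preimage (hGS.sub (hHS.const_smul s))
  have hCC : (C 1)ᶜ = C (-1) := by
    ext w
    obtain ⟨s, n, hn⟩ := pillow_eq_pillow (h w w.2.1)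
    constructor
    · intro hw
      rcases Int.units_eq_one_or s with rfl | rfl
      · exact absurd ⟨n, by rw [hn, add_sub_cancel_left]⟩ hw
      · exact ⟨n, by rw [hn, add_sub_cancel_left]⟩
    · rintro ⟨m, hm⟩ ⟨k, hk⟩
      apply w.2.2
      refine ⟨m - k, ?_⟩
      have : intVec (m - k) = intVec m - intVec k := by simp [intVec]
      rw [this, hm, hk]
      simp
  have hclopen : IsClopen (C 1) := ⟨hC 1, by rw [← isClosed_compl_iff, hCC]; exact hC (-1)⟩
  obtain ⟨s, hs⟩ : ∃ s, C s = Set.univ := by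
    rcases isClopen_iff.1 hclopen with h1 | h1
    · exact ⟨-1, by rw [← hCC, h1, Set.compl_empty]⟩
    · exact ⟨1, h1⟩
  have hall : ∀ w : S, ∃ n, intVec n = G w - s • H w := fun w => by
    have : w ∈ C s := hs ▸ Set.mem_univ w
    exact this
  choose n hn using hall
  have hnc : Continuous n := by
    rw [isClosedEmbedding_intVec.isEmbedding.continuous_iff]
    exact (hGS.sub (hHS.const_smul s)).congr fun w => (hn w).symm
  obtain ⟨w₀⟩ := ‹Nonempty S›
  refine ⟨s, n w₀, ?_⟩
  have heq : Set.EqOn G (fun w => s • H w + intVec (n w₀)) S := by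
    intro w hw
    have := PreconnectedSpace.constant ‹_› hnc (x := w₀) (y := ⟨w, hw⟩)
    show G w = s • H w + intVec (n w₀)
    rw [this, hn]
    abel
  exact heq.of_subset_closure hG ((hH.const_smul s).add continuous_const).continuousOn
    Set.sdiff_subset hSd

theorem planeMap_injective (A : Matrix.SpecialLinearGroup (Fin 2) ℝ) :
    Function.Injective (planeMap A) := by
  intro v w h
  have := congrArg (planeMap A⁻¹) h
  rwa [← planeMap_mul, ← planeMap_mul, inv_mul_cancel, planeMap_one, planeMap_one] at this

theorem IsOver.image_vertices {O : Origami ι} {O' : Origami κ}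
    {B : Matrix.SpecialLinearGroup (Fin 2) ℤ} {f : O.Surface ≃ₜ O'.Surface}
    (hf : IsOver O O' (toReal B) f) : f '' O.vertices = O'.vertices := by
  have key : ∀ p, f p ∈ O'.vertices ↔ p ∈ O.vertices := by
    intro p
    obtain ⟨ω, z, rfl⟩ := O.exists_opt_eq p
    rw [mem_vertices_iff_dev, mem_vertices_iff_dev, dev_opt, hf]
    constructor
    · intro h
      obtain ⟨n, hn⟩ := pillow_eq_zero h
      have h1 := congrArg (planeMap (toReal B⁻¹)) hn
      rw [planeMap_intVec, ← planeMap_mul] at h1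
      have h2 : toReal B⁻¹ * toReal B = 1 := by
        rw [toReal, toReal, ← map_mul, inv_mul_cancel, map_one]
      rw [h2, planeMap_one] at h1
      rw [h1, pillow_intVec]
    · intro h
      obtain ⟨n, hn⟩ := pillow_eq_zero h
      rw [hn, planeMap_intVec, pillow_intVec]
  ext q
  constructor
  · rintro ⟨p, hp, rfl⟩
    exact (key p).2 hp
  · intro hq
    exact ⟨f.symm q, (key _).1 (by simpa using hq), f.apply_symm_apply q⟩

/-- In natural coordinates `f` and the linear map agree in the pillowcase, hence on a small disc up
to one sign and one translation by `exists_eq_smul_add`. A negative sign is absorbed by negating the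
chart at `p`. -/
theorem IsOver.isAffine [Finite ι] [Finite κ] {O : Origami ι} {O' : Origami κ}
    {B : Matrix.SpecialLinearGroup (Fin 2) ℤ} {f : O.Surface ≃ₜ O'.Surface}
    (hf : IsOver O O' (toReal B) f) : IsAffine O O' (toReal B) f := by
  refine ⟨hf.image_vertices, fun p hp => ?_⟩
  have hfp : f p ∉ O'.vertices := by
    rw [← hf.image_vertices]
    rintro ⟨q, hq, h⟩
    exact hp (f.injective h ▸ hq)
  obtain ⟨e, he, hpe⟩ := O.exists_isNatural hp
  obtain ⟨e', he', hpe'⟩ := O'.exists_isNatural hfp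
  obtain ⟨c, hc⟩ := he.exists_dev_eq hpe
  obtain ⟨c', hc'⟩ := he'.exists_dev_eq hpe'
  have h1 : ∀ᶠ q in 𝓝 p, f q ∈ e'.source ∧ pillow (e' (f q) + c') =
      pillow (planeMap (toReal B) (e q + c)) := by
    filter_upwards [hc, f.continuous.continuousAt.eventually hc',
      f.continuous.continuousAt.eventually (e'.open_source.mem_nhds hpe')] with q h1 h2 h3
    refine ⟨h3, ?_⟩
    rw [← h2]
    obtain ⟨ω, z, rfl⟩ := O.exists_opt_eq q
    rw [dev_opt] at h1
    obtain ⟨s, n, hn⟩ := pillow_eq_pillow h1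
    rw [hf, hn, planeMap_add, planeMap_intVec, planeMap_smul, pillow_smul_add]
  have h2 : ∀ᶠ v in 𝓝 (e p), v ∈ e.target ∧ f (e.symm v) ∈ e'.source ∧
      pillow (e' (f (e.symm v)) + c') = pillow (planeMap (toReal B) (v + c)) := by
    have h3 : ∀ᶠ v in 𝓝 (e p), v ∈ e.target := e.open_target.mem_nhds (e.map_source hpe)
    have h4 := (e.continuousAt_symm (e.map_source hpe)).eventually
      (by rw [e.left_inv hpe]; exact h1)
    filter_upwards [h3, h4] with v h3 h4
    rw [e.right_inv h3] at h4
    exact ⟨h3, h4⟩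
  obtain ⟨r, hr, hball⟩ := Metric.eventually_nhds_iff_ball.1 h2
  obtain ⟨s, n, hsn⟩ := exists_eq_smul_add hr (G := fun v => e' (f (e.symm v)) + c')
    (H := fun v => planeMap (toReal B) (v + c))
    (by
      refine ContinuousOn.add ?_ continuousOn_const
      refine e'.continuousOn.comp (f.continuous.comp_continuousOn
        (e.continuousOn_symm.mono fun v hv => (hball v hv).1)) fun v hv => (hball v hv).2.1)
    ((continuous_planeMap _).comp (continuous_id.add continuous_const))
    (fun v w h => add_right_cancel (planeMap_injective _ h))
    fun v hv => (hball v hv).2.2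
  have h5 : ∀ᶠ q in 𝓝 p, e' (f q) = s • planeMap (toReal B) (e q) +
      (s • planeMap (toReal B) c + intVec n - c') := by
    filter_upwards [e.open_source.mem_nhds hpe,
      (e.continuousAt hpe).eventually (Metric.ball_mem_nhds _ hr)] with q h6 h7
    have := hsn (e q) h7
    simp only [e.left_inv h6] at this
    rw [planeMap_add, smul_add] at this
    rw [eq_sub_of_add_eq this]
    abel
  rcases Int.units_eq_one_or s with rfl | rfl
  · refine ⟨e, e', he, he', hpe, hpe', planeMap (toReal B) c + intVec n - c', ?_⟩
    simpa only [one_smul] using h5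
  · refine ⟨_, e', he.neg, he', hpe, hpe',
      (-1 : ℤˣ) • planeMap (toReal B) c + intVec n - c', ?_⟩
    filter_upwards [h5] with q hq
    rw [hq]
    congr 1
    rw [← planeMap_smul]
    congr 1
    simp

end Origami

/-! ### Maps over the identity of the pillowcase -/

namespace Origami

variable {ι κ : Type}

open unitInterval (symm)

/-- Maps of placed squares that respect the adjacencies. -/
structure Intertwines (O : Origami ι) (O' : Origami κ) (φ : ι × Bool → κ × Bool) : Prop where
  flip : ∀ ω, φ (flip ω) = Origami.flip (φ ω)
  inv : ∀ d ω, φ (O.inv d ω) = O'.inv d (φ ω)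

theorem isOver_one_iff {O : Origami ι} {O' : Origami κ} {f : O.Surface → O'.Surface} :
    IsOver O O' 1 f ↔ ∀ p, O'.dev (f p) = O.dev p := by
  constructor
  · intro h p
    obtain ⟨ω, z, rfl⟩ := O.exists_opt_eq p
    rw [h, planeMap_one, dev_opt]
  · intro h ω z
    rw [h, planeMap_one, dev_opt]

theorem eq_or_eq_rot_of_pillow {z w : UnitSquare} (hz : IsInner z)
    (h : pillow (coord w) = pillow (coord z)) : w = z ∨ w = rot z := by
  obtain ⟨⟨z1, z1'⟩, ⟨z2, z2'⟩⟩ := isInner_iff_coord.1 hz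
  obtain ⟨s, n, hn⟩ := pillow_eq_pillow h
  have w1 := w.1.2
  have w2 := w.2.2
  have h1 := congrArg Prod.fst hn
  have h2 := congrArg Prod.snd hn
  rcases Int.units_eq_one_or s with rfl | rfl
  · left
    simp only [one_smul, coord, intVec, Prod.fst_add, Prod.snd_add] at h1 h2 z1 z1' z2 z2'
    have key : ∀ (x y : unitInterval) (k : ℤ), 0 < (x : ℝ) → (x : ℝ) < 1 → (y : ℝ) = x + k → y = x := by
      intro x y k hx hx' hk
      have hy := y.2.1
      have hy' := y.2.2
      have k1 : (-1 : ℝ) < k := by linarith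
      have k2 : (k : ℝ) < 1 := by linarith
      have k1' : -1 < k := by exact_mod_cast k1
      have k2' : k < 1 := by exact_mod_cast k2
      obtain rfl : k = 0 := by omega
      exact Subtype.ext (by simpa using hk)
    exact Prod.ext (key _ _ _ z1 z1' h1) (key _ _ _ z2 z2' h2)
  · right
    simp only [Units.neg_smul, one_smul, coord, intVec, Prod.fst_add, Prod.snd_add, Prod.fst_neg,
      Prod.snd_neg] at h1 h2 z1 z1' z2 z2'
    have key : ∀ (x y : unitInterval) (k : ℤ), 0 < (x : ℝ) → (x : ℝ) < 1 → (y : ℝ) = -x + k →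
        y = symm x := by
      intro x y k hx hx' hk
      have hy := y.2.1
      have hy' := y.2.2
      have k1 : (0 : ℝ) < k := by linarith
      have k2 : (k : ℝ) < 2 := by linarith
      have k1' : 0 < k := by exact_mod_cast k1
      have k2' : k < 2 := by exact_mod_cast k2
      obtain rfl : k = 1 := by omega
      exact Subtype.ext (by rw [hk, unitInterval.coe_symm_eq]; push_cast; ring)
    exact Prod.ext (key _ _ _ z1 z1' h1) (key _ _ _ z2 z2' h2)

theorem exists_eq_opt_of_dev {O : Origami ι} {p : O.Surface} {z : UnitSquare} (hz : IsInner z)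
    (h : O.dev p = pillow (coord z)) : ∃ ω, p = O.opt ω z := by
  obtain ⟨ω, w, rfl⟩ := O.exists_opt_eq p
  rw [dev_opt] at h
  rcases eq_or_eq_rot_of_pillow hz h with rfl | rfl
  · exact ⟨ω, rfl⟩
  · exact ⟨flip ω, (O.opt_flip ω z).symm⟩

theorem eq_of_opt_eq_opt {O : Origami ι} {ω ω' : ι × Bool} {z : UnitSquare} (hz : IsInner z)
    (hz' : rot z ≠ z) (h : O.opt ω z = O.opt ω' z) : ω = ω' := by
  rcases rep_eq_rep (rep_eq_of_isInner hz h) with ⟨h1, -⟩ | ⟨-, h1⟩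
  · exact h1.symm
  · exact absurd h1.symm hz'

/-- The centre is fixed by `rot` and does not distinguish the two placements. The open lower half of
the square avoids it and is connected; there the placed square containing the image is unique and
locally constant, hence constant. -/
theorem exists_opt_eq_on_lower_half [Finite ι] [Finite κ] {O : Origami ι} {O' : Origami κ}
    {f : O.Surface ≃ₜ O'.Surface} (hf : IsOver O O' 1 f) (ω : ι × Bool) :
    ∃ ω', ∀ z : UnitSquare, (z.2 : ℝ) ≤ 1 / 2 → f (O.opt ω z) = O'.opt ω' z := by
  set V : Set (ℝ × ℝ) := Set.Ioo (0 : ℝ) 1 ×ˢ Set.Ioo (0 : ℝ) (1 / 2) with hV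
  have hVi : ∀ v ∈ V, IsInner (squareProj v) ∧ rot (squareProj v) ≠ squareProj v := by
    rintro v ⟨h1, h2⟩
    have h3 : v.2 ∈ Set.Ioo (0 : ℝ) 1 := ⟨h2.1, by linarith [h2.2]⟩
    refine ⟨isInner_squareProj h1 h3, fun h => ?_⟩
    have h4 := congrArg (fun z => (coord z).2) h
    simp only [coord_rot, coord_squareProj (Set.Ioo_subset_Icc_self h1) (Set.Ioo_subset_Icc_self h3)]
      at h4
    simp [intVec] at h4
    linarith [h2.2]
  have : PreconnectedSpace V :=
    Subtype.preconnectedSpace (isPreconnected_Ioo.prod isPreconnected_Ioo)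
  have hex : ∀ v : V, ∃ ω', f (O.opt ω (squareProj v)) = O'.opt ω' (squareProj v) := fun v =>
    exists_eq_opt_of_dev (hVi v v.2).1 (by rw [hf, planeMap_one])
  choose ψ hψ using hex
  have hcl : ∀ ω', IsClosed (ψ ⁻¹' {ω'}) := by
    intro ω'
    have : ψ ⁻¹' {ω'} = {v : V | f (O.opt ω (squareProj v)) = O'.opt ω' (squareProj v)} := by
      ext v
      constructor
      · rintro rfl
        exact hψ v
      · intro h
        exact eq_of_opt_eq_opt (hVi v v.2).1 (hVi v v.2).2 ((hψ v).symm.trans h)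
    rw [this]
    have hc : Continuous fun v : V => squareProj v := continuous_squareProj.comp continuous_subtype_val
    exact isClosed_eq (f.continuous.comp ((O.continuous_opt ω).comp hc))
      ((O'.continuous_opt ω').comp hc)
  have hloc : IsLocallyConstant ψ := by
    intro s
    have : ψ ⁻¹' s = (⋃ ω' : (sᶜ : Set _), ψ ⁻¹' {ω'.1})ᶜ := by
      ext v
      simp only [Set.mem_preimage, Set.mem_compl_iff, Set.mem_iUnion, Set.mem_singleton_iff,
        not_exists]
      exact ⟨fun h ω' e => ω'.2 (e ▸ h), fun h => by_contra fun h' => h ⟨_, h'⟩ rfl⟩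
    rw [this, isOpen_compl_iff]
    exact isClosed_iUnion_of_finite fun ω' => hcl _
  have hv0 : ((1 / 2, 1 / 4) : ℝ × ℝ) ∈ V := by simp only [hV]; norm_num
  refine ⟨ψ ⟨_, hv0⟩, fun z hz => ?_⟩
  have heq : Set.EqOn (fun v => f (O.opt ω (squareProj v)))
      (fun v => O'.opt (ψ ⟨_, hv0⟩) (squareProj v)) (closure V) := by
    refine Set.EqOn.closure (fun v hv => ?_)
      (f.continuous.comp ((O.continuous_opt ω).comp continuous_squareProj))
      ((O'.continuous_opt _).comp continuous_squareProj)
    have h1 := hψ ⟨v, hv⟩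
    rw [hloc.apply_eq_of_preconnectedSpace ⟨v, hv⟩ ⟨_, hv0⟩] at h1
    exact h1
  have hz' : coord z ∈ closure V := by
    rw [hV, closure_prod_eq, closure_Ioo (by norm_num), closure_Ioo (by norm_num)]
    exact ⟨z.1.2, z.2.2.1, hz⟩
  have := heq hz'
  simpa only [squareProj_coord] using this

theorem exists_opt_eq_opt [Finite ι] [Finite κ] {O : Origami ι} {O' : Origami κ}
    {f : O.Surface ≃ₜ O'.Surface} (hf : IsOver O O' 1 f) :
    ∃ φ, Intertwines O O' φ ∧ ∀ ω z, f (O.opt ω z) = O'.opt (φ ω) z := by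
  choose φ hφ using fun ω => exists_opt_eq_on_lower_half hf ω
  have third : (1 / 3 : ℝ) ∈ unitInterval := by constructor <;> norm_num
  have half : (1 / 2 : ℝ) ∈ unitInterval := by constructor <;> norm_num
  have hflip : ∀ ω, φ (flip ω) = flip (φ ω) := by
    intro ω
    -- At height `1 / 2` a point and its half rotation both lie in the closed lower half; the
    -- abscissa `1 / 3` keeps away from the centre.
    let z : UnitSquare := (⟨1 / 3, third⟩, ⟨1 / 2, half⟩)
    have hz : IsInner z := by
      rw [isInner_iff_coord]
      simp only [z, coord]
      norm_num
    have hz' : rot z ≠ z := by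
      intro h
      have := congrArg (fun z => (coord z).1) h
      simp [z, coord, rot] at this
      norm_num at this
    have h1 := hφ ω z le_rfl
    have h2 := hφ (flip ω) (rot z) (by simp only [z, rot, unitInterval.coe_symm_eq]; norm_num)
    rw [opt_flip_rot, h1, ← O'.opt_flip_rot] at h2
    exact (eq_of_opt_eq_opt (isInner_rot.2 hz) (by rw [rot_rot]; exact hz'.symm) h2).symm
  have hall : ∀ ω z, f (O.opt ω z) = O'.opt (φ ω) z := by
    intro ω z
    rcases le_total (z.2 : ℝ) (1 / 2) with h | h
    · exact hφ ω z h
    · rw [← O.opt_flip_rot, hφ _ _ (by simp only [rot, unitInterval.coe_symm_eq]; linarith), hflip,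
        opt_flip_rot]
  refine ⟨φ, ⟨hflip, fun d ω => ?_⟩, hall⟩
  -- A point of the edge that is neither an end nor the midpoint, so that it determines the placed
  -- square on the other side.
  let u : unitInterval := ⟨1 / 3, third⟩
  have hu0 : u ≠ 0 := fun h => by
    have := congrArg Subtype.val h
    simp [u] at this
  have hu1 : u ≠ 1 := fun h => by
    have := congrArg Subtype.val h
    simp [u] at this
  have huu : u ≠ symm u := fun h => by
    have := congrArg Subtype.val h
    simp only [u, unitInterval.coe_symm_eq] at this
    norm_num at this
  have h1 := hall (O.inv d ω) (mkPt d 0 (symm u))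
  rw [O.opt_inv, hall] at h1
  rcases rep_eq_of_edge hu0 hu1 h1 with h2 | h2
  · exfalso
    rcases rep_eq_rep h2 with ⟨-, h3⟩ | ⟨-, h3⟩
    · exact huu (mkPt_injective h3).2.symm
    · rw [rot_mkPt] at h3
      simpa using (mkPt_injective h3).1
  · rcases rep_eq_rep h2 with ⟨h3, -⟩ | ⟨-, h3⟩
    · exact h3
    · exfalso
      rw [rot_mkPt] at h3
      simpa using (mkPt_injective h3).1

/-- A homeomorphism over the identity of the pillowcase is a relabelling of the squares. -/
theorem exists_equiv_of_isOver_one [Finite ι] [Finite κ] {O : Origami ι} {O' : Origami κ}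
    {f : O.Surface ≃ₜ O'.Surface} (hf : IsOver O O' 1 f) :
    ∃ φ : ι × Bool ≃ κ × Bool, Intertwines O O' φ := by
  obtain ⟨φ, h, hφ⟩ := exists_opt_eq_opt hf
  have hf' : IsOver O' O 1 f.symm := by
    rw [isOver_one_iff] at hf ⊢
    intro p
    rw [← hf, f.apply_symm_apply]
  obtain ⟨ψ, h', hψ⟩ := exists_opt_eq_opt hf'
  have third : (1 / 3 : ℝ) ∈ unitInterval := by constructor <;> norm_num
  let z : UnitSquare := (⟨1 / 3, third⟩, ⟨1 / 3, third⟩)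
  have hz : IsInner z := by
    rw [isInner_iff_coord]
    simp only [z, coord]
    norm_num
  have hz' : rot z ≠ z := by
    intro h
    have := congrArg (fun z => (coord z).1) h
    simp [z, coord, rot] at this
    norm_num at this
  refine ⟨⟨φ, ψ, fun ω => ?_, fun ω => ?_⟩, h⟩
  · apply eq_of_opt_eq_opt (O := O) hz hz'
    rw [← hψ, ← hφ, f.symm_apply_apply]
  · apply eq_of_opt_eq_opt (O := O') hz hz'
    rw [← hφ, ← hψ, f.apply_symm_apply]

/-- A relabelling of the squares gives a homeomorphism over the identity of the pillowcase. -/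
theorem exists_homeomorph_of_equiv {O : Origami ι} {O' : Origami κ}
    {φ : ι × Bool ≃ κ × Bool} (h : Intertwines O O' φ) :
    ∃ f : O.Surface ≃ₜ O'.Surface, IsOver O O' 1 f := by
  have map : ∀ {ι κ : Type} {O : Origami ι} {O' : Origami κ} {φ : ι × Bool → κ × Bool},
      Intertwines O O' φ → ∃ F : O.Surface → O'.Surface, Continuous F ∧
        ∀ ω z, F (O.opt ω z) = O'.opt (φ ω) z := by
    intro ι κ O O' φ h
    refine ⟨O.lift (fun ω z => O'.opt (φ ω) z) (fun ω z => ?_) (fun d ω u => ?_),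
      continuous_lift fun ω => O'.continuous_opt _, lift_opt⟩
    · rw [h.flip, opt_flip_rot]
    · rw [h.inv, opt_inv]
  have h' : Intertwines O' O φ.symm := by
    refine ⟨fun ω => ?_, fun d ω => ?_⟩
    · rw [Equiv.symm_apply_eq, h.flip, Equiv.apply_symm_apply]
    · rw [Equiv.symm_apply_eq, h.inv, Equiv.apply_symm_apply]
  obtain ⟨F, hF, hF'⟩ := map h
  obtain ⟨G, hG, hG'⟩ := map h'
  refine ⟨⟨⟨F, G, fun p => ?_, fun p => ?_⟩, hF, hG⟩, fun ω z => ?_⟩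
  · obtain ⟨ω, z, rfl⟩ := O.exists_opt_eq p
    rw [hF', hG', Equiv.symm_apply_apply]
  · obtain ⟨ω, z, rfl⟩ := O'.exists_opt_eq p
    rw [hG', hF', Equiv.apply_symm_apply]
  · show O'.dev (F _) = _
    rw [hF', dev_opt, planeMap_one]

end Origami

/-! ### Maps over the generators of the modular group -/

namespace Origami

variable {ι κ : Type}

open unitInterval (symm)

/-- The rotation of the unit square by a right angle. -/
def turn (z : UnitSquare) : UnitSquare := (symm z.2, z.1)

theorem continuous_turn : Continuous turn := by unfold turn; fun_prop

theorem turn_turn (z : UnitSquare) : turn (turn z) = rot z := rfl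

theorem turn_rot (z : UnitSquare) : turn (rot z) = rot (turn z) := rfl

/-- The quarter turn takes the left edge to the lower one, and the lower edge to the right one,
which is the left edge of the flipped placement. -/
theorem exists_turnMap {O : Origami ι} {O' : Origami κ} {φ : ι × Bool → κ × Bool}
    (hflip : ∀ ω, φ (flip ω) = flip (φ ω)) (h1 : ∀ ω, φ (O.inv true ω) = O'.inv false (φ ω))
    (h2 : ∀ ω, flip (φ (O.inv false ω)) = O'.inv true (flip (φ ω))) :
    ∃ F : O.Surface → O'.Surface, Continuous F ∧ ∀ ω z, F (O.opt ω z) = O'.opt (φ ω) (turn z) := by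
  refine ⟨O.lift (fun ω z => O'.opt (φ ω) (turn z)) (fun ω z => ?_) (fun d ω u => ?_),
    continuous_lift fun ω => (O'.continuous_opt _).comp continuous_turn, lift_opt⟩
  · rw [hflip, turn_rot, opt_flip_rot]
  · cases d
    · have e1 : turn (mkPt false 0 (symm u)) = rot (mkPt true 0 u) := by simp [turn, mkPt, rot]
      have e2 : turn (mkPt false 0 u) = rot (mkPt true 0 (symm u)) := by simp [turn, mkPt, rot]
      rw [e1, e2, ← opt_flip, ← opt_flip, h2, ← O'.opt_inv true (flip (φ ω)), unitInterval.symm_symm]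
    · have e1 : turn (mkPt true 0 (symm u)) = mkPt false 0 u := by simp [turn, mkPt]
      have e2 : turn (mkPt true 0 u) = mkPt false 0 (symm u) := by simp [turn, mkPt]
      rw [e1, e2, h1, ← O'.opt_inv false (φ ω), unitInterval.symm_symm]

/-- The action of the rotation by a right angle. -/
theorem planeMap_S (v : ℝ × ℝ) : planeMap (toReal ModularGroup.S) v = (-v.2, v.1) := by
  simp only [planeMap, toReal_apply]
  simp [ModularGroup.S]

theorem planeMap_T (v : ℝ × ℝ) : planeMap (toReal ModularGroup.T) v = (v.1 + v.2, v.2) := by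
  simp only [planeMap, toReal_apply]
  simp [ModularGroup.T]

theorem exists_homeomorph_over_S {O : Origami ι} {O' : Origami κ} (φ : ι × Bool ≃ κ × Bool)
    (hflip : ∀ ω, φ (flip ω) = flip (φ ω)) (h1 : ∀ ω, φ (O.inv true ω) = O'.inv false (φ ω))
    (h2 : ∀ ω, flip (φ (O.inv false ω)) = O'.inv true (flip (φ ω))) :
    ∃ f : O.Surface ≃ₜ O'.Surface, IsOver O O' (toReal ModularGroup.S) f := by
  have hflip' : ∀ ω, φ.symm (flip ω) = flip (φ.symm ω) := by
    intro ω
    rw [Equiv.symm_apply_eq, hflip, Equiv.apply_symm_apply]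
  obtain ⟨F, hF, hF'⟩ := exists_turnMap hflip h1 h2
  obtain ⟨G, hG, hG'⟩ := exists_turnMap (O := O') (O' := O) (φ := fun ω => flip (φ.symm ω))
    (fun ω => by rw [hflip'])
    (fun ω => by
      have := h2 (flip (φ.symm ω))
      rw [hflip, Equiv.apply_symm_apply, flip_flip] at this
      rw [← hflip', Equiv.symm_apply_eq, ← this, flip_flip])
    (fun ω => by rw [flip_flip, flip_flip, Equiv.symm_apply_eq, h1, Equiv.apply_symm_apply])
  refine ⟨⟨⟨F, G, fun p => ?_, fun p => ?_⟩, hF, hG⟩, fun ω z => ?_⟩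
  · obtain ⟨ω, z, rfl⟩ := O.exists_opt_eq p
    rw [hF', hG', Equiv.symm_apply_apply, turn_turn, opt_flip_rot]
  · obtain ⟨ω, z, rfl⟩ := O'.exists_opt_eq p
    rw [hG', hF', ← hflip', Equiv.apply_symm_apply, turn_turn, opt_flip_rot]
  · show O'.dev (F _) = _
    rw [hF', dev_opt, planeMap_S]
    have := pillow_smul_add 1 (-(coord z).2, (coord z).1) (1, 0)
    rw [← this]
    congr 1
    simp [coord, turn, intVec, sub_eq_neg_add]

/-- Maps from the surface that are given on one half of each of the placed squares. -/
theorem exists_foldMap {O : Origami ι} {Y : Type*} [TopologicalSpace Y] {g : UnitSquare → ℝ}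
    (hg : Continuous g) (hrot : ∀ z, g (rot z) = -g z) {P : ι × Bool → UnitSquare → Y}
    (hP : ∀ ω, Continuous (P ω)) (hP' : ∀ ω z, g z = 0 → P (flip ω) (rot z) = P ω z)
    (hedge : ∀ E : ι × Bool → UnitSquare → Y, (∀ ω z, 0 ≤ g z → E ω z = P ω z) →
      (∀ ω z, g z ≤ 0 → E ω z = P (flip ω) (rot z)) →
      ∀ d ω u, E (O.inv d ω) (mkPt d 0 (symm u)) = E ω (mkPt d 0 u)) :
    ∃ F : O.Surface → Y, Continuous F ∧ ∀ ω z, 0 ≤ g z → F (O.opt ω z) = P ω z := by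
  set E : ι × Bool → UnitSquare → Y := fun ω z => if 0 ≤ g z then P ω z else P (flip ω) (rot z) with hE
  have e1 : ∀ ω z, 0 ≤ g z → E ω z = P ω z := fun ω z h => if_pos h
  have e2 : ∀ ω z, g z ≤ 0 → E ω z = P (flip ω) (rot z) := by
    intro ω z h
    rcases h.eq_or_lt with h | h
    · rw [e1 _ _ h.ge, hP' _ _ h]
    · exact if_neg (not_le.2 h)
  refine ⟨O.lift E (fun ω z => ?_) (hedge E e1 e2), continuous_lift fun ω => ?_, fun ω z h => ?_⟩
  · rcases le_total 0 (g z) with h | h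
    · rw [e1 _ _ h, e2 _ _ (by rw [hrot]; linarith), flip_flip, rot_rot]
    · rw [e2 _ _ h, e1 _ _ (by rw [hrot]; linarith)]
  · exact Continuous.if_le (hP ω) ((hP _).comp continuous_rot) continuous_const hg
      fun z h => (hP' ω z h.symm).symm
  · rw [lift_opt, e1 _ _ h]

/-- The upper or lower half of the square contains a representative of each point. -/
theorem exists_opt_eq_of_fold (O : Origami ι) {g : UnitSquare → ℝ} (hrot : ∀ z, g (rot z) = -g z)
    (p : O.Surface) : ∃ ω z, 0 ≤ g z ∧ O.opt ω z = p := by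
  obtain ⟨ω, z, rfl⟩ := O.exists_opt_eq p
  rcases le_total 0 (g z) with h | h
  · exact ⟨ω, z, h, rfl⟩
  · exact ⟨flip ω, rot z, by rw [hrot]; linarith, O.opt_flip_rot ω z⟩

theorem squareProj_eq {z : UnitSquare} {v : ℝ × ℝ} (h : v = coord z) : squareProj v = z := by
  rw [h, squareProj_coord]

/-- The triangle `x + y ≤ 1` is a fundamental domain of the half rotation, and the shear maps it
onto the triangle `y ≤ x` of the same square. The left edge becomes the diagonal, so the half
rotation about its midpoint becomes the one about the centre; the lower edge is fixed. This explains
`h1` and `h3`. The inverse map is constructed on the second triangle. -/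
theorem exists_homeomorph_over_T {O : Origami ι} {O' : Origami κ} (φ : ι × Bool ≃ κ × Bool)
    (h1 : ∀ ω, φ (O.inv true ω) = flip (φ ω))
    (h2 : ∀ ω, φ (O.inv true (flip (O.inv true ω))) = O'.inv true (φ ω))
    (h3 : ∀ ω, φ (O.inv false ω) = O'.inv false (φ ω)) :
    ∃ f : O.Surface ≃ₜ O'.Surface, IsOver O O' (toReal ModularGroup.T) f := by
  set g : UnitSquare → ℝ := fun z => 1 - z.1 - z.2 with hg
  set g' : UnitSquare → ℝ := fun z => z.1 - z.2 with hg'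
  have hgrot : ∀ z, g (rot z) = -g z := by
    intro z; simp only [hg, rot, unitInterval.coe_symm_eq]; ring
  have hgrot' : ∀ z, g' (rot z) = -g' z := by
    intro z; simp only [hg', rot, unitInterval.coe_symm_eq]; ring
  -- The hypotenuse of the triangle becomes the right edge, so the half rotation about the centre
  -- becomes the one about the midpoint of the right edge.
  have k1 : ∀ ω, φ (flip ω) = flip (O'.inv true (flip (φ ω))) := by
    intro ω
    have := h1 (O.inv true (flip ω))
    rw [inv_inv] at this
    rw [this]
    have := h2 (O.inv true ω)
    rw [inv_inv] at this
    rw [this, h1]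
  have k2 : ∀ ω, φ.symm (flip ω) = O.inv true (φ.symm ω) := by
    intro ω
    rw [Equiv.symm_apply_eq, h1, Equiv.apply_symm_apply]
  have k3 : ∀ ω, φ.symm (O'.inv true ω) = O.inv true (flip (O.inv true (φ.symm ω))) := by
    intro ω
    rw [Equiv.symm_apply_eq, h2, Equiv.apply_symm_apply]
  have k4 : ∀ ω, φ.symm (O'.inv false ω) = O.inv false (φ.symm ω) := by
    intro ω
    rw [Equiv.symm_apply_eq, h3, Equiv.apply_symm_apply]
  obtain ⟨F, hF, hF'⟩ : ∃ F : O.Surface → O'.Surface, Continuous F ∧ ∀ ω z, 0 ≤ g z →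
      F (O.opt ω z) = O'.opt (φ ω) (squareProj ((coord z).1 + (coord z).2, (coord z).2)) := by
    refine exists_foldMap (by simp only [hg]; fun_prop) hgrot (fun ω => ?_) (fun ω z h => ?_)
      (fun E e1 e2 d ω u => ?_)
    · refine (O'.continuous_opt _).comp (continuous_squareProj.comp ?_)
      exact ((continuous_fst.add continuous_snd).prodMk continuous_snd).comp continuous_coord
    · have s1 : squareProj ((coord z).1 + (coord z).2, (coord z).2) = rot (mkPt true 0 (symm z.2)) := by
        apply squareProj_eq
        simp only [hg] at h
        simp [coord, rot, mkPt]
        linarith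
      have s2 : squareProj ((coord (rot z)).1 + (coord (rot z)).2, (coord (rot z)).2) =
          rot (mkPt true 0 z.2) := by
        apply squareProj_eq
        simp only [hg] at h
        simp [coord, rot, mkPt]
        linarith
      rw [s1, s2, k1, opt_flip_rot, ← opt_flip, ← O'.opt_inv true (flip (φ ω)), unitInterval.symm_symm]
    · cases d
      · rw [e1 _ _ (by simp [hg, mkPt, unitInterval.nonneg]), e1 _ _ (by simp [hg, mkPt, unitInterval.le_one])]
        have s : ∀ u : unitInterval, squareProj ((coord (mkPt false 0 u)).1 + (coord (mkPt false 0 u)).2,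
            (coord (mkPt false 0 u)).2) = mkPt false 0 u := by
          intro u
          apply squareProj_eq
          simp [coord, mkPt]
        rw [s, s, h3, opt_inv]
      · rw [e1 _ _ (by simp [hg, mkPt, unitInterval.nonneg]), e1 _ _ (by simp [hg, mkPt, unitInterval.le_one])]
        have s : ∀ u : unitInterval, squareProj ((coord (mkPt true 0 u)).1 + (coord (mkPt true 0 u)).2,
            (coord (mkPt true 0 u)).2) = (u, u) := by
          intro u
          apply squareProj_eq
          simp [coord, mkPt]
        rw [s, s, h1, show (symm u, symm u) = rot (u, u) from rfl, opt_flip_rot]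
  obtain ⟨G, hG, hG'⟩ : ∃ G : O'.Surface → O.Surface, Continuous G ∧ ∀ ω z, 0 ≤ g' z →
      G (O'.opt ω z) = O.opt (φ.symm ω) (squareProj ((coord z).1 - (coord z).2, (coord z).2)) := by
    refine exists_foldMap (by simp only [hg']; fun_prop) hgrot' (fun ω => ?_) (fun ω z h => ?_)
      (fun E e1 e2 d ω u => ?_)
    · refine (O.continuous_opt _).comp (continuous_squareProj.comp ?_)
      exact ((continuous_fst.sub continuous_snd).prodMk continuous_snd).comp continuous_coord
    · have s1 : squareProj ((coord z).1 - (coord z).2, (coord z).2) = mkPt true 0 z.2 := by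
        apply squareProj_eq
        simp only [hg'] at h
        simp [coord, mkPt]
        linarith
      have s2 : squareProj ((coord (rot z)).1 - (coord (rot z)).2, (coord (rot z)).2) =
          mkPt true 0 (symm z.2) := by
        apply squareProj_eq
        simp only [hg'] at h
        simp [coord, rot, mkPt]
        linarith
      rw [s1, s2, k2, opt_inv]
    · cases d
      · rw [e1 _ _ (by simp [hg', mkPt, unitInterval.le_one]), e1 _ _ (by simp [hg', mkPt, unitInterval.nonneg])]
        have s : ∀ u : unitInterval, squareProj ((coord (mkPt false 0 u)).1 - (coord (mkPt false 0 u)).2,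
            (coord (mkPt false 0 u)).2) = mkPt false 0 u := by
          intro u
          apply squareProj_eq
          simp [coord, mkPt]
        rw [s, s, k4, opt_inv]
      · rw [e2 _ _ (by simp [hg', mkPt, unitInterval.le_one]), e2 _ _ (by simp [hg', mkPt, unitInterval.nonneg])]
        have s : ∀ u : unitInterval, squareProj ((coord (rot (mkPt true 0 u))).1 -
            (coord (rot (mkPt true 0 u))).2, (coord (rot (mkPt true 0 u))).2) = (u, symm u) := by
          intro u
          apply squareProj_eq
          simp [coord, mkPt, rot]
        rw [s, s, k2, k3, inv_inv, k2, unitInterval.symm_symm,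
          show (symm u, u) = rot (u, symm u) by simp [rot], opt_flip_rot]
  refine ⟨⟨⟨F, G, fun p => ?_, fun p => ?_⟩, hF, hG⟩, fun ω z => ?_⟩
  · obtain ⟨ω, z, hz, rfl⟩ := O.exists_opt_eq_of_fold hgrot p
    have e : coord (squareProj ((coord z).1 + (coord z).2, (coord z).2)) =
        ((coord z).1 + (coord z).2, (coord z).2) := by
      simp only [hg] at hz
      exact coord_squareProj ⟨add_nonneg z.1.2.1 z.2.2.1, by simp only [coord]; linarith⟩ z.2.2
    rw [hF' _ _ hz, hG', Equiv.symm_apply_apply, e]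
    · simp only [add_sub_cancel_right]
      rw [squareProj_eq (z := z) rfl]
    · have e1 := congrArg Prod.fst e
      have e2 := congrArg Prod.snd e
      simp only [coord] at e1 e2
      simp only [hg', coord, e1, e2]
      simpa using z.1.2.1
  · obtain ⟨ω, z, hz, rfl⟩ := O'.exists_opt_eq_of_fold hgrot' p
    have e : coord (squareProj ((coord z).1 - (coord z).2, (coord z).2)) =
        ((coord z).1 - (coord z).2, (coord z).2) := by
      simp only [hg'] at hz
      have h4 := z.1.2.2
      have h5 := z.2.2.1
      exact coord_squareProj ⟨hz, by simp only [coord]; linarith⟩ z.2.2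
    rw [hG' _ _ hz, hF', Equiv.apply_symm_apply, e]
    · simp only [sub_add_cancel]
      rw [squareProj_eq (z := z) rfl]
    · have e1 := congrArg Prod.fst e
      have e2 := congrArg Prod.snd e
      simp only [coord] at e1 e2
      simp only [hg, coord, e1, e2]
      linarith [z.1.2.2]
  · have key : ∀ ω z, 0 ≤ g z → O'.dev (F (O.opt ω z)) =
        pillow (planeMap (toReal ModularGroup.T) (coord z)) := by
      intro ω z hz
      rw [hF' _ _ hz, dev_opt, planeMap_T, coord_squareProj _ z.2.2]
      simp only [hg] at hz
      exact ⟨add_nonneg z.1.2.1 z.2.2.1, by simp only [coord]; linarith⟩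
    show O'.dev (F _) = _
    rcases le_total 0 (g z) with h | h
    · exact key ω z h
    · rw [← O.opt_flip_rot, key _ _ (by rw [hgrot]; linarith), coord_rot, planeMap_add,
        planeMap_intVec, planeMap_smul, pillow_smul_add]

end Origami

/-! ### The Veech group -/

namespace Origami

variable {ι κ : Type}

theorem toReal_mul (A B : Matrix.SpecialLinearGroup (Fin 2) ℤ) :
    toReal (A * B) = toReal A * toReal B := map_mul _ _ _

theorem toReal_one : toReal 1 = 1 := map_one _

theorem IsOver.symm {O : Origami ι} {O' : Origami κ} {B : Matrix.SpecialLinearGroup (Fin 2) ℤ}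
    {f : O.Surface ≃ₜ O'.Surface} (hf : IsOver O O' (toReal B) f) :
    IsOver O' O (toReal B⁻¹) f.symm := by
  intro ω z
  obtain ⟨ω', w, hw⟩ := O.exists_opt_eq (f.symm (O'.opt ω z))
  have h := hf ω' w
  rw [hw, f.apply_symm_apply, dev_opt] at h
  obtain ⟨s, n, hn⟩ := pillow_eq_pillow h
  rw [← hw, dev_opt, hn, planeMap_add, planeMap_intVec, planeMap_smul, pillow_smul_add,
    ← planeMap_mul, ← toReal_mul, inv_mul_cancel, toReal_one, planeMap_one]

/-- The integral matrices over which there are homeomorphisms. -/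
def matrixGroup (O : Origami ι) : Subgroup (Matrix.SpecialLinearGroup (Fin 2) ℤ) where
  carrier := {B | ∃ f : O.Surface ≃ₜ O.Surface, IsOver O O (toReal B) f}
  mul_mem' := by
    rintro A B ⟨f, hf⟩ ⟨g, hg⟩
    exact ⟨g.trans f, by rw [toReal_mul]; exact hf.comp hg⟩
  one_mem' := ⟨Homeomorph.refl _, by rw [toReal_one]; exact isOver_one_iff.2 fun _ => rfl⟩
  inv_mem' := by
    rintro A ⟨f, hf⟩
    exact ⟨f.symm, hf.symm⟩

theorem veechGroup_eq [Finite ι] [Nonempty ι] {O : Origami ι}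
    (hS : ModularGroup.S ∈ O.matrixGroup) (hT : ModularGroup.T ∈ O.matrixGroup) :
    O.veechGroup = (modularGroup : Set (Matrix.ProjectiveSpecialLinearGroup (Fin 2) ℝ)) := by
  have htop : O.matrixGroup = ⊤ := by
    rw [eq_top_iff, ← SpecialLinearGroup.SL2Z_generators, Subgroup.closure_le]
    rintro B (rfl | rfl)
    exacts [hS, hT]
  ext x
  constructor
  · rintro ⟨A, f, hf, rfl⟩
    obtain ⟨-, B, rfl⟩ := hf.exists_isOver
    exact ⟨B, rfl⟩
  · rintro ⟨B, rfl⟩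
    obtain ⟨f, hf⟩ : B ∈ O.matrixGroup := htop ▸ Subgroup.mem_top B
    exact ⟨toReal B, f, hf.isAffine, rfl⟩

/-- A class in `PSL(2,ℝ)` gives the matrix up to sign only, which is harmless because `pillow` is
even. -/
theorem mem_matrixGroup [Finite ι] [Nonempty ι] {O : Origami ι}
    (h : O.veechGroup = (modularGroup : Set (Matrix.ProjectiveSpecialLinearGroup (Fin 2) ℝ)))
    (B : Matrix.SpecialLinearGroup (Fin 2) ℤ) : B ∈ O.matrixGroup := by
  have h1 : (QuotientGroup.mk (toReal B) : Matrix.ProjectiveSpecialLinearGroup (Fin 2) ℝ) ∈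
      O.veechGroup := by
    rw [h]
    exact ⟨B, rfl⟩
  obtain ⟨A, f, hf, hA⟩ := h1
  have h2 := QuotientGroup.eq.1 hA
  obtain ⟨r, hr, hr'⟩ := Matrix.SpecialLinearGroup.mem_center_iff.1 h2
  obtain ⟨hf, -⟩ := hf.exists_isOver
  have h3 : toReal B = A * (A⁻¹ * toReal B) := by rw [mul_inv_cancel_left]
  rw [Fintype.card_fin, pow_two, mul_self_eq_one_iff] at hr
  rcases hr with rfl | rfl
  · have h4 : A⁻¹ * toReal B = 1 := Subtype.ext (by rw [← hr', map_one]; rfl)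
    rw [h4, mul_one] at h3
    exact ⟨f, h3 ▸ hf⟩
  · have h4 : A⁻¹ * toReal B = -1 := Subtype.ext (by rw [← hr', map_neg, map_one]; rfl)
    rw [h4, mul_neg, mul_one] at h3
    exact ⟨f, h3 ▸ hf.neg⟩

theorem flip_involutive : Function.Involutive (flip : ι × Bool → ι × Bool) := flip_flip

theorem inv_involutive (O : Origami ι) (d : Bool) : Function.Involutive (O.inv d) := O.inv_inv d

/-- The change of placement as a permutation. -/
def flipPerm : Equiv.Perm (ι × Bool) := flip_involutive.toPerm

/-- The adjacency of placed squares as a permutation. -/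
def invPerm (O : Origami ι) (d : Bool) : Equiv.Perm (ι × Bool) := (O.inv_involutive d).toPerm

theorem isInvolutionTriple (O : Origami ι) (hO : ConnectedSpace O.Surface) :
    IsInvolutionTriple flipPerm (O.invPerm true) (O.invPerm false) where
  mul_self_a := Equiv.ext flip_flip
  mul_self_b := Equiv.ext (O.inv_inv true)
  mul_self_c := Equiv.ext (O.inv_inv false)
  a_ne := flip_ne
  b_ne := O.inv_ne true
  c_ne := O.inv_ne false
  trans S hS h := by
    classical
    have h1 : ∀ ω, flip ω ∈ S ↔ ω ∈ S := fun ω =>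
      ⟨fun hω => by have := (h _ hω).1; rwa [show flipPerm (flip ω) = ω from flip_flip ω] at this,
        fun hω => (h _ hω).1⟩
    have h2 : ∀ d ω, O.inv d ω ∈ S ↔ ω ∈ S := by
      have key : ∀ d ω, ω ∈ S → O.inv d ω ∈ S := fun d ω hω => by
        cases d
        exacts [(h _ hω).2.2, (h _ hω).2.1]
      exact fun d ω => ⟨fun hω => by have := key d _ hω; rwa [inv_inv] at this, key d ω⟩
    have hc : Continuous (O.lift (fun ω _ => decide (ω ∈ S)) (fun ω z => by simp only [h1])
        (fun d ω u => by simp only [h2])) := continuous_lift fun ω => continuous_const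
    obtain ⟨ω₀, hω₀⟩ := hS
    refine Set.eq_univ_of_forall fun ω => ?_
    have := PreconnectedSpace.constant inferInstance hc (x := O.opt ω (0, 0)) (y := O.opt ω₀ (0, 0))
    rw [lift_opt, lift_opt] at this
    simpa [hω₀] using this

/-- Without fixed points both cycle types consist of twos only, half as many as there are points. -/
theorem isConj_of_involutive {Ω : Type*} [Finite Ω] {x y : Equiv.Perm Ω} (hx : x * x = 1)
    (hy : y * y = 1) (hx' : ∀ p, x p ≠ p) (hy' : ∀ p, y p ≠ p) : IsConj x y := by
  classical
  have := Fintype.ofFinite Ω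
  have key : ∀ x : Equiv.Perm Ω, x * x = 1 → (∀ p, x p ≠ p) →
      x.cycleType = Multiset.replicate (Fintype.card Ω / 2) 2 := by
    intro x hx hx'
    have h1 : ∀ n ∈ x.cycleType, n = 2 := by
      intro n hn
      have h2 := Equiv.Perm.two_le_of_mem_cycleType hn
      have h3 := (Equiv.Perm.dvd_of_mem_cycleType hn).trans
        (orderOf_dvd_of_pow_eq_one (n := 2) (by rw [pow_two, hx]))
      exact le_antisymm (Nat.le_of_dvd two_pos h3) h2
    have h2 := Multiset.eq_replicate_of_mem h1
    have h3 : x.support = Finset.univ := by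
      ext p
      simp [hx' p]
    have h4 := x.sum_cycleType
    rw [h2, Multiset.sum_replicate, h3, Finset.card_univ, smul_eq_mul] at h4
    rw [h2]
    congr 1
    omega
  rw [Equiv.Perm.isConj_iff_cycleType_eq, key x hx hx', key y hy hy']

theorem exists_equiv_of_isOver [Finite ι] [Finite κ] {O : Origami ι} {O' : Origami κ}
    {B : Matrix.SpecialLinearGroup (Fin 2) ℤ} {f : O.Surface ≃ₜ O.Surface}
    {g : O.Surface ≃ₜ O'.Surface} (hf : IsOver O O (toReal B) f) (hg : IsOver O O' (toReal B) g) :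
    ∃ φ : κ × Bool ≃ ι × Bool, Intertwines O' O φ := by
  apply exists_equiv_of_isOver_one (f := g.symm.trans f)
  have := hf.comp hg.symm
  rw [← toReal_mul, mul_inv_cancel, toReal_one] at this
  exact this

/-- Each transformed triple is realized by an origami that receives a model homeomorphism from `O`
over the generator. Composing its inverse with a self-homeomorphism of `O` over the same generator
gives a map over the identity, hence a relabelling that conjugates the triples. -/
theorem isModularTriple [Finite ι] [Nonempty ι] {O : Origami ι} (hO : ConnectedSpace O.Surface)
    (h : O.veechGroup = (modularGroup : Set (Matrix.ProjectiveSpecialLinearGroup (Fin 2) ℝ))) :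
    IsModularTriple flipPerm (O.invPerm true) (O.invPerm false) where
  toIsInvolutionTriple := O.isInvolutionTriple hO
  shear := by
    have ht := O.isInvolutionTriple hO
    obtain ⟨f, hf⟩ := mem_matrixGroup h ModularGroup.T
    -- The first involution of an origami is always `flipPerm`. The shear puts `b` in its place, so
    -- the triple is first conjugated by some `φ` that takes `b` to `flipPerm`.
    obtain ⟨φ, hφ⟩ := isConj_iff.1 (isConj_of_involutive ht.mul_self_b ht.mul_self_a ht.b_ne ht.a_ne)
    let t : Bool → Equiv.Perm (ι × Bool) := fun d => φ *
      (if d then O.invPerm true * flipPerm * O.invPerm true else O.invPerm false) * φ⁻¹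
    have htt : ∀ d ω, t d (t d ω) = ω := by
      intro d ω
      cases d <;> simp [t, ht.a_a, ht.b_b, ht.c_c]
    have htn : ∀ d ω, t d ω ≠ ω := by
      intro d ω hω
      cases d
      · apply ht.c_ne (φ⁻¹ ω)
        apply φ.injective
        simpa [t] using hω
      · apply ht.a_ne (O.invPerm true (φ⁻¹ ω))
        apply (O.invPerm true).injective
        apply φ.injective
        rw [ht.b_b]
        simpa [t] using hω
    obtain ⟨g, hg⟩ := exists_homeomorph_over_T (O := O) (O' := ofInvs (fun d => t d) htt htn) φ
      (fun ω => by
        have := congrArg (fun x : Equiv.Perm _ => x (φ ω)) hφ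
        simp only [Equiv.Perm.mul_apply, ← Equiv.Perm.mul_apply φ⁻¹ φ, inv_mul_cancel,
          Equiv.Perm.one_apply] at this
        exact this)
      (fun ω => by
        rw [inv_ofInvs]
        simp [t]
        rfl)
      (fun ω => by
        rw [inv_ofInvs]
        simp [t]
        rfl)
    obtain ⟨ψ, hψ⟩ := exists_equiv_of_isOver hf hg
    have e1 : SemiconjBy (ψ : Equiv.Perm _) flipPerm flipPerm := Equiv.ext hψ.flip
    have e2 : ∀ d, SemiconjBy (ψ : Equiv.Perm _) (t d) (O.invPerm d) := fun d => Equiv.ext fun ω => by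
      have := hψ.inv d ω
      rwa [inv_ofInvs] at this
    have e3 : SemiconjBy φ (O.invPerm true) flipPerm := by
      rw [SemiconjBy, ← hφ, inv_mul_cancel_right]
    have e4 : ∀ x, SemiconjBy φ x (φ * x * φ⁻¹) := fun x => by
      rw [SemiconjBy, inv_mul_cancel_right]
    exact ⟨(ψ * φ)⁻¹, (e1.mul_left e3).inv_symm_left, ((e2 true).mul_left (e4 _)).inv_symm_left,
      ((e2 false).mul_left (e4 _)).inv_symm_left⟩
  rotation := by
    have ht := O.isInvolutionTriple hO
    obtain ⟨f, hf⟩ := mem_matrixGroup h ModularGroup.S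
    let t : Bool → Equiv.Perm (ι × Bool) := fun d =>
      if d then flipPerm * O.invPerm false * flipPerm else O.invPerm true
    have htt : ∀ d ω, t d (t d ω) = ω := by
      intro d ω
      cases d <;> simp [t, ht.a_a, ht.b_b, ht.c_c]
    have htn : ∀ d ω, t d ω ≠ ω := by
      intro d ω hω
      cases d
      · exact ht.b_ne ω hω
      · apply ht.c_ne (flipPerm ω)
        apply flipPerm.injective
        rw [ht.a_a]
        exact hω
    obtain ⟨g, hg⟩ := exists_homeomorph_over_S (O := O) (O' := ofInvs (fun d => t d) htt htn)
      (Equiv.refl _) (fun ω => rfl) (fun ω => by rw [inv_ofInvs]; rfl)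
      (fun ω => by
        rw [inv_ofInvs]
        show flipPerm _ = flipPerm (O.invPerm false (flipPerm (flipPerm ω)))
        rw [ht.a_a]
        rfl)
    obtain ⟨ψ, hψ⟩ := exists_equiv_of_isOver hf hg
    have e1 : SemiconjBy (ψ : Equiv.Perm _) flipPerm flipPerm := Equiv.ext hψ.flip
    have e2 : ∀ d, SemiconjBy (ψ : Equiv.Perm _) (t d) (O.invPerm d) := fun d => Equiv.ext fun ω => by
      have := hψ.inv d ω
      rwa [inv_ofInvs] at this
    exact ⟨ψ⁻¹, SemiconjBy.inv_symm_left e1, SemiconjBy.inv_symm_left (e2 true),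
      SemiconjBy.inv_symm_left (e2 false)⟩

end Origami

/-! ### Vertices, and orientations of the squares -/

namespace Origami

variable {ι κ : Type}

open unitInterval (symm)

/-- The corners of the squares as lower left (`false`) and lower right (`true`) corners of placed
squares. -/
def cornerRep (x : (ι × Bool) × Bool) : Squares ι := rep x.1 (if x.2 then (1, 0) else (0, 0))

theorem cornerRep_injective : Function.Injective (cornerRep : (ι × Bool) × Bool → Squares ι) := by
  rintro ⟨ω, b⟩ ⟨ω', b'⟩ h
  rcases rep_eq_rep h with ⟨h1, h2⟩ | ⟨-, h2⟩
  · obtain rfl : ω' = ω := h1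
    cases b <;> cases b' <;> simp_all
  · exfalso
    cases b <;> cases b' <;> simp [rot] at h2

theorem isCorner_cornerRep (x : (ι × Bool) × Bool) : IsCorner (cornerRep x).2 := by
  rw [cornerRep, isCorner_rep]
  obtain ⟨ω, b⟩ := x
  cases b <;> simp [IsCorner]

theorem exists_cornerRep_eq {p : Squares ι} (hp : IsCorner p.2) : ∃ x, cornerRep x = p := by
  obtain ⟨ω, z, rfl⟩ := exists_rep_eq p
  rw [isCorner_rep] at hp
  obtain ⟨x, y⟩ := z
  obtain ⟨h1 | h1, h2 | h2⟩ := hp <;> obtain rfl : x = _ := h1 <;> obtain rfl : y = _ := h2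
  · exact ⟨(ω, false), rfl⟩
  · refine ⟨(flip ω, true), ?_⟩
    rw [← rep_flip ω]
    simp [cornerRep, rot]
  · exact ⟨(ω, true), rfl⟩
  · refine ⟨(flip ω, false), ?_⟩
    rw [← rep_flip ω]
    simp [cornerRep, rot]

/-- The adjacency of corners across the lower edge. -/
theorem mk_cornerRep_lower (O : Origami ι) (ω : ι × Bool) (b : Bool) :
    Quot.mk O.Rel (cornerRep (O.inv false ω, !b)) = Quot.mk O.Rel (cornerRep (ω, b)) := by
  have := O.opt_inv false ω (if b then 1 else 0)
  cases b <;> simpa [opt, cornerRep, mkPt] using this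

/-- The adjacency of corners across the left edge. -/
theorem mk_cornerRep_left (O : Origami ι) (ω : ι × Bool) :
    Quot.mk O.Rel (cornerRep (flip (O.inv true ω), true)) = Quot.mk O.Rel (cornerRep (ω, false)) := by
  have := O.opt_inv true ω 0
  rw [← opt_flip_rot] at this
  simpa [opt, cornerRep, mkPt, rot] using this

/-- The two corners following a given one in the circular order around a vertex belong to this
permutation of the placed squares. -/
def around (O : Origami ι) (ω : ι × Bool) : ι × Bool := O.inv false (flip (O.inv true ω))

theorem mk_cornerRep_around (O : Origami ι) (ω : ι × Bool) :
    Quot.mk O.Rel (cornerRep (O.around ω, false)) = Quot.mk O.Rel (cornerRep (ω, false)) := by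
  rw [← mk_cornerRep_left O ω, ← mk_cornerRep_lower O (flip (O.inv true ω)) true]
  rfl

/-- A corner lies on two edges: the lower one, and the left or the right one. Crossing them gives
all its elementary identifications. -/
theorem rel_cornerRep {O : Origami ι} {x y : (ι × Bool) × Bool} (h : O.Rel (cornerRep x) (cornerRep y)) :
    y = (O.inv false x.1, !x.2) ∨ (x.2 = false ∧ y = (flip (O.inv true x.1), true)) ∨
      (x.2 = true ∧ y = (O.inv true (flip x.1), false)) := by
  obtain ⟨d, ω, u, h1, h2⟩ := O.rel_iff.1 h
  obtain ⟨θ, b⟩ := x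
  have lower : ∀ b, mkPt false 0 u = (if b then (1, 0) else (0, 0)) →
      rep (O.inv false ω) (mkPt false 0 (symm u)) = cornerRep (O.inv false ω, !b) := by
    intro b hb
    cases b <;> simp [mkPt] at hb <;> simp [cornerRep, hb, mkPt]
  rcases rep_eq_rep h1 with ⟨rfl, h3⟩ | ⟨rfl, h3⟩ <;> cases d <;> cases b <;>
    simp only [mkPt, rot, if_true, Bool.false_eq_true, if_false, Prod.mk.injEq,
      unitInterval.symm_zero, unitInterval.symm_one, zero_ne_one, and_false, false_and, true_and,
      and_true] at h3
  · left
    apply cornerRep_injective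
    rw [h2, h3]
    simp [cornerRep, mkPt]
  · left
    apply cornerRep_injective
    rw [h2, h3]
    simp [cornerRep, mkPt]
  · right; left
    refine ⟨rfl, ?_⟩
    apply cornerRep_injective
    rw [h2, h3, ← rep_flip]
    simp [cornerRep, mkPt, rot]
  · right; right
    refine ⟨rfl, ?_⟩
    apply cornerRep_injective
    rw [h2, h3]
    simp [cornerRep, mkPt]

/-- If `around` is an involution, all cone angles are at most `2 π`. -/
theorem around_around_ne {O : Origami ι} (h : O.IsNontrivial) : ¬ ∀ ω, O.around (O.around ω) = ω := by
  intro hτ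
  obtain ⟨v, hv⟩ := h
  have hc : ∀ ω, flip (O.inv true (O.around ω)) = O.inv false ω := by
    intro ω
    rw [← O.inv_inv false (flip _)]
    exact congrArg (O.inv false) (hτ ω)
  have hne : {c : Squares ι | IsCorner c.2 ∧ O.pt c.1 c.2 = v}.Nonempty := by
    by_contra hcon
    rw [Set.not_nonempty_iff_eq_empty] at hcon
    rw [cornerCount, hcon, Set.ncard_empty] at hv
    omega
  obtain ⟨p, hp, rfl⟩ := hne
  obtain ⟨ω, hω⟩ : ∃ ω, Quot.mk O.Rel (cornerRep (ω, false)) = Quot.mk O.Rel p := by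
    obtain ⟨⟨ω, b⟩, rfl⟩ := exists_cornerRep_eq hp
    cases b
    · exact ⟨ω, rfl⟩
    · exact ⟨O.inv false ω, O.mk_cornerRep_lower ω true⟩
  -- The corners met during two applications of `around`. The circle closes there because of `hc`,
  -- so these are all corners at the vertex.
  set K : Set (Squares ι) := cornerRep '' {(ω, false), (flip (O.inv true ω), true),
    (O.around ω, false), (O.inv false ω, true)} with hK
  have hKR : ∀ p q, O.Rel p q → p ∈ K → q ∈ K := by
    rintro _ q hpq ⟨x, hx, rfl⟩
    obtain ⟨y, rfl⟩ := exists_cornerRep_eq (hpq.isCorner_iff.1 (isCorner_cornerRep x))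
    refine ⟨y, ?_, rfl⟩
    have := rel_cornerRep hpq
    rcases hx with rfl | rfl | rfl | rfl <;> simp only [Set.mem_insert_iff, Set.mem_singleton_iff]
    · rcases this with rfl | ⟨-, rfl⟩ | ⟨h, -⟩
      · simp
      · simp
      · simp at h
    · rcases this with rfl | ⟨h, -⟩ | ⟨-, rfl⟩
      · simp [around]
      · simp at h
      · simp
    · rcases this with rfl | ⟨-, rfl⟩ | ⟨h, -⟩
      · simp [around]
      · simp [hc]
      · simp at h
    · rcases this with rfl | ⟨h, -⟩ | ⟨-, rfl⟩
      · simp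
      · simp at h
      · rw [← hc]
        simp
  have hKe : ∀ p q, Quot.mk O.Rel p = Quot.mk O.Rel q → p ∈ K → q ∈ K := by
    intro p q h hp
    have hP : ∀ a b, O.Rel a b → (a ∈ K) = (b ∈ K) := fun a b hab =>
      propext ⟨hKR a b hab, hKR b a hab.symm⟩
    have : (p ∈ K) = (q ∈ K) := congrArg (Quot.lift (fun p => p ∈ K) hP) h
    exact this.mp hp
  have hle : {c : Squares ι | IsCorner c.2 ∧ O.pt c.1 c.2 = O.pt p.1 p.2} ⊆ K := by
    rintro c ⟨-, h2⟩
    exact hKe _ c (hω.trans h2.symm) ⟨_, Or.inl rfl, rfl⟩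
  have hfin : ({(ω, false), (flip (O.inv true ω), true), (O.around ω, false),
    (O.inv false ω, true)} : Set ((ι × Bool) × Bool)).Finite := Set.toFinite _
  have h1 := Set.ncard_le_ncard hle (hfin.image _)
  have h2 : K.ncard ≤ 4 := by
    refine (Set.ncard_image_le hfin).trans ?_
    refine (Set.ncard_insert_le _ _).trans (Nat.succ_le_succ ?_)
    refine (Set.ncard_insert_le _ _).trans (Nat.succ_le_succ ?_)
    exact (Set.ncard_insert_le _ _).trans (by rw [Set.ncard_singleton])
  rw [cornerCount] at hv
  omega

/-- The corners around a vertex. -/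
theorem card_le_cornerCount [Finite ι] (O : Origami ι) {v : O.Surface}
    (s : Finset ((ι × Bool) × Bool)) (hs : ∀ x ∈ s, Quot.mk O.Rel (cornerRep x) = v) :
    s.card ≤ O.cornerCount v := by
  rw [cornerCount, ← Set.ncard_coe_finset, ← Set.ncard_image_of_injective _ cornerRep_injective]
  refine Set.ncard_le_ncard ?_ (finite_setOf_isCorner.subset fun c hc => hc.1)
  rintro _ ⟨x, hx, rfl⟩
  exact ⟨isCorner_cornerRep x, hs x hx⟩

/-! ### Abelian origamis -/

/-- With opposite signs `coord` would be constant near `z`, but the square has no isolated points.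
-/
theorem units_smul_coord_injective {z : UnitSquare} {s s' : ℤˣ} {c c' : ℝ × ℝ}
    (h : ∀ᶠ w in 𝓝 z, s • coord w + c = s' • coord w + c') : s = s' := by
  have : (𝓝[≠] z).NeBot := inferInstance
  obtain ⟨w, hw, hwz⟩ := ((h.filter_mono nhdsWithin_le_nhds).and
    (self_mem_nhdsWithin : {z}ᶜ ∈ 𝓝[≠] z)).exists
  have hz := h.self_of_nhds
  by_contra hs
  have hs' : s' = -s := by
    rcases Int.units_eq_one_or s with rfl | rfl <;> rcases Int.units_eq_one_or s' with rfl | rfl <;>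
      simp_all
  subst hs'
  apply hwz
  apply coord_injective
  have h1 : s • (coord w - coord z) = (-s) • (coord w - coord z) := by
    rw [smul_sub, smul_sub, sub_eq_sub_iff_add_eq_add]
    have h2 : s • coord w + c + ((-s) • coord z + c') = (-s) • coord w + c' + (s • coord z + c) := by
      rw [hw, hz]
    have h3 : s • coord w + (-s) • coord z + (c + c') = (-s) • coord w + s • coord z + (c + c') := by
      rw [add_add_add_comm] at h2
      rw [h2, add_add_add_comm, add_comm c' c]
    exact add_right_cancel h3
  have h2 : (coord w - coord z) + (coord w - coord z) = 0 := by
    rw [Units.neg_smul, eq_neg_iff_add_eq_zero, ← smul_add] at h1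
    rw [← units_smul_cancel s (_ + _), h1, smul_zero]
  have h3 : (2 : ℝ) • (coord w - coord z) = 0 := by rw [two_smul]; exact h2
  exact sub_eq_zero.1 ((smul_eq_zero.1 h3).resolve_left two_ne_zero)

/-- In an abelian origami the placed squares have signs. -/
theorem IsAbelian.exists_sign {O : Origami ι} (h : O.IsAbelian) : ∃ σ : ι × Bool → ℤˣ,
    (∀ ω, σ (flip ω) = -σ ω) ∧ ∀ d ω, σ (O.inv d ω) = -σ ω := by
  obtain ⟨T, hT, hcov, htr⟩ := h
  -- The sign of a chart from `T` relative to the coordinate of the placed square. The choice of the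
  -- chart does not matter, since transition maps are translations.
  let R : ι × Bool → UnitSquare → ℤˣ → Prop := fun ω z s => ∃ e ∈ T, O.opt ω z ∈ e.source ∧
    ∃ c, ∀ᶠ w in 𝓝 z, e (O.opt ω w) = s • coord w + c
  have hex : ∀ ω z, ¬ IsCorner z → ∃ s, R ω z s := by
    intro ω z hz
    obtain ⟨e, he, hp⟩ := hcov (O.opt ω z) (fun h => hz (opt_mem_vertices.1 h))
    obtain ⟨s, c, hc⟩ := (hT e he).exists_opt hp
    exact ⟨s, e, he, hp, c, hc⟩
  have huniq : ∀ ω z s s', R ω z s → R ω z s' → s = s' := by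
    rintro ω z s s' ⟨e, he, hp, c, hc⟩ ⟨e', he', hp', c', hc'⟩
    obtain ⟨c'', h1⟩ := htr e he e' he' _ ⟨hp, hp'⟩
    have h2 : ∀ᶠ w in 𝓝 z, s • coord w + (c + c'') = s' • coord w + c' := by
      filter_upwards [hc, hc', (O.continuous_opt ω).continuousAt.eventually h1] with w a1 a2 a3
      rw [← a2, a3, a1, add_assoc]
    exact units_smul_coord_injective h2
  have hloc : ∀ ω z s, R ω z s → ∀ᶠ w in 𝓝 z, R ω w s := by
    rintro ω z s ⟨e, he, hp, c, hc⟩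
    filter_upwards [eventually_eventually_nhds.2 hc,
      (O.continuous_opt ω).continuousAt.eventually (e.open_source.mem_nhds hp)] with w h1 h2
    exact ⟨e, he, h2, c, h1⟩
  have hflip : ∀ ω z s, R ω z s → R (flip ω) (rot z) (-s) := by
    rintro ω z s ⟨e, he, hp, c, hc⟩
    refine ⟨e, he, by rwa [opt_flip_rot], s • intVec (1, 1) + c, ?_⟩
    have h1 : Filter.Tendsto rot (𝓝 (rot z)) (𝓝 z) := by
      have := continuous_rot.tendsto (rot z)
      rwa [rot_rot] at this
    filter_upwards [h1.eventually hc] with w hw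
    rw [opt_flip, hw, coord_rot, smul_add, smul_smul, mul_neg_one, add_assoc]
  set V : Set (ℝ × ℝ) := Set.Ioo (0 : ℝ) 1 ×ˢ Set.Ioo (0 : ℝ) 1 with hV
  have : PreconnectedSpace V :=
    Subtype.preconnectedSpace (isPreconnected_Ioo.prod isPreconnected_Ioo)
  have hinner : ∀ ω, ∃ s, ∀ z, IsInner z → R ω z s := by
    intro ω
    have hex' : ∀ v : V, ∃ s, R ω (squareProj v) s := fun v =>
      hex ω _ (isInner_squareProj v.2.1 v.2.2).not_isCorner
    choose s hs using hex'
    have hc : Continuous fun v : V => squareProj v := continuous_squareProj.comp continuous_subtype_val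
    have hlc : IsLocallyConstant s := by
      rw [IsLocallyConstant.iff_eventually_eq]
      intro v
      filter_upwards [hc.continuousAt.eventually (hloc _ _ _ (hs v))] with w hw
      exact huniq _ _ _ _ (hs w) hw
    have hv0 : ((1 / 2, 1 / 2) : ℝ × ℝ) ∈ V := by simp only [hV]; norm_num
    refine ⟨s ⟨_, hv0⟩, fun z hz => ?_⟩
    have := hs ⟨coord z, isInner_iff_coord.1 hz⟩
    rwa [squareProj_coord, hlc.apply_eq_of_preconnectedSpace _ ⟨_, hv0⟩] at this
  choose σ hσ using hinner
  have hall : ∀ ω z s, R ω z s → s = σ ω := by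
    intro ω z s hz
    obtain ⟨w, hw, hwi⟩ := mem_closure_iff_nhds.1 (dense_isInner z) _ (hloc ω z s hz)
    exact huniq _ _ _ _ hw (hσ ω w hwi)
  have hnc : ∀ ω, ∃ z s, R ω z s := fun ω => by
    obtain ⟨z, hz⟩ := dense_isInner.nonempty
    exact ⟨z, _, hσ ω z hz⟩
  refine ⟨σ, fun ω => ?_, fun d ω => ?_⟩
  · obtain ⟨z, s, hz⟩ := hnc ω
    rw [← hall _ _ _ hz, ← hall _ _ _ (hflip _ _ _ hz)]
  · have half : (1 / 2 : ℝ) ∈ unitInterval := by constructor <;> norm_num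
    have hp : O.opt ω (mkPt d 0 ⟨1 / 2, half⟩) ∉ O.vertices := by
      rw [opt_mem_vertices, isCorner_mkPt]
      rintro ⟨-, h | h⟩ <;> have := congrArg Subtype.val h <;> norm_num at this
    obtain ⟨e, he, hp⟩ := hcov _ hp
    obtain ⟨s, c, h1, h2⟩ := (hT e he).exists_opt_inv hp
    rw [← hall ω _ s ⟨e, he, hp, c, h1⟩]
    rw [← O.opt_inv] at hp
    exact (hall _ _ _ ⟨e, he, hp, _, h2⟩).symm

/-! ### Connectedness -/

/-- A clopen set contains all of a placed square or nothing of it, so it gives a set of placed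
squares closed under the three involutions. -/
theorem connectedSpace_surface {O : Origami ι} [Nonempty ι] (h : ∀ S : Set (ι × Bool), S.Nonempty →
    (∀ ω ∈ S, flip ω ∈ S ∧ O.inv true ω ∈ S ∧ O.inv false ω ∈ S) → S = Set.univ) :
    ConnectedSpace O.Surface := by
  have hne : Nonempty O.Surface := ⟨O.opt (Classical.arbitrary _, false) (0, 0)⟩
  refine { toNonempty := hne, toPreconnectedSpace := preconnectedSpace_iff_clopen.2 fun U hU => ?_ }
  have hUω : ∀ ω z w, O.opt ω z ∈ U → O.opt ω w ∈ U := by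
    intro ω z w hz
    have h1 : IsClopen (O.opt ω ⁻¹' U) := hU.preimage (O.continuous_opt ω)
    rcases isClopen_iff.1 h1 with h2 | h2
    · exact absurd (h2 ▸ hz : z ∈ (∅ : Set UnitSquare)) (Set.notMem_empty z)
    · exact (h2 ▸ Set.mem_univ w : w ∈ O.opt ω ⁻¹' U)
  rcases Set.eq_empty_or_nonempty U with hU' | ⟨p, hp⟩
  · exact Or.inl hU'
  right
  obtain ⟨ω₀, z₀, rfl⟩ := O.exists_opt_eq p
  have hS := h {ω | ∀ z, O.opt ω z ∈ U} ⟨ω₀, fun z => hUω _ _ _ hp⟩ fun ω hω => by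
    refine ⟨fun z => ?_, fun z => ?_, fun z => ?_⟩
    · rw [opt_flip]; exact hω _
    · exact hUω _ (mkPt true 0 (symm 0)) _ (by rw [opt_inv]; exact hω _)
    · exact hUω _ (mkPt false 0 (symm 0)) _ (by rw [opt_inv]; exact hω _)
  refine Set.eq_univ_of_forall fun q => ?_
  obtain ⟨ω, z, rfl⟩ := O.exists_opt_eq q
  have : ω ∈ {ω | ∀ z, O.opt ω z ∈ U} := hS ▸ Set.mem_univ ω
  exact this z

end Origami

/-! ### The origami of degree six -/

namespace Origami

theorem surface_charactaOrigami : ConnectedSpace charactaOrigami.Surface := by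
  refine connectedSpace_surface fun S hS h => ?_
  -- There is a single horizontal cylinder: moving along it, followed by at most one change of
  -- placement, reaches every placed square.
  have key : ∀ p q : Fin 6 × Bool, ∃ i : Fin 6, ∃ b : Bool, (flip^[b.toNat])
      ((fun ω => charactaOrigami.inv true (flip ω))^[i] p) = q := by
    decide +kernel
  obtain ⟨p, hp⟩ := hS
  refine Set.eq_univ_of_forall fun q => ?_
  obtain ⟨i, b, rfl⟩ := key p q
  have h1 : ∀ i : ℕ, (fun ω => charactaOrigami.inv true (flip ω))^[i] p ∈ S := by
    intro i
    induction i with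
    | zero => exact hp
    | succ i ih =>
      rw [Function.iterate_succ_apply']
      exact (h _ (h _ ih).1).2.1
  cases b
  · exact h1 i
  · exact (h _ (h1 i)).1

theorem isNontrivial_charactaOrigami : charactaOrigami.IsNontrivial := by
  -- Five distinct corners at one vertex; four would still allow the angle `2 π`.
  let s : Finset ((Fin 6 × Bool) × Bool) :=
    let τ := charactaOrigami.around
    let ω : Fin 6 × Bool := (0, false)
    {(ω, false), (τ ω, false), (τ (τ ω), false), (flip (charactaOrigami.inv true ω), true),
      (flip (charactaOrigami.inv true (τ ω)), true)}
  have hs : s.card = 5 := by decide +kernel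
  refine ⟨Quot.mk _ (cornerRep ((0, false), false)),
    lt_of_lt_of_le ?_ (card_le_cornerCount _ s fun x hx => ?_)⟩
  · rw [hs]; norm_num
  · simp only [s, Finset.mem_insert, Finset.mem_singleton] at hx
    rcases hx with rfl | rfl | rfl | rfl | rfl
    · rfl
    · exact mk_cornerRep_around _ _
    · exact (mk_cornerRep_around _ _).trans (mk_cornerRep_around _ _)
    · exact mk_cornerRep_left _ _
    · exact (mk_cornerRep_left _ _).trans (mk_cornerRep_around _ _)

theorem not_isAbelian_charactaOrigami : ¬ charactaOrigami.IsAbelian := by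
  intro h
  obtain ⟨σ, h1, h2⟩ := h.exists_sign
  -- Each of the three half rotations changes the sign, so a product of three of them has no fixed
  -- point if signs exist.
  obtain ⟨ω, hω⟩ : ∃ ω, flip (charactaOrigami.inv true (charactaOrigami.inv false ω)) = ω := by
    decide +kernel
  have h3 := congrArg σ hω
  rw [h1, h2, h2, neg_neg] at h3
  rcases Int.units_eq_one_or (σ ω) with h4 | h4 <;> rw [h4] at h3 <;> exact absurd h3 (by decide)

/-- The two permutations `φ` carry the triple of the origami to itself after its transformation by
`S` and by `T`; the conditions on them are finite checks. -/
theorem veechGroup_charactaOrigami : charactaOrigami.veechGroup =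
    (modularGroup : Set (Matrix.ProjectiveSpecialLinearGroup (Fin 2) ℝ)) := by
  apply veechGroup_eq
  · let φ : Fin 6 × Bool → Fin 6 × Bool := fun ω =>
      if ω.1.val % 2 = 0 then (ω.1 + 1, !ω.2) else (ω.1 - 1, ω.2)
    have hφ : Function.Injective φ := by decide +kernel
    exact exists_homeomorph_over_S (Equiv.ofBijective φ (Finite.injective_iff_bijective.1 hφ))
      (by decide +kernel : ∀ ω, φ (flip ω) = flip (φ ω))
      (by decide +kernel : ∀ ω, φ (charactaOrigami.inv true ω) = charactaOrigami.inv false (φ ω))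
      (by decide +kernel : ∀ ω, flip (φ (charactaOrigami.inv false ω)) =
        charactaOrigami.inv true (flip (φ ω)))
  · let φ : Fin 6 × Bool → Fin 6 × Bool := fun ω => (if ω.2 then ω.1 + 1 else ω.1, ω.2)
    have hφ : Function.Injective φ := by decide +kernel
    exact exists_homeomorph_over_T (Equiv.ofBijective φ (Finite.injective_iff_bijective.1 hφ))
      (by decide +kernel : ∀ ω, φ (charactaOrigami.inv true ω) = flip (φ ω))
      (by decide +kernel : ∀ ω, φ (charactaOrigami.inv true (flip (charactaOrigami.inv true ω))) =
        charactaOrigami.inv true (φ ω))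
      (by decide +kernel : ∀ ω, φ (charactaOrigami.inv false ω) = charactaOrigami.inv false (φ ω))

theorem iso_of_intertwines {ι κ : Type} [Finite ι] [Finite κ] {O : Origami ι} {O' : Origami κ}
    {φ : ι × Bool ≃ κ × Bool} (h : Intertwines O O' φ) : O.Iso O' := by
  obtain ⟨f, hf⟩ := exists_homeomorph_of_equiv h
  rw [← toReal_one] at hf
  refine ⟨f, ?_⟩
  rw [← toReal_one]
  exact hf.isAffine

theorem canonicalDouble_iso_ornithorynque :
    charactaOrigami.canonicalDouble.Iso Origami.ornithorynque := by
  -- The parity of the square decides between front and back of the pillowcase, and the two copies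
  -- of a square lie three sheets apart.
  let φ : (Fin 6 × Bool) × Bool → (ZMod 6 × Bool) × Bool := fun ω =>
    (((![0, 0, 4, 4, 2, 2] : Fin 6 → ZMod 6) ω.1.1 + if ω.1.2 then 3 else 0,
      ω.1.1.val % 2 == 0), xor ω.2 ω.1.2)
  have hfin : Finite (ZMod 6) := inferInstanceAs (Finite (Fin 6))
  have hinj : Function.Injective φ := by decide +kernel
  have hsurj : Function.Surjective φ := by decide +kernel
  exact iso_of_intertwines (φ := Equiv.ofBijective φ ⟨hinj, hsurj⟩)
    ⟨(by decide +kernel : ∀ ω, φ (flip ω) = flip (φ ω)),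
      (by decide +kernel : ∀ d ω, φ (charactaOrigami.canonicalDouble.inv d ω) =
        ornithorynque.inv d (φ ω))⟩

/-- The placed square with a given label. -/
def placed (k : Fin 12) : Fin 6 × Bool := (⟨k / 2, by omega⟩, k.val % 2 == 1)

theorem placed_targetTable : ∀ k l : Fin 12,
    (TripleSearch.digit TripleSearch.targetTable (3 * k + 0) = l + 1 → placed l = flip (placed k)) ∧
    (TripleSearch.digit TripleSearch.targetTable (3 * k + 1) = l + 1 →
      placed l = charactaOrigami.inv true (placed k)) ∧
    (TripleSearch.digit TripleSearch.targetTable (3 * k + 2) = l + 1 →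
      placed l = charactaOrigami.inv false (placed k)) := by
  decide +kernel

section

variable {d : ℕ} {O : Origami (Fin d)}

theorem exists_equiv_of_veechGroup_eq (hc : ConnectedSpace O.Surface) (hn : O.IsNontrivial)
    (hV : O.veechGroup = (modularGroup : Set (Matrix.ProjectiveSpecialLinearGroup (Fin 2) ℝ)))
    (hd : d ≤ 6) : ∃ φ : Fin d × Bool ≃ Fin 12, ∀ p, ∀ g < 3,
      TripleSearch.digit TripleSearch.targetTable (3 * (φ p : ℕ) + g) =
        (φ (tripleAct flipPerm (O.invPerm true) (O.invPerm false) g p) : ℕ) + 1 := by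
  have hne : Nonempty (Fin d) := by
    obtain ⟨ω, -, -⟩ := O.exists_opt_eq (Classical.arbitrary O.Surface)
    exact ⟨ω.1⟩
  refine (isModularTriple hc hV).exists_equiv_targetTable ?_ fun h => ?_
  · rw [Nat.card_prod, Nat.card_fin, Nat.card_eq_fintype_card, Fintype.card_bool]
    omega
  -- The permutation `c * a * b` of this triple is `around`.
  · exact around_around_ne hn fun ω => congrArg (fun x : Equiv.Perm _ => x ω) h

/-- For every degree up to six the classification puts the `2 * d` placed squares in bijection with
twelve labels. -/
theorem six_le_degree (hc : ConnectedSpace O.Surface) (hn : O.IsNontrivial)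
    (hV : O.veechGroup = (modularGroup : Set (Matrix.ProjectiveSpecialLinearGroup (Fin 2) ℝ))) :
    6 ≤ d := by
  by_contra hd
  obtain ⟨φ, -⟩ := exists_equiv_of_veechGroup_eq hc hn hV (by omega)
  have := Nat.card_congr φ
  rw [Nat.card_prod, Nat.card_fin, Nat.card_fin, Nat.card_eq_fintype_card, Fintype.card_bool] at this
  omega

theorem iso_charactaOrigami {O : Origami (Fin 6)} (hc : ConnectedSpace O.Surface)
    (hn : O.IsNontrivial)
    (hV : O.veechGroup = (modularGroup : Set (Matrix.ProjectiveSpecialLinearGroup (Fin 2) ℝ))) :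
    O.Iso charactaOrigami := by
  obtain ⟨φ, hφ⟩ := exists_equiv_of_veechGroup_eq hc hn hV le_rfl
  have hp : Function.Bijective placed := by
    constructor <;> decide +kernel
  refine iso_of_intertwines (φ := φ.trans (Equiv.ofBijective placed hp)) ⟨fun ω => ?_, fun d ω => ?_⟩
  · exact (placed_targetTable _ _).1 (hφ ω 0 (by norm_num))
  · cases d
    · exact (placed_targetTable _ _).2.2 (hφ ω 2 (by norm_num))
    · exact (placed_targetTable _ _).2.1 (hφ ω 1 (by norm_num))

end

end Origami

theorem mainTheorem1 :
    -- the origami is connected, nontrivial and non-abelian, with Veech group `PSL(2,ℤ)`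
    ConnectedSpace charactaOrigami.Surface ∧ charactaOrigami.IsNontrivial ∧
    ¬ charactaOrigami.IsAbelian ∧
    charactaOrigami.veechGroup = (modularGroup : Set (Matrix.ProjectiveSpecialLinearGroup (Fin 2) ℝ)) ∧
    -- no nontrivial origami of smaller degree has this Veech group
    (∀ (d : ℕ) (O : Origami (Fin d)), ConnectedSpace O.Surface → O.IsNontrivial →
      O.veechGroup = (modularGroup : Set (Matrix.ProjectiveSpecialLinearGroup (Fin 2) ℝ)) →
      6 ≤ d) ∧
    -- it is the only one of degree 6, up to isomorphism
    (∀ O : Origami (Fin 6), ConnectedSpace O.Surface → O.IsNontrivial →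
      O.veechGroup = (modularGroup : Set (Matrix.ProjectiveSpecialLinearGroup (Fin 2) ℝ)) →
      O.Iso charactaOrigami) ∧
    -- its canonical double cover is the Ornithorynque origami
    charactaOrigami.canonicalDouble.Iso Origami.ornithorynque := by
  exact ⟨Origami.surface_charactaOrigami, Origami.isNontrivial_charactaOrigami,
    Origami.not_isAbelian_charactaOrigami, Origami.veechGroup_charactaOrigami,
    fun _ _ => Origami.six_le_degree, fun _ => Origami.iso_charactaOrigami,
    Origami.canonicalDouble_iso_ornithorynque⟩
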